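/- Fix integers $e,\ell\ge 2$ and $s\in\mathbb Z$. Let $B_s$ be the set of charged $\ell$-partitions $|\lambda,\mathbf s\rangle$, where $\lambda=(\lambda^1,\dots,\lambda^\ell)$ is an $\ell$-tuple of partitions and $\mathbf s\in\mathbb Z^\ell$ satisfies $s_1+\dots+s_\ell=s$. A box $\gamma=(a,b,j)$ (row, column, component; $a,b\ge1$, $1\le j\le\ell$) has content $\mathfrak c(\gamma)=b-a+s_j$. Write $\gamma>\gamma'$ if $\mathfrak c(\gamma)>\mathfrak c(\gamma')$, or if $\mathfrak c(\gamma)=\mathfrak c(\gamma')$ and $j<j'$. **Kashiwara crystals.** For $i\in\mathbb Z/e$, write the addable ($A$) and removable ($R$) boxes of $|\lambda,\mathbf s\rangle$ with content $i$ modulo $e$ in increasing order, and delete factors $RA$ recursively until a word $A^pR^q$ remains. The operator $\tilde f_i$ adds the box of the last $A$ (value $0$ if $p=0$), and $\tilde e_i$ removes the box of the first $R$ (value $0$ if $q=0$). This is the $\mathcal U_q(\widehat{\mathfrak{sl}}_e)$-crystal on $B_s$. The $\ell$-abacus of $|\lambda,\mathbf s\rangle$ is the set of beads $\mathcal A(\lambda,\mathbf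 s)=\{(j,\lambda^j_k+s_j-k+1): 1\le j\le\ell,\ k\ge1\}$; in the same way charged $1$-partitions and charged $e$-partitions have a $1$-abacus and an $e$-abacus. Every $c\in\mathbb Z$ is $c=ze\ell-(y-1)e-(x-1)$ for unique $z\in\mathbb Z$, $1\le y\le\ell$, $1\le x\le e$; put $\tau(c)=(y,\,ez-(x-1))$ and $\dot\tau(c)=(x,\,\ell z-(y-1))$. Applied to beads, $\tau$ and $\dot\tau$ give bijections from charged partitions to charged $\ell$-partitions and to charged $e$-partitions. Level-rank duality sends $\tau|\lambda,s\rangle$ to $\dot\tau|\lambda',-s\rangle$, where $\lambda'$ is the conjugate partition. Through it, the operators of the $\mathcal U_p(\widehat{\mathfrak{sl}}_\ell)$-crystal (same rule, with $e$ and $\ell$ exchanged) act on $B_s$. An element of $B_s$ is a doubly highest weight vertex if the operators $\tilde e$ of both crystals all send it to $0$. **Heisenberg crystal operators.** The first $e$-period of a set of beads is, if it exists, the sequence of $e$ beads $(j_1,d_1),\dots,(j_e,d_e)$ such that $d_1$ is the rightmost position of a bead, $d_{i+1}=d_i-1$, $j_1\ge\dots\ge j_e$, and $j_i$ is the smallest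 row that contains a bead in position $d_i$; the $(k+1)$-st $e$-period is the first $e$-period after the first $k$ are removed. For a partition $\sigma$, a Heisenberg crystal operator $\tilde b_\sigma$ is a map $B_s\to B_s$ which preserves the charge and such that 1. if $|\lambda,\mathbf s\rangle$ is a doubly highest weight vertex, then the abacus has a $k$-th $e$-period for all $k\ge1$, and $\tilde b_\sigma$ shifts the $k$-th $e$-period by $\sigma_k$ steps to the right for all $k$; 2. $\tilde b_\sigma$ commutes with all operators $\tilde e,\tilde f$ of both Kashiwara crystals (with $\tilde b_\sigma(0)=0$). **Good vertical strips.** Let $\mathcal W(\lambda,\mathbf s)$ be the set of boxes directly to the right of $\lambda$, where each $\lambda^j$ is considered to have infinitely many zero parts. An admissible vertical $e$-strip of $|\lambda,\mathbf s\rangle$ is a sequence $(\gamma_1,\dots,\gamma_e)$ of boxes of $\mathcal W(\lambda,\mathbf s)$ with $\mathfrak c(\gamma_i)=\mathfrak c(\gamma_{i+1})+1$ and weakly decreasing components, no two successive boxes being in the same row of the same component. These strips are ordered lexicographically by $>$. The first good strip is the greatest one, and the $k$-th good strip is the greatest among those smaller than, and disjoint from, all of the first $k-1$ good strips. Let $\tilde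 c_\sigma|\lambda,\mathbf s\rangle$ be obtained from $|\lambda,\mathbf s\rangle$ by performing, for $k=1,2,\dots$ successively, $\sigma_k$ times the following step: add the $k$-th good vertical $e$-strip of the charged $\ell$-partition reached so far. **Theorem.** For every partition $\sigma$, the operator $\tilde b_\sigma$ exists and is unique, all the steps in the definition of $\tilde c_\sigma$ are possible for every element of $B_s$, and $\tilde c_\sigma=\tilde b_\sigma$. -/

import Mathlib

namespace FockSpace

/-- A charged `ℓ`-partition `|λ, s⟩`: an `ℓ`-tuple of partitions, as Young diagrams, together with
an `ℓ`-tuple of integers. -/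
@[ext]
structure ChargedPartition (ℓ : ℕ) where
  shape : Fin ℓ → YoungDiagram
  charge : Fin ℓ → ℤ

/-- A box `(a, b, j)`: row, column, component. All three are counted from `0`, which changes neither
the contents `b - a + s_j` nor any comparison of components. -/
@[ext]
structure Box (ℓ : ℕ) where
  row : ℕ
  col : ℕ
  comp : Fin ℓ

/-- The set `B_s` of charged `ℓ`-partitions whose charge has sum `s`. -/
def Basis (ℓ : ℕ) (s : ℤ) : Type := {x : ChargedPartition ℓ // ∑ j, x.charge j = s}

variable {ℓ : ℕ}

/-- The content `b - a + s_j` of a box. -/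
def content (x : ChargedPartition ℓ) (g : Box ℓ) : ℤ :=
  (g.col : ℤ) - (g.row : ℤ) + x.charge g.comp

/-- The boxes of the Young diagrams of `x`. -/
def boxes (x : ChargedPartition ℓ) : Set (Box ℓ) := {g | (g.row, g.col) ∈ x.shape g.comp}

/-- `y` is obtained from `x` by adding the set of boxes `X`: these boxes are not in `x`, and
`x ⊔ X` is the Young diagram of the `ℓ`-partition `y`, with the same charge. -/
def AddBoxes (x : ChargedPartition ℓ) (X : Set (Box ℓ)) (y : ChargedPartition ℓ) : Prop :=
  y.charge = x.charge ∧ Disjoint X (boxes x) ∧ boxes y = boxes x ∪ X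

/-- `BoxLT x g g'` is `g < g'`: the content of `g` is smaller, or the contents agree and the
component of `g` is larger. -/
def BoxLT (x : ChargedPartition ℓ) (g g' : Box ℓ) : Prop :=
  content x g < content x g' ∨ (content x g = content x g' ∧ g'.comp < g.comp)

/-- The partial map that sends `a` to the `b` with `r a b`, and to `none` (the element `0` of a
crystal) if there is none. It is used for relations that determine `b`. -/
noncomputable def partialMap {α : Type*} (r : α → α → Prop) (a : α) : Option α :=
  open Classical in if h : ∃ b, r a b then some h.choose else none

/-! ### Kashiwara crystals -/

/-- `w` is the word of the addable (marked `true`) and removable (marked `false`) boxes of `x`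
whose content is `i` modulo `m`, in increasing order. -/
def IsWord (m : ℕ) (i : ZMod m) (x : ChargedPartition ℓ) (w : List (Box ℓ × Bool)) : Prop :=
  w.Pairwise (fun t t' => BoxLT x t.1 t'.1) ∧
  ∀ g : Box ℓ,
    ((g, true) ∈ w ↔ (content x g : ZMod m) = i ∧ ∃ y, AddBoxes x {g} y) ∧
    ((g, false) ∈ w ↔ (content x g : ZMod m) = i ∧ ∃ y, AddBoxes y {g} x)

/-- The reduced word: all factors "removable, addable" are deleted recursively, until the word
consists of addable boxes followed by removable boxes. -/
def reduceWord : List (Box ℓ × Bool) → List (Box ℓ × Bool)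
  | [] => []
  | t :: w =>
    match t, reduceWord w with
    | (_, false), (_, true) :: r => r
    | t, r => t :: r

/-- The good addable `i`-box is the last addable box of the reduced word. -/
def IsGoodAddable (m : ℕ) (i : ZMod m) (x : ChargedPartition ℓ) (g : Box ℓ) : Prop :=
  ∃ w, IsWord m i x w ∧ ((reduceWord w).filter (fun t => t.2)).getLast? = some (g, true)

/-- The good removable `i`-box is the first removable box of the reduced word. -/
def IsGoodRemovable (m : ℕ) (i : ZMod m) (x : ChargedPartition ℓ) (g : Box ℓ) : Prop :=
  ∃ w, IsWord m i x w ∧ ((reduceWord w).filter (fun t => !t.2)).head? = some (g, false)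

/-- `y` is obtained from `x` by adding the good addable `i`-box of `x`. -/
def RaisesTo (m : ℕ) (i : ZMod m) (x y : ChargedPartition ℓ) : Prop :=
  ∃ g, IsGoodAddable m i x g ∧ AddBoxes x {g} y

/-- `y` is obtained from `x` by removing the good removable `i`-box of `x`. -/
def LowersTo (m : ℕ) (i : ZMod m) (x y : ChargedPartition ℓ) : Prop :=
  ∃ g, IsGoodRemovable m i x g ∧ AddBoxes y {g} x

/-! ### Abaci and level-rank duality -/

/-- The positions `λ_k + s - k + 1`, `k ≥ 1`, of the beads of `|λ, s⟩` on the `1`-abacus. -/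
def beads (lam : YoungDiagram) (s : ℤ) : Set ℤ :=
  {c | ∃ k : ℕ, c = (lam.rowLen k : ℤ) + s - (k : ℤ)}

/-- The `ℓ`-abacus of a charged `ℓ`-partition, rows counted from `0`. -/
def abacus (x : ChargedPartition ℓ) : Set (Fin ℓ × ℤ) :=
  {p | p.2 ∈ beads (x.shape p.1) (x.charge p.1)}

/-- `x = τ |λ, s⟩`. Every integer is `-z e ℓ + y e + r` for a unique `z` and unique `0 ≤ y < ℓ`,
`0 ≤ r < e`, and the bijection `τ` sends the position `c` for which `-c` is this integer to the
position `e z - r` in row `y` of the `ℓ`-abacus. -/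
def IsTau (e : ℕ) (lam : YoungDiagram) (s : ℤ) (x : ChargedPartition ℓ) : Prop :=
  ∀ (z : ℤ) (y : Fin ℓ) (r : Fin e),
    z * (e : ℤ) * (ℓ : ℤ) - (y : ℤ) * (e : ℤ) - (r : ℤ) ∈ beads lam s ↔
      (y, (e : ℤ) * z - (r : ℤ)) ∈ abacus x

/-- `x = τ̇ |λ, s⟩`, where `τ̇` sends the same position to the position `ℓ z - y` in row `r` of the
`e`-abacus. -/
def IsTauDot (ℓ : ℕ) {e : ℕ} (lam : YoungDiagram) (s : ℤ) (x : ChargedPartition e) : Prop :=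
  ∀ (z : ℤ) (y : Fin ℓ) (r : Fin e),
    z * (e : ℤ) * (ℓ : ℤ) - (y : ℤ) * (e : ℤ) - (r : ℤ) ∈ beads lam s ↔
      (r, (ℓ : ℤ) * z - (y : ℤ)) ∈ abacus x

/-- The charged `e`-partition `xd` is the (twisted) level-rank dual of the charged `ℓ`-partition
`x`: its image under the composition of `τ⁻¹`, conjugation `|λ, s⟩ ↦ |λ', -s⟩`, and `τ̇`. -/
def IsLevelRankDual {e : ℕ} (x : ChargedPartition ℓ) (xd : ChargedPartition e) : Prop :=
  ∃ (lam : YoungDiagram) (s : ℤ), IsTau e lam s x ∧ IsTauDot ℓ lam.transpose (-s) xd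

/-! ### The two families of Kashiwara crystal operators on `B_s` -/

variable {s : ℤ}

/-- The Kashiwara operator `f̃_i` of affine `sl_e`. -/
noncomputable def opF (e : ℕ) (i : ZMod e) : Basis ℓ s → Option (Basis ℓ s) :=
  partialMap fun x y => RaisesTo e i x.1 y.1

/-- The Kashiwara operator `ẽ_i` of affine `sl_e`. -/
noncomputable def opE (e : ℕ) (i : ZMod e) : Basis ℓ s → Option (Basis ℓ s) :=
  partialMap fun x y => LowersTo e i x.1 y.1

/-- The Kashiwara operator `f̃_j` of affine `sl_ℓ`, acting through level-rank duality. -/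
noncomputable def dualF (e : ℕ) (j : ZMod ℓ) : Basis ℓ s → Option (Basis ℓ s) :=
  partialMap fun x y => ∃ xd yd : ChargedPartition e,
    IsLevelRankDual x.1 xd ∧ IsLevelRankDual y.1 yd ∧ RaisesTo ℓ j xd yd

/-- The Kashiwara operator `ẽ_j` of affine `sl_ℓ`, acting through level-rank duality. -/
noncomputable def dualE (e : ℕ) (j : ZMod ℓ) : Basis ℓ s → Option (Basis ℓ s) :=
  partialMap fun x y => ∃ xd yd : ChargedPartition e,
    IsLevelRankDual x.1 xd ∧ IsLevelRankDual y.1 yd ∧ LowersTo ℓ j xd yd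

/-- Doubly highest weight vertices: highest weight vertices for both Kashiwara crystals. -/
def IsDoublyHighestWeight (e : ℕ) (x : Basis ℓ s) : Prop :=
  (∀ i : ZMod e, opE e i x = none) ∧ (∀ j : ZMod ℓ, dualE e j x = none)

/-! ### Periods and the Heisenberg crystal operators -/

/-- `P` is the first `e`-period of a bead configuration `A`: `e` beads in consecutive columns, read
from right to left and starting in the rightmost column of `A`, with weakly decreasing row indices,
each bead being the lowest one of its column. -/
def IsFirstPeriod {e : ℕ} (A : Set (Fin ℓ × ℤ)) (P : Fin e → Fin ℓ × ℤ) : Prop :=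
  (∀ i, P i ∈ A) ∧
  (∀ i : Fin e, (i : ℕ) = 0 → ∀ p ∈ A, p.2 ≤ (P i).2) ∧
  (∀ i i' : Fin e, (i' : ℕ) = i + 1 → (P i).2 = (P i').2 + 1) ∧
  (∀ i i' : Fin e, i < i' → (P i').1 ≤ (P i).1) ∧
  (∀ i, ∀ p ∈ A, p.2 = (P i).2 → (P i).1 ≤ p.1)

/-- `P 0, P 1, …` are the successive `e`-periods of the totally `e`-periodic configuration `A`: each
is the first period of what is left of `A` after removing the previous ones. -/
def IsPeriodSequence {e : ℕ} (A : Set (Fin ℓ × ℤ)) (P : ℕ → Fin e → Fin ℓ × ℤ) : Prop :=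
  ∀ k, IsFirstPeriod {p | p ∈ A ∧ ∀ k' < k, p ∉ Set.range (P k')} (P k)

/-- The defining properties of the Heisenberg crystal operator `b̃_σ : B_s → B_s`. It preserves the
charge; on a doubly highest weight vertex it shifts the `k`-th `e`-period of the `ℓ`-abacus by `σ_k`
steps to the right; it commutes with all Kashiwara crystal operators of both crystals. -/
structure IsHeisenbergOperator (e : ℕ) (sigma : YoungDiagram) (b : Basis ℓ s → Basis ℓ s) :
    Prop where
  charge_eq : ∀ x, (b x).1.charge = x.1.charge
  shift_periods : ∀ x, IsDoublyHighestWeight e x →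
    ∃ P : ℕ → Fin e → Fin ℓ × ℤ, IsPeriodSequence (abacus x.1) P ∧
      abacus (b x).1 = {p | ∃ k i, p = ((P k i).1, (P k i).2 + (sigma.rowLen k : ℤ))}
  comm_opF : ∀ (i : ZMod e) x, (opF e i x).map b = opF e i (b x)
  comm_opE : ∀ (i : ZMod e) x, (opE e i x).map b = opE e i (b x)
  comm_dualF : ∀ (j : ZMod ℓ) x, (dualF e j x).map b = dualF e j (b x)
  comm_dualE : ∀ (j : ZMod ℓ) x, (dualE e j x).map b = dualE e j (b x)

/-! ### Vertical strips -/

/-- The set of boxes directly to the right of `x`, where `x` is considered to have infinitely many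
parts of size zero in each component. -/
def rightBoxes (x : ChargedPartition ℓ) : Set (Box ℓ) :=
  {g | (g.row, g.col) ∉ x.shape g.comp ∧
    ((0 < g.col ∧ (g.row, g.col - 1) ∈ x.shape g.comp) ∨ g.col = 0)}

/-- Level `ℓ` vertical `e`-strips: no two successive boxes are in the same row and component. -/
def IsVerticalStrip {e : ℕ} (X : Fin e → Box ℓ) : Prop :=
  ∀ i i' : Fin e, (i' : ℕ) = i + 1 → ¬ ((X i').row = (X i).row ∧ (X i').comp = (X i).comp)

/-- Admissible strips: the contents decrease by one at each step, and the components decrease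
weakly. -/
def IsAdmissible {e : ℕ} (x : ChargedPartition ℓ) (X : Fin e → Box ℓ) : Prop :=
  (∀ i i' : Fin e, (i' : ℕ) = i + 1 → content x (X i) = content x (X i') + 1) ∧
  (∀ i i' : Fin e, i < i' → (X i').comp ≤ (X i).comp)

/-- The set of admissible vertical `e`-strips of `x`. -/
def strips (e : ℕ) (x : ChargedPartition ℓ) : Set (Fin e → Box ℓ) :=
  {X | IsVerticalStrip X ∧ IsAdmissible x X ∧ ∀ i, X i ∈ rightBoxes x}

/-- The lexicographic order on `e`-tuples of boxes; `StripLT x X Y` is `X < Y`. -/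
def StripLT {e : ℕ} (x : ChargedPartition ℓ) (X Y : Fin e → Box ℓ) : Prop :=
  ∃ i, (∀ i' < i, X i' = Y i') ∧ BoxLT x (X i) (Y i)

/-- The strips available after `X 0, …, X (k-1)`: those smaller than all of these and with no box
in common with any of them. -/
def availableStrips {e : ℕ} (x : ChargedPartition ℓ) (X : ℕ → Fin e → Box ℓ) (k : ℕ) :
    Set (Fin e → Box ℓ) :=
  {Y | Y ∈ strips e x ∧
    ∀ k' < k, StripLT x Y (X k') ∧ Disjoint (Set.range (X k')) (Set.range Y)}

/-- `X 0, X 1, …` are the first, second, … good vertical `e`-strips of `x`: each is the greatest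
available one. -/
def IsGoodSequence {e : ℕ} (x : ChargedPartition ℓ) (X : ℕ → Fin e → Box ℓ) : Prop :=
  ∀ k, X k ∈ availableStrips x X k ∧
    ∀ Y ∈ availableStrips x X k, Y ≠ X k → StripLT x Y (X k)

/-- Adding the good vertical `e`-strip with index `k` (counted from `0`); the value is `none` if this
strip cannot be added. -/
noncomputable def addGoodStrip (e k : ℕ) : Basis ℓ s → Option (Basis ℓ s) :=
  partialMap fun x y => ∃ X : ℕ → Fin e → Box ℓ,
    IsGoodSequence x.1 X ∧ AddBoxes x.1 (Set.range (X k)) y.1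

/-- Adding `n` times the good vertical `e`-strip with index `k`, which is determined anew after each
step. -/
noncomputable def addGoodStripTimes (e k : ℕ) : ℕ → Basis ℓ s → Option (Basis ℓ s)
  | 0, x => some x
  | n + 1, x => (addGoodStripTimes e k n x).bind (addGoodStrip e k)

/-- The map `c̃_σ`: for `k = 1, 2, …` in turn, as far as `σ` has parts, add `σ_k` times the `k`-th
good vertical `e`-strip. The value is `none` if one of the steps is impossible. -/
noncomputable def cTilde (e : ℕ) (sigma : YoungDiagram) (x : Basis ℓ s) : Option (Basis ℓ s) :=
  (List.range (sigma.colLen 0)).foldlM (fun y k => addGoodStripTimes e k (sigma.rowLen k) y) x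

end FockSpace

namespace FockSpace

/-! The `ℓ`-abacus is continued to a bead configuration in the plane that is invariant under the
translation by `(e, ℓ)` (`cover`). An admissible vertical `e`-strip is then one period of a weakly
increasing periodic path with one bead in each column, and adding the strip pushes all beads of this
path one step to the right. A lower path gives a lexicographically greater strip, so the good strips
are the minimal paths, peeled off one after the other (`isGoodSequence_iff`), and `cTilde` becomes
`pushAll`.

The central notion is that of a greedy path: in each column it takes the first bead at or above its
previous row. Two greedy paths of one configuration are equal, or one lies strictly below the other
everywhere; pushing one leaves the other greedy, and the two pushes commute. The minimal path is
greedy. A later path is greedy only after the earlier ones are removed, and it can be pushed when it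
is greedy in the full configuration. Pushing a greedy `k`-th path makes the next path greedy and
changes no other path. Hence `n` pushes of the `k`-th path allow `n` pushes of the next one
(`IsConfig.hasSlack_iterate_step`). Since the parts of `σ` decrease weakly, all steps of `cTilde`
are possible.

To see that pushing commutes with the Kashiwara operators, take as height of the columns `i` and `i
+ 1` a primitive of the difference of their indicator functions. The signature rule says that `f̃_i`
moves the bead in the row of the last global minimum of the height. Such a move changes greedy paths
only in the columns congruent to `i`, gives an order isomorphism between the greedy paths before and
after, and commutes with pushing them (`compatible_addRel`). An order argument, after the lower
paths have been pushed out of the way, shows that `k`-th paths correspond to `k`-th paths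
(`Compatible.step`). Level-rank duality is the passage to the complement, reflected in the diagonal.
A greedy path seen from the other side of its staircase is a greedy path of the complement; the
order is reversed and pushes correspond to pushes. So the same result with `e` and `ℓ` exchanged
treats the second crystal (`compatible_dualRel`). Pushes create no good boxes, which takes care of
the value `0`.

If no box is removable in the crystal for `e`, the lowest beads of the columns form the minimal
path, every bead lies on one of the paths, and the paths are the `e`-periods; pushing then shifts
the periods. This gives the values on doubly highest weight vertices. Every other vertex is the
image under some `f̃` of a vertex that arises by moving one bead to a position of smaller weight,
and a descent on weights gives uniqueness. -/

/-! ### Periodic configurations and monotone paths -/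

/-- A bead configuration on the plane (columns first, rows second) that is invariant under the
translation by `(e, l)`, and whose columns are empty far below and full far above. -/
structure IsConfig (e l : ℤ) (A : Set (ℤ × ℤ)) : Prop where
  periodic : ∀ c r, (c + e, r + l) ∈ A ↔ (c, r) ∈ A
  low : ∀ c, ∃ m, ∀ r, (c, r) ∈ A → m ≤ r
  high : ∀ c, ∃ m, ∀ r, m ≤ r → (c, r) ∈ A

def IsPeriodic (e l : ℤ) (p : ℤ → ℤ) : Prop := ∀ c, p (c + e) = p c + l

theorem IsPeriodic.add_mul {e l : ℤ} {p : ℤ → ℤ} (hp : IsPeriodic e l p) (c k : ℤ) :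
    p (c + k * e) = p c + k * l := by
  induction k with
  | zero => simp
  | succ k ih =>
    have := hp (c + k * e)
    rw [show c + (k + 1 : ℤ) * e = c + k * e + e by ring, this, ih]; ring
  | pred k ih =>
    have := hp (c + (-k - 1 : ℤ) * e)
    rw [show c + (-k - 1 : ℤ) * e + e = c + (-k : ℤ) * e by ring, ih] at this
    linarith

theorem IsConfig.add_mul {e l : ℤ} {A : Set (ℤ × ℤ)} (hA : IsConfig e l A) (c r k : ℤ) :
    (c + k * e, r + k * l) ∈ A ↔ (c, r) ∈ A := by
  induction k with
  | zero => simp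
  | succ k ih =>
    rw [show c + (k + 1 : ℤ) * e = c + k * e + e by ring,
      show r + (k + 1 : ℤ) * l = r + k * l + l by ring, hA.periodic, ih]
  | pred k ih =>
    rw [← ih, ← hA.periodic (c + (-k - 1 : ℤ) * e)]
    rw [show c + (-k - 1 : ℤ) * e + e = c + (-k : ℤ) * e by ring,
      show r + (-k - 1 : ℤ) * l + l = r + (-k : ℤ) * l by ring]

def IsPath (A : Set (ℤ × ℤ)) (p : ℤ → ℤ) : Prop := Monotone p ∧ ∀ c, (c, p c) ∈ A

/-- The pointwise minimum of all monotone paths of beads. -/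
noncomputable def minPath (A : Set (ℤ × ℤ)) (c : ℤ) : ℤ := sInf {r | ∃ p, IsPath A p ∧ p c = r}

def graph (p : ℤ → ℤ) : Set (ℤ × ℤ) := {x | x.2 = p x.1}

@[simp] theorem mem_graph {p : ℤ → ℤ} {c r : ℤ} : (c, r) ∈ graph p ↔ r = p c := Iff.rfl

def peel (A : Set (ℤ × ℤ)) : Set (ℤ × ℤ) := A \ graph (minPath A)

/-- The `k`-th path, when minimal paths are peeled off one after the other. -/
noncomputable def nthPath (A : Set (ℤ × ℤ)) (k : ℕ) : ℤ → ℤ := minPath (peel^[k] A)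

/-- All beads of the path move one step to the right. -/
def push (A : Set (ℤ × ℤ)) (p : ℤ → ℤ) : Set (ℤ × ℤ) := {x | (x ∈ A ∧ x.2 ≠ p x.1) ∨ x.2 = p (x.1 - 1)}

theorem mem_push {A : Set (ℤ × ℤ)} {p : ℤ → ℤ} {c r : ℤ} :
    (c, r) ∈ push A p ↔ ((c, r) ∈ A ∧ r ≠ p c) ∨ r = p (c - 1) := Iff.rfl

theorem mem_peel {A : Set (ℤ × ℤ)} {c r : ℤ} :
    (c, r) ∈ peel A ↔ (c, r) ∈ A ∧ r ≠ minPath A c := Iff.rfl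

/-- A path of beads which, from each column to the next, uses the first available bead. -/
structure IsGreedy (e l : ℤ) (A : Set (ℤ × ℤ)) (p : ℤ → ℤ) : Prop where
  periodic : IsPeriodic e l p
  le : ∀ c, p (c - 1) ≤ p c
  mem : ∀ c, (c, p c) ∈ A
  gap : ∀ c r, p (c - 1) ≤ r → r < p c → (c, r) ∉ A

/-! ### Existence, periodicity and greediness of the minimal path. -/

section
variable {e l : ℤ} {A : Set (ℤ × ℤ)}

theorem monotone_of_pred_le {p : ℤ → ℤ} (h : ∀ c, p (c - 1) ≤ p c) : Monotone p :=
  monotone_int_of_le_succ fun n => by simpa using h (n + 1)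

theorem IsGreedy.monotone {p : ℤ → ℤ} (hp : IsGreedy e l A p) : Monotone p :=
  monotone_of_pred_le hp.le

theorem IsGreedy.isPath {p : ℤ → ℤ} (hp : IsGreedy e l A p) : IsPath A p := ⟨hp.monotone, hp.mem⟩

theorem _root_.Monotone.int_pred_le {p : ℤ → ℤ} (h : Monotone p) (c : ℤ) : p (c - 1) ≤ p c :=
  h (by omega)

/-- One bound `M` makes all of the columns `0, …, e - 1` full from row `M` on. The staircase that is
constant on each block of `e` columns and rises by `l` between blocks then consists of beads. -/
theorem IsConfig.exists_path (hA : IsConfig e l A) (he : 0 < e) (hl : 0 < l) :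
    ∃ p, IsPath A p := by
  choose m hm using hA.high
  obtain ⟨M, hM⟩ : ∃ M, ∀ c ∈ Finset.Ico 0 e, m c ≤ M := by
    refine ⟨∑ c ∈ Finset.Ico 0 e, |m c|, fun c hc => (le_abs_self _).trans ?_⟩
    exact Finset.single_le_sum (f := fun c => |m c|) (fun _ _ => abs_nonneg _) hc
  refine ⟨fun c => M + c / e * l, ?_, fun c => ?_⟩
  · intro a b hab
    have : a / e ≤ b / e := Int.ediv_le_ediv he hab
    simp only
    nlinarith
  · have h1 : c = c % e + c / e * e := by rw [mul_comm]; exact (Int.emod_add_mul_ediv c e).symm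
    have h2 := hA.add_mul (c % e) M (c / e)
    rw [← h1] at h2
    refine h2.2 (hm _ _ (hM _ ?_))
    simp [Int.emod_nonneg c he.ne', Int.emod_lt_of_pos c he]

theorem IsConfig.bddBelow_paths (hA : IsConfig e l A) (c : ℤ) :
    BddBelow {r | ∃ p, IsPath A p ∧ p c = r} := by
  obtain ⟨m, hm⟩ := hA.low c
  exact ⟨m, by rintro r ⟨p, hp, rfl⟩; exact hm _ (hp.2 c)⟩

theorem IsConfig.minPath_le (hA : IsConfig e l A) {p : ℤ → ℤ} (hp : IsPath A p) (c : ℤ) :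
    minPath A c ≤ p c := csInf_le (hA.bddBelow_paths c) ⟨p, hp, rfl⟩

theorem IsConfig.isPath_minPath (hA : IsConfig e l A) (he : 0 < e) (hl : 0 < l) :
    IsPath A (minPath A) := by
  have key : ∀ c, ∃ p, IsPath A p ∧ p c = minPath A c := fun c => by
    obtain ⟨p, hp⟩ := hA.exists_path he hl
    exact Int.csInf_mem (s := {r | ∃ p, IsPath A p ∧ p c = r}) ⟨p c, p, hp, rfl⟩
      (hA.bddBelow_paths c)
  constructor
  · intro a b hab
    obtain ⟨p, hp, h⟩ := key b
    rw [← h]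
    exact (hA.minPath_le hp a).trans (hp.1 hab)
  · intro c
    obtain ⟨p, hp, h⟩ := key c
    rw [← h]
    exact hp.2 c

/-- Translating the minimal path by `(e, l)` or by `(-e, -l)` gives a path, and comparing it with
the minimal one in both directions gives periodicity. If a bead were passed over in one column,
using it there would give a smaller path. -/
theorem IsConfig.isGreedy_minPath (hA : IsConfig e l A) (he : 0 < e) (hl : 0 < l) :
    IsGreedy e l A (minPath A) := by
  have hp := hA.isPath_minPath he hl
  refine ⟨fun c => le_antisymm ?_ ?_, hp.1.int_pred_le, hp.2, ?_⟩
  · have := hA.minPath_le (p := fun c => minPath A (c - e) + l)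
      ⟨fun a b hab => by simpa using hp.1 (by omega), fun c => by
        have := (hA.periodic (c - e) (minPath A (c - e))).2 (hp.2 _)
        simpa using this⟩ (c + e)
    simpa using this
  · have := hA.minPath_le (p := fun c => minPath A (c + e) - l)
      ⟨fun a b hab => by simpa using hp.1 (by omega), fun c => by
        have := (hA.periodic c (minPath A (c + e) - l)).1
        simp only [sub_add_cancel] at this
        exact this (hp.2 _)⟩ c
    linarith
  · intro c r h1 h2 h3
    have := hA.minPath_le (p := Function.update (minPath A) c r) (by
      constructor
      · refine monotone_of_pred_le fun b => ?_
        rcases eq_or_ne b c with rfl | hb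
        · simpa [Function.update] using h1
        · rcases eq_or_ne (b - 1) c with hb' | hb'
          · subst hb'
            simp only [Function.update_self, Function.update_of_ne hb]
            exact h2.le.trans (hp.1.int_pred_le b)
          · simp only [Function.update_of_ne hb, Function.update_of_ne hb']
            exact hp.1.int_pred_le b
      · intro b
        rcases eq_or_ne b c with rfl | hb
        · simpa using h3
        · simpa [Function.update_of_ne hb] using hp.2 b) c
    simp at this
    omega

/-- Removing a path, pushing a path and moving a bead change each column in a bounded range of rows
only, so the conditions far below and far above carry over. -/
theorem IsConfig.congr_far (hA : IsConfig e l A) {B : Set (ℤ × ℤ)}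
    (hper : ∀ c r, (c + e, r + l) ∈ B ↔ (c, r) ∈ B)
    (h : ∀ c, ∃ m M, ∀ r, r < m ∨ M < r → ((c, r) ∈ B ↔ (c, r) ∈ A)) : IsConfig e l B := by
  refine ⟨hper, fun c => ?_, fun c => ?_⟩
  · obtain ⟨m, M, h⟩ := h c
    obtain ⟨m', h'⟩ := hA.low c
    refine ⟨min m m', fun r hr => ?_⟩
    by_contra! hlt
    exact absurd (h' r ((h r (Or.inl (by omega))).1 hr)) (by omega)
  · obtain ⟨m, M, h⟩ := h c
    obtain ⟨m', h'⟩ := hA.high c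
    exact ⟨max (M + 1) m', fun r hr => (h r (Or.inr (by omega))).2 (h' r (by omega))⟩

theorem IsConfig.diff_graph (hA : IsConfig e l A) {p : ℤ → ℤ} (hp : IsPeriodic e l p) :
    IsConfig e l (A \ graph p) :=
  hA.congr_far (fun c r => by simp [hA.periodic, hp c]) fun c =>
    ⟨p c, p c, fun r hr => by
      have : r ≠ p c := by omega
      simp [this]⟩

theorem IsConfig.push (hA : IsConfig e l A) {p : ℤ → ℤ} (hp : IsPeriodic e l p) :
    IsConfig e l (push A p) :=
  hA.congr_far (fun c r => by
      have h1 := hp (c - 1)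
      rw [show c - 1 + e = c + e - 1 by ring] at h1
      simp [mem_push, hA.periodic, hp c, h1]) fun c =>
    ⟨min (p c) (p (c - 1)), max (p c) (p (c - 1)), fun r hr => by
      have : r ≠ p c := by omega
      have h2 : r ≠ p (c - 1) := by omega
      simp [mem_push, this, h2]⟩

theorem IsConfig.peel (hA : IsConfig e l A) (he : 0 < e) (hl : 0 < l) : IsConfig e l (peel A) :=
  hA.diff_graph (hA.isGreedy_minPath he hl).periodic

theorem IsConfig.iterate_peel (hA : IsConfig e l A) (he : 0 < e) (hl : 0 < l) (k : ℕ) :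
    IsConfig e l (FockSpace.peel^[k] A) := by
  induction k with
  | zero => exact hA
  | succ k ih => rw [Function.iterate_succ_apply']; exact ih.peel he hl

theorem mem_iterate_peel {k : ℕ} {c r : ℤ} :
    (c, r) ∈ peel^[k] A ↔ (c, r) ∈ A ∧ ∀ j < k, r ≠ nthPath A j c := by
  induction k with
  | zero => simp
  | succ k ih =>
    rw [Function.iterate_succ_apply', mem_peel, ih, Nat.forall_lt_succ_right, and_assoc]
    rfl

theorem nthPath_add (j k : ℕ) : nthPath A (j + k) = nthPath (peel^[k] A) j := by
  rw [nthPath, nthPath, Function.iterate_add_apply]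

/-- Greediness refers to the peeled configuration. In `A` itself the path may pass over beads of
earlier paths, and it is the greediness in `A` that decides whether the path can be pushed. -/
theorem IsConfig.nthPath_greedy (hA : IsConfig e l A) (he : 0 < e) (hl : 0 < l) (k : ℕ) :
    IsGreedy e l (FockSpace.peel^[k] A) (nthPath A k) :=
  (hA.iterate_peel he hl k).isGreedy_minPath he hl

theorem IsConfig.nthPath_isPath (hA : IsConfig e l A) (he : 0 < e) (hl : 0 < l) (k : ℕ) :
    IsPath A (nthPath A k) :=
  ⟨(hA.nthPath_greedy he hl k).monotone, fun c =>
    (mem_iterate_peel.1 ((hA.nthPath_greedy he hl k).mem c)).1⟩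

/-- This minimality among the paths that avoid the earlier ones is how all later paths are compared.
-/
theorem IsConfig.nthPath_le (hA : IsConfig e l A) (he : 0 < e) (hl : 0 < l) {k : ℕ} {q : ℤ → ℤ}
    (hq : IsPath A q) (hd : ∀ j < k, ∀ c, q c ≠ nthPath A j c) (c : ℤ) : nthPath A k c ≤ q c :=
  (hA.iterate_peel he hl k).minPath_le
    ⟨hq.1, fun c => mem_iterate_peel.2 ⟨hq.2 c, fun j hj => hd j hj c⟩⟩ c

theorem IsConfig.nthPath_ne (hA : IsConfig e l A) (he : 0 < e) (hl : 0 < l) {j k : ℕ}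
    (hjk : j < k) (c : ℤ) : nthPath A k c ≠ nthPath A j c :=
  (mem_iterate_peel.1 ((hA.nthPath_greedy he hl k).mem c)).2 j hjk

theorem IsConfig.nthPath_lt (hA : IsConfig e l A) (he : 0 < e) (hl : 0 < l) {j k : ℕ}
    (hjk : j < k) (c : ℤ) : nthPath A j c < nthPath A k c :=
  lt_of_le_of_ne (hA.nthPath_le he hl (hA.nthPath_isPath he hl k)
    (fun _ hi _ => hA.nthPath_ne he hl (hi.trans hjk) _) c) (hA.nthPath_ne he hl hjk c).symm

/-! ### The order on greedy paths -/

/-- The useful form of the gap condition: a bead below the path in column `c` is already below the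
value of the path in the preceding column. This leaves room between two comparable greedy paths. -/
theorem IsGreedy.lt_pred {p : ℤ → ℤ} (hp : IsGreedy e l A p) {c x : ℤ} (hx : (c, x) ∈ A)
    (h : x < p c) : x < p (c - 1) := by
  by_contra! h'
  exact hp.gap c x h' h hx

theorem IsGreedy.eq_succ {p q : ℤ → ℤ} (hp : IsGreedy e l A p) (hq : IsGreedy e l A q) {c : ℤ}
    (h : p (c - 1) = q (c - 1)) : p c = q c := by
  by_contra hne
  rcases lt_or_gt_of_ne hne with h' | h'
  · have := hq.lt_pred (hp.mem c) h'
    have := hp.le c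
    omega
  · have := hp.lt_pred (hq.mem c) h'
    have := hq.le c
    omega

theorem forall_of_forall_ge (he : 0 < e) {P : ℤ → Prop} (hP : ∀ c, P c ↔ P (c + e)) {c : ℤ}
    (h : ∀ d, c ≤ d → P d) (d : ℤ) : P d := by
  have key : ∀ k : ℕ, P d ↔ P (d + k * e) := fun k => by
    induction k with
    | zero => simp
    | succ k ih => rw [ih, hP]; push_cast; ring_nf
  rw [key (c - d).toNat]
  apply h
  have : ((c - d).toNat : ℤ) ≥ c - d := Int.self_le_toNat _
  nlinarith

theorem IsPeriodic.lt_of_ge {p q : ℤ → ℤ} (he : 0 < e) (hp : IsPeriodic e l p)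
    (hq : IsPeriodic e l q) {c : ℤ} (h : ∀ d, c ≤ d → p d < q d) (d : ℤ) : p d < q d :=
  forall_of_forall_ge he (fun c => by rw [hp, hq]; omega) h d

theorem IsPeriodic.le_of_le {p q : ℤ → ℤ} (he : 0 < e) (hp : IsPeriodic e l p)
    (hq : IsPeriodic e l q) {c : ℤ} (h : ∀ d, d ≤ c → p d ≤ q d) (d : ℤ) : p d ≤ q d := by
  have key : ∀ k : ℕ, p d ≤ q d ↔ p (d + (-k : ℤ) * e) ≤ q (d + (-k : ℤ) * e) := fun k => by
    rw [hp.add_mul, hq.add_mul]; omega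
  rw [key (d - c).toNat]
  apply h
  have : ((d - c).toNat : ℤ) ≥ d - c := Int.self_le_toNat _
  nlinarith

/-- The greedy rule determines a path to the right of any column, and periodicity transports this to
all columns. -/
theorem IsGreedy.eq_of_eq {p q : ℤ → ℤ} (he : 0 < e) (hp : IsGreedy e l A p)
    (hq : IsGreedy e l A q) {c : ℤ} (h : p c = q c) : p = q := by
  funext d
  refine forall_of_forall_ge he (P := fun d => p d = q d) (c := c)
    (fun c => by rw [hp.periodic, hq.periodic]; omega) (fun d hd => ?_) d
  induction d, hd using Int.leInduction with
  | base => exact h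
  | succ n hn ih => exact hp.eq_succ hq (by simpa using ih)

theorem IsGreedy.lt_of_lt {p q : ℤ → ℤ} (he : 0 < e) (hp : IsGreedy e l A p)
    (hq : IsGreedy e l A q) {c : ℤ} (h : p c < q c) (d : ℤ) : p d < q d := by
  refine hp.periodic.lt_of_ge he hq.periodic (c := c) (fun d hd => ?_) d
  induction d, hd using Int.leInduction with
  | base => exact h
  | succ n hn ih =>
    rcases lt_trichotomy (p (n + 1)) (q (n + 1)) with h' | h' | h'
    · exact h'
    · have := hp.eq_of_eq he hq h'
      subst this
      omega
    · have h1 := hp.lt_pred (hq.mem (n + 1)) h'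
      have h2 := hq.le (n + 1)
      simp only [add_sub_cancel_right] at h1 h2
      omega

theorem IsGreedy.trichotomy {p q : ℤ → ℤ} (he : 0 < e) (hp : IsGreedy e l A p)
    (hq : IsGreedy e l A q) : (∀ c, p c < q c) ∨ p = q ∨ ∀ c, q c < p c := by
  rcases lt_trichotomy (p 0) (q 0) with h | h | h
  · exact Or.inl (hp.lt_of_lt he hq h)
  · exact Or.inr (Or.inl (hp.eq_of_eq he hq h))
  · exact Or.inr (Or.inr (hq.lt_of_lt he hp h))

/-- The pushed bead in column `c` could only disturb `q` between the rows `q (c - 1)` and `q c`. If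
`p` is below `q`, then `p c < q (c - 1)`; if it is above, then `q c < p (c - 1)`. In both cases the
bead misses this range. -/
theorem IsGreedy.mem_push {p q : ℤ → ℤ} (he : 0 < e) (hp : IsGreedy e l A p)
    (hq : IsGreedy e l A q) (hne : q ≠ p) : IsGreedy e l (push A p) q := by
  have key : ∀ c, q c ≠ p c := fun c h => hne (hq.eq_of_eq he hp h)
  refine ⟨hq.periodic, hq.le, fun c => Or.inl ⟨hq.mem c, key c⟩, fun c r h1 h2 h3 => ?_⟩
  rcases h3 with ⟨h3, -⟩ | h3
  · exact hq.gap c r h1 h2 h3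
  · simp only at h3
    rcases hp.trichotomy he hq with h | h | h
    · have := hq.lt_pred (hp.mem c) (h c)
      have := hp.le c
      omega
    · exact hne h.symm
    · have := hp.lt_pred (hq.mem c) (h c)
      omega

/-- Two different greedy paths interlace so strictly that a pushed bead of one never lands on a bead
of the other. -/
theorem IsGreedy.push_comm {p q : ℤ → ℤ} (he : 0 < e) (hp : IsGreedy e l A p)
    (hq : IsGreedy e l A q) (hne : q ≠ p) : push (push A p) q = push (push A q) p := by
  have key : ∀ c, q c ≠ p c := fun c h => hne (hq.eq_of_eq he hp h)
  have k1 : ∀ c, p (c - 1) ≠ q c := fun c h => by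
    rcases hp.trichotomy he hq with h' | h' | h'
    · have := hq.lt_pred (hp.mem c) (h' c)
      have := hq.le c
      have := hp.le c
      omega
    · exact hne h'.symm
    · have := hp.lt_pred (hq.mem c) (h' c)
      omega
  have k2 : ∀ c, q (c - 1) ≠ p c := fun c h => by
    rcases hp.trichotomy he hq with h' | h' | h'
    · have := hq.lt_pred (hp.mem c) (h' c)
      omega
    · exact hne h'.symm
    · have := h' c
      have := hq.le c
      omega
  ext ⟨c, r⟩
  have := k1 c
  have := k2 c
  simp only [FockSpace.mem_push]
  by_cases h1 : r = q (c - 1)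
  · simp [h1, k2]
  · by_cases h2 : r = p (c - 1)
    · simp [h2, k1]
    · simp only [h1, h2, or_false]
      tauto

end

/-! ### Pushing the `k`-th path -/

/-- The `k`-th path moves one step to the right. -/
noncomputable def step (k : ℕ) (A : Set (ℤ × ℤ)) : Set (ℤ × ℤ) := push A (nthPath A k)

section
variable {e l : ℤ} {A : Set (ℤ × ℤ)}

theorem IsGreedy.isPath_shift {p : ℤ → ℤ} (hp : IsGreedy e l A p) :
    IsPath (FockSpace.push A p) fun c => p (c - 1) :=
  ⟨fun a b hab => hp.monotone (by omega), fun _ => Or.inr rfl⟩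

theorem IsConfig.minPath_push_le (hA : IsConfig e l A) {p : ℤ → ℤ} (hp : IsGreedy e l A p) (c : ℤ) :
    minPath (FockSpace.push A p) c ≤ p (c - 1) :=
  (hA.push hp.periodic).minPath_le hp.isPath_shift c

theorem IsConfig.minPath_lt_nthPath (hA : IsConfig e l A) (he : 0 < e) (hl : 0 < l) (j : ℕ) (c : ℤ) :
    minPath A c < nthPath A (j + 1) c := hA.nthPath_lt he hl (Nat.succ_pos j) c

/-- It suffices that the second path `r` after the push uses no pushed bead, as it is then a path of
`A` that avoids the minimal path `p`. If it did use one, it would lie weakly below `p` everywhere,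
and the first path `q < r` could not use a pushed bead. So `q` would be a path of `A` that is
somewhere strictly below `p`. -/
theorem IsConfig.nthPath_one_push_minPath (hA : IsConfig e l A) (he : 0 < e) (hl : 0 < l) (c : ℤ) :
    nthPath A 1 c ≤ nthPath (FockSpace.push A (minPath A)) 1 c := by
  have hp := hA.isGreedy_minPath he hl
  have hT := hA.push hp.periodic
  set p := minPath A with hpdef
  set T := FockSpace.push A p with hTdef
  have hq := hT.isGreedy_minPath he hl
  have hqp := hA.minPath_push_le hp
  rw [← hTdef] at hqp
  have hr := hT.nthPath_greedy he hl 1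
  have hrT := hT.nthPath_isPath he hl 1
  have hqr := hT.minPath_lt_nthPath he hl 0
  simp only [zero_add] at hqr
  set q := minPath T
  set r := nthPath T 1
  have key : ∀ d, r d ≠ p (d - 1) := by
    intro d hd
    -- Going to the left: if `r` were above `p` in column `n - 1`, its bead in column `n` would be
    -- an old bead between `p (n - 1)` and `p n`, which greediness excludes.
    have h1 : ∀ x, x ≤ d → r x ≤ p x := by
      intro x hx
      induction x, hx using Int.leInductionDown with
      | base => rw [hd]; exact hp.le d
      | pred n hn ih =>
        by_contra! hlt
        have h2 := hr.le n
        have h3 : (n, r n) ∈ A ∧ r n ≠ p n := by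
          rcases hrT.2 n with h | h
          · exact h
          · simp only at h; omega
        exact hp.gap n (r n) (by omega) (by omega) h3.1
    have h2 := hr.periodic.le_of_le he hp.periodic h1
    have h3 : ∀ x, (x, q x) ∈ A ∧ q x ≠ p x := by
      intro x
      rcases hq.mem x with h | h
      · exact h
      · exfalso
        simp only at h
        have h4 := hqr x
        have h5 := h2 x
        have h6 : (x, r x) ∈ A ∧ r x ≠ p x := by
          rcases hrT.2 x with h' | h'
          · exact h'
          · simp only at h'; omega
        exact hp.gap x (r x) (by omega) (by omega) h6.1
    have h4 : p d ≤ q d := hA.minPath_le ⟨hq.monotone, fun x => (h3 x).1⟩ d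
    have := hqp d
    have := hp.le d
    have := (h3 d).2
    omega
  have h3 : ∀ x, (x, r x) ∈ A ∧ r x ≠ p x := fun x => by
    rcases hrT.2 x with h | h
    · exact h
    · exact absurd h (key x)
  refine hA.nthPath_le he hl ⟨hrT.1, fun x => (h3 x).1⟩ (fun j hj x => ?_) c
  obtain rfl : j = 0 := by omega
  exact (h3 x).2

/-- The old paths survive the push and avoid the new first path, which lies weakly below the old
one. Conversely, from the third path on, the new paths lie above the second one, hence above the
minimal path of `A`, and cannot use pushed beads. -/
theorem IsConfig.nthPath_push_minPath (hA : IsConfig e l A) (he : 0 < e) (hl : 0 < l) (j : ℕ) :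
    nthPath (FockSpace.push A (minPath A)) (j + 1) = nthPath A (j + 1) := by
  have hp := hA.isGreedy_minPath he hl
  have hT := hA.push hp.periodic
  have hqp := hA.minPath_push_le hp
  induction j using Nat.strong_induction_on with
  | _ j ih =>
  funext c
  apply le_antisymm
  · have h1 := hA.nthPath_isPath he hl (j + 1)
    refine hT.nthPath_le he hl ⟨h1.1, fun x => Or.inl ⟨h1.2 x, ?_⟩⟩ (fun i hi x => ?_) c
    · exact (hA.minPath_lt_nthPath he hl j x).ne'
    · rcases i with - | i
      · have := hqp x
        have := hp.le x
        have := hA.minPath_lt_nthPath he hl j x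
        have h : nthPath (FockSpace.push A (minPath A)) 0 x ≤ minPath A (x - 1) := hqp x
        omega
      · rw [ih i (by omega)]
        exact hA.nthPath_ne he hl hi x
  · rcases j with - | j
    · exact hA.nthPath_one_push_minPath he hl c
    · have h1 := hT.nthPath_isPath he hl (j + 1 + 1)
      have h2 : ∀ x, nthPath A 1 x < nthPath (FockSpace.push A (minPath A)) (j + 1 + 1) x := fun x => by
        rw [← ih 0 (by omega)]
        exact hT.nthPath_lt he hl (by omega) x
      have h3 : ∀ x, minPath A x < nthPath (FockSpace.push A (minPath A)) (j + 1 + 1) x := fun x =>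
        (hA.minPath_lt_nthPath he hl 0 x).trans (h2 x)
      refine hA.nthPath_le he hl ⟨h1.1, fun x => ?_⟩ (fun i hi x => ?_) c
      · rcases h1.2 x with h | h
        · exact h.1
        · simp only at h
          have := hp.le x
          have := h3 x
          omega
      · rcases i with - | i
        · exact (h3 x).ne'
        · rw [← ih i (by omega)]
          exact hT.nthPath_ne he hl hi x

theorem IsConfig.lt_nthPath_pred (hA : IsConfig e l A) (he : 0 < e) (hl : 0 < l) {j k : ℕ}
    (hk : IsGreedy e l A (nthPath A k)) (hjk : j < k) (c : ℤ) :
    nthPath A j c < nthPath A k (c - 1) :=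
  hk.lt_pred ((hA.nthPath_isPath he hl j).2 c) (hA.nthPath_lt he hl hjk c)

/-- The pushed beads lie strictly above all earlier paths, by `IsConfig.lt_nthPath_pred`, so they
offer nothing to these paths. -/
theorem IsConfig.nthPath_step_lt (hA : IsConfig e l A) (he : 0 < e) (hl : 0 < l) {j k : ℕ}
    (hk : IsGreedy e l A (nthPath A k)) (hjk : j < k) : nthPath (step k A) j = nthPath A j := by
  have hT := hA.push hk.periodic
  rw [← step] at hT
  induction j using Nat.strong_induction_on with
  | _ j ih =>
  have hle : ∀ c, nthPath (step k A) j c ≤ nthPath A j c := fun c => by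
    have h1 := hA.nthPath_isPath he hl j
    refine hT.nthPath_le he hl ⟨h1.1, fun x => Or.inl ⟨h1.2 x, ?_⟩⟩ (fun i hi x => ?_) c
    · exact (hA.nthPath_lt he hl hjk x).ne
    · rw [ih i hi (hi.trans hjk)]
      exact hA.nthPath_ne he hl hi x
  funext c
  refine (hle c).antisymm ?_
  have h1 := hT.nthPath_isPath he hl j
  refine hA.nthPath_le he hl ⟨h1.1, fun x => ?_⟩ (fun i hi x => ?_) c
  · rcases h1.2 x with h | h
    · exact h.1
    · simp only at h
      have := hA.lt_nthPath_pred he hl hk hjk x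
      have := hle x
      omega
  · rw [← ih i hi (hi.trans hjk)]
    exact hT.nthPath_ne he hl hi x

/-- Since the push does not affect the first `k` paths, it commutes with peeling them off. This
reduces statements about the `k`-th path to statements about the minimal one. -/
theorem IsConfig.iterate_peel_step (hA : IsConfig e l A) (he : 0 < e) (hl : 0 < l) {k : ℕ}
    (hk : IsGreedy e l A (nthPath A k)) :
    FockSpace.peel^[k] (step k A) = FockSpace.push (FockSpace.peel^[k] A) (nthPath A k) := by
  ext ⟨c, r⟩
  rw [mem_iterate_peel, mem_push, mem_iterate_peel, step, mem_push]
  have h1 : (∀ j < k, r ≠ nthPath (FockSpace.push A (nthPath A k)) j c) ↔ ∀ j < k, r ≠ nthPath A j c :=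
    forall₂_congr fun j hj => by rw [← step, hA.nthPath_step_lt he hl hk hj]
  have h2 : r = nthPath A k (c - 1) → ∀ j < k, r ≠ nthPath A j c := fun h j hj => by
    have := hA.lt_nthPath_pred he hl hk hj c
    omega
  rw [h1]
  tauto

theorem IsConfig.nthPath_step_gt (hA : IsConfig e l A) (he : 0 < e) (hl : 0 < l) {j k : ℕ}
    (hk : IsGreedy e l A (nthPath A k)) (hjk : k < j) : nthPath (step k A) j = nthPath A j := by
  obtain ⟨i, rfl⟩ := Nat.exists_eq_add_of_lt hjk
  rw [show k + i + 1 = (i + 1) + k by ring, nthPath_add (A := FockSpace.step k A) (i + 1) k,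
    nthPath_add (A := A) (i + 1) k, hA.iterate_peel_step he hl hk]
  exact (hA.iterate_peel he hl k).nthPath_push_minPath he hl i

theorem IsConfig.nthPath_step_ne (hA : IsConfig e l A) (he : 0 < e) (hl : 0 < l) {j k : ℕ}
    (hk : IsGreedy e l A (nthPath A k)) (hjk : j ≠ k) : nthPath (step k A) j = nthPath A j := by
  rcases lt_or_gt_of_ne hjk with h | h
  · exact hA.nthPath_step_lt he hl hk h
  · exact hA.nthPath_step_gt he hl hk h

theorem IsConfig.nthPath_step_self_le (hA : IsConfig e l A) (he : 0 < e) (hl : 0 < l) {k : ℕ}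
    (hk : IsGreedy e l A (nthPath A k)) (c : ℤ) : nthPath (step k A) k c ≤ nthPath A k (c - 1) := by
  have : nthPath (step k A) k = minPath (FockSpace.peel^[k] (step k A)) := rfl
  rw [this, hA.iterate_peel_step he hl hk]
  exact (hA.iterate_peel he hl k).minPath_push_le (hA.nthPath_greedy he hl k) c

theorem IsConfig.step (hA : IsConfig e l A) (he : 0 < e) (hl : 0 < l) (k : ℕ) :
    IsConfig e l (step k A) := hA.push (hA.nthPath_greedy he hl k).periodic

theorem IsConfig.greedy_zero (hA : IsConfig e l A) (he : 0 < e) (hl : 0 < l) :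
    IsGreedy e l A (nthPath A 0) := hA.isGreedy_minPath he hl

/-- Only beads of the earlier paths could spoil greediness. After the push they lie, in column `c`,
at or below the old value of the `k`-th path in column `c - 1`, hence strictly below the value of
the next path in that column. -/
theorem IsConfig.greedy_step_succ (hA : IsConfig e l A) (he : 0 < e) (hl : 0 < l) {k : ℕ}
    (hk : IsGreedy e l A (nthPath A k)) :
    IsGreedy e l (FockSpace.step k A) (nthPath (FockSpace.step k A) (k + 1)) := by
  have hT := hA.step he hl k
  have hg := hT.nthPath_greedy he hl (k + 1)
  refine ⟨hg.periodic, hg.le, (hT.nthPath_isPath he hl _).2, fun c r h1 h2 h3 => ?_⟩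
  refine hg.gap c r h1 h2 (mem_iterate_peel.2 ⟨h3, fun j hj h => ?_⟩)
  have h4 : nthPath (FockSpace.step k A) j c ≤ nthPath (FockSpace.step k A) k c := by
    rcases (Nat.le_of_lt_succ hj).lt_or_eq with h' | rfl
    · exact (hT.nthPath_lt he hl h' c).le
    · exact le_rfl
  have h5 := hA.nthPath_step_self_le he hl hk c
  have h6 := hA.nthPath_lt he hl (Nat.lt_succ_self k) (c - 1)
  rw [← hA.nthPath_step_gt he hl hk (Nat.lt_succ_self k)] at h6
  simp only [Nat.succ_eq_add_one] at h6
  omega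

theorem IsConfig.nthPath_injective (hA : IsConfig e l A) (he : 0 < e) (hl : 0 < l) {j k : ℕ}
    (h : j ≠ k) : nthPath A j ≠ nthPath A k := fun h' => by
  rcases lt_or_gt_of_ne h with h'' | h''
  · exact hA.nthPath_ne he hl h'' 0 (by rw [h'])
  · exact hA.nthPath_ne he hl h'' 0 (by rw [h'])

theorem IsConfig.greedy_step_ne (hA : IsConfig e l A) (he : 0 < e) (hl : 0 < l) {j k : ℕ}
    (hk : IsGreedy e l A (nthPath A k)) (hj : IsGreedy e l A (nthPath A j)) (hjk : j ≠ k) :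
    IsGreedy e l (FockSpace.step k A) (nthPath (FockSpace.step k A) j) := by
  rw [hA.nthPath_step_ne he hl hk hjk]
  exact hk.mem_push he hj (hA.nthPath_injective he hl hjk)

theorem IsConfig.step_comm (hA : IsConfig e l A) (he : 0 < e) (hl : 0 < l) {j k : ℕ}
    (hk : IsGreedy e l A (nthPath A k)) (hj : IsGreedy e l A (nthPath A j)) (hjk : j ≠ k) :
    FockSpace.step j (FockSpace.step k A) = FockSpace.step k (FockSpace.step j A) := by
  rw [FockSpace.step, hA.nthPath_step_ne he hl hk hjk, FockSpace.step,
    hk.push_comm he hj (hA.nthPath_injective he hl hjk), FockSpace.step,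
    hA.nthPath_step_ne he hl hj hjk.symm, FockSpace.step]

/-- The `k`-th path can be pushed at least `n` times. -/
def HasSlack (e l : ℤ) (k : ℕ) : ℕ → Set (ℤ × ℤ) → Prop
  | 0, _ => True
  | n + 1, A => IsGreedy e l A (nthPath A k) ∧ HasSlack e l k n (FockSpace.step k A)

theorem HasSlack.mono {k m n : ℕ} (h : HasSlack e l k n A) (hmn : m ≤ n) : HasSlack e l k m A := by
  induction n generalizing m A with
  | zero => obtain rfl : m = 0 := by omega
            exact h
  | succ n ih =>
    rcases m with - | m
    · trivial
    · exact ⟨h.1, ih h.2 (by omega)⟩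

theorem IsConfig.hasSlack_zero (hA : IsConfig e l A) (he : 0 < e) (hl : 0 < l) (n : ℕ) :
    HasSlack e l 0 n A := by
  induction n generalizing A with
  | zero => trivial
  | succ n ih => exact ⟨hA.greedy_zero he hl, ih (hA.step he hl 0)⟩

/-- A push of the `k`-th path commutes with the pushes of the next path that were possible before,
and makes one more of them possible at the end. -/
theorem IsConfig.hasSlack_step (hA : IsConfig e l A) (he : 0 < e) (hl : 0 < l) {k n : ℕ}
    (hk : IsGreedy e l A (nthPath A k)) (h : HasSlack e l (k + 1) n A) :
    HasSlack e l (k + 1) (n + 1) (FockSpace.step k A) := by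
  induction n generalizing A with
  | zero => exact ⟨hA.greedy_step_succ he hl hk, trivial⟩
  | succ n ih =>
    refine ⟨hA.greedy_step_succ he hl hk, ?_⟩
    rw [hA.step_comm he hl hk h.1 (by omega)]
    exact ih (hA.step he hl _) (hA.greedy_step_ne he hl h.1 hk (by omega)) h.2

theorem IsConfig.iterate_step (hA : IsConfig e l A) (he : 0 < e) (hl : 0 < l) (k n : ℕ) :
    IsConfig e l ((FockSpace.step k)^[n] A) := by
  induction n with
  | zero => exact hA
  | succ n ih => rw [Function.iterate_succ_apply']; exact ih.step he hl k

theorem HasSlack.iterate {k m n : ℕ} (h : HasSlack e l k (m + n) A) :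
    HasSlack e l k n ((FockSpace.step k)^[m] A) := by
  induction m generalizing A with
  | zero => simpa using h
  | succ m ih =>
    rw [Function.iterate_succ_apply]
    rw [Nat.add_right_comm] at h
    exact ih h.2

theorem IsConfig.hasSlack_iterate_step (hA : IsConfig e l A) (he : 0 < e) (hl : 0 < l) {k n : ℕ}
    (h : HasSlack e l k n A) : HasSlack e l (k + 1) n ((FockSpace.step k)^[n] A) := by
  induction n with
  | zero => trivial
  | succ n ih =>
    rw [Function.iterate_succ_apply']
    exact (hA.iterate_step he hl k n).hasSlack_step he hl (h.iterate (m := n) (n := 1)).1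
      (ih (h.mono (by omega)))

/-- For `k = 0, 1, …, n - 1` in turn, the `k`-th path is pushed `f k` times. -/
noncomputable def pushAll (f : ℕ → ℕ) (A : Set (ℤ × ℤ)) : ℕ → Set (ℤ × ℤ)
  | 0 => A
  | k + 1 => (FockSpace.step k)^[f k] (pushAll f A k)

theorem IsConfig.pushAll (hA : IsConfig e l A) (he : 0 < e) (hl : 0 < l) (f : ℕ → ℕ) (n : ℕ) :
    IsConfig e l (pushAll f A n) := by
  induction n with
  | zero => exact hA
  | succ n ih => exact ih.iterate_step he hl _ _

/-- The `f n` pushes of path `n` provide `f n` pushes of path `n + 1`, and only `f (n + 1) ≤ f n` of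
them are needed. This is the point where `σ` has to be a partition. -/
theorem IsConfig.hasSlack_pushAll (hA : IsConfig e l A) (he : 0 < e) (hl : 0 < l) {f : ℕ → ℕ}
    (hf : Antitone f) (n : ℕ) : HasSlack e l n (f n) (FockSpace.pushAll f A n) := by
  induction n with
  | zero => exact hA.hasSlack_zero he hl _
  | succ n ih => exact ((hA.pushAll he hl f n).hasSlack_iterate_step he hl ih).mono (hf n.le_succ)

end

/-! ### Relations between configurations that respect greedy paths -/

/-- A relation `F` between configurations together with a relation `R` between paths which restricts
to an order isomorphism between the greedy paths, such that `F` commutes with pushing. -/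
structure Compatible (e l : ℤ) (F : Set (ℤ × ℤ) → Set (ℤ × ℤ) → Prop)
    (R : (ℤ → ℤ) → (ℤ → ℤ) → Prop) : Prop where
  lift : ∀ {A B p}, IsConfig e l A → IsConfig e l B → F A B → IsGreedy e l A p →
    ∃ p', IsGreedy e l B p' ∧ R p p' ∧ F (push A p) (push B p')
  colift : ∀ {A B p'}, IsConfig e l A → IsConfig e l B → F A B → IsGreedy e l B p' →
    ∃ p, IsGreedy e l A p ∧ R p p'
  lt_iff : ∀ {A B p q p' q'}, IsGreedy e l A p → IsGreedy e l A q → IsGreedy e l B p' →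
    IsGreedy e l B q' → R p p' → R q q' → ((∀ c, p c < q c) ↔ ∀ c, p' c < q' c)

section
variable {e l : ℤ} {A B : Set (ℤ × ℤ)}

/-- Two configurations are made to have greedy first paths simultaneously, by pushes that preserve
`P`. Once the paths up to `k` are greedy, a push of path `k` makes path `k + 1` greedy but may spoil
path `k`. So the paths up to `k` are separated a second time, now by pushes of paths below `k`,
which keep path `k + 1` greedy. -/
theorem exists_separated (he : 0 < e) (hl : 0 < l) (k : ℕ)
    {P : Set (ℤ × ℤ) → Set (ℤ × ℤ) → Prop}
    (hP : ∀ A B j, j < k → P A B → IsGreedy e l A (nthPath A j) → IsGreedy e l B (nthPath B j) →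
      P (step j A) (step j B))
    (hc : ∀ A B, P A B → IsConfig e l A ∧ IsConfig e l B) (hAB : P A B) :
    ∃ A' B', P A' B' ∧ ∀ j ≤ k, IsGreedy e l A' (nthPath A' j) ∧ IsGreedy e l B' (nthPath B' j) := by
  induction k generalizing A B P with
  | zero =>
    refine ⟨A, B, hAB, fun j hj => ?_⟩
    obtain rfl : j = 0 := by omega
    exact ⟨(hc _ _ hAB).1.greedy_zero he hl, (hc _ _ hAB).2.greedy_zero he hl⟩
  | succ k ih =>
    obtain ⟨A₁, B₁, h₁, g₁⟩ := ih (fun A B j hj => hP A B j (by omega)) hc hAB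
    obtain ⟨cA, cB⟩ := hc _ _ h₁
    obtain ⟨gA, gB⟩ := g₁ k le_rfl
    obtain ⟨A₂, B₂, h₂, g₂⟩ := ih (A := step k A₁) (B := step k B₁)
      (P := fun A B => P A B ∧ IsGreedy e l A (nthPath A (k + 1)) ∧ IsGreedy e l B (nthPath B (k + 1)))
      (fun A B j hj h gA gB => ⟨hP A B j (by omega) h.1 gA gB,
        (hc _ _ h.1).1.greedy_step_ne he hl gA h.2.1 (by omega),
        (hc _ _ h.1).2.greedy_step_ne he hl gB h.2.2 (by omega)⟩)
      (fun A B h => hc A B h.1)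
      ⟨hP _ _ k (by omega) h₁ gA gB, cA.greedy_step_succ he hl gA, cB.greedy_step_succ he hl gB⟩
    refine ⟨A₂, B₂, h₂.1, fun j hj => ?_⟩
    rcases hj.lt_or_eq with h | rfl
    · exact g₂ j (by omega)
    · exact h₂.2

variable {F : Set (ℤ × ℤ) → Set (ℤ × ℤ) → Prop} {R : (ℤ → ℤ) → (ℤ → ℤ) → Prop}

theorem IsConfig.nthPath_le_of_lt (hA : IsConfig e l A) (he : 0 < e) (hl : 0 < l) {k : ℕ} {q : ℤ → ℤ}
    (hq : IsPath A q) (h : ∀ c, nthPath A k c < q c) (c : ℤ) : nthPath A (k + 1) c ≤ q c := by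
  refine hA.nthPath_le he hl hq (fun j hj x => ?_) c
  have := h x
  rcases (Nat.le_of_lt_succ hj).lt_or_eq with h' | rfl
  · have := hA.nthPath_lt he hl h' x
    omega
  · omega

/-- The lift `p'` of the `k`-th path has to be identified as the `k`-th path of `B`. For lack of
greediness of the lower paths, the order isomorphism of greedy paths does not see the index
directly. So the lower paths are pushed, in both configurations and compatibly with `F` by
induction, until they are greedy; neither `k`-th path changes. Then `p'` and the `k`-th path of `B'`
are compared as immediate successors of the preceding path. -/
theorem Compatible.step (hF : Compatible e l F R) (he : 0 < e) (hl : 0 < l) (k : ℕ)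
    (hA : IsConfig e l A) (hB : IsConfig e l B) (hAB : F A B) (hk : IsGreedy e l A (nthPath A k)) :
    IsGreedy e l B (nthPath B k) ∧ R (nthPath A k) (nthPath B k) ∧
      F (FockSpace.step k A) (FockSpace.step k B) := by
  induction k using Nat.strong_induction_on generalizing A B with
  | _ k ih =>
  obtain ⟨p', hp', hR, hpush⟩ := hF.lift hA hB hAB hk
  suffices h : nthPath B k = p' by
    rw [FockSpace.step, FockSpace.step, h]
    exact ⟨hp', hR, hpush⟩
  rcases k with - | k
  · obtain ⟨q, hq, hqR⟩ := hF.colift hA hB hAB (hB.greedy_zero he hl)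
    rcases (hB.greedy_zero he hl).trichotomy he hp' with h1 | h1 | h1
    · have h2 := (hF.lt_iff hq hk (hB.greedy_zero he hl) hp' hqR hR).2 h1 0
      have h3 : nthPath A 0 0 ≤ q 0 := hA.minPath_le hq.isPath 0
      omega
    · exact h1
    · have h2 := h1 0
      have h3 : nthPath B 0 0 ≤ p' 0 := hB.minPath_le hp'.isPath 0
      omega
  · obtain ⟨A', B', ⟨hAB', hA', hB', eA, eB, gA, gB⟩, g⟩ := exists_separated he hl (k + 1)
      (P := fun A' B' => F A' B' ∧ IsConfig e l A' ∧ IsConfig e l B' ∧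
        nthPath A' (k + 1) = nthPath A (k + 1) ∧ nthPath B' (k + 1) = nthPath B (k + 1) ∧
        IsGreedy e l A' (nthPath A (k + 1)) ∧ IsGreedy e l B' p')
      (fun A' B' j hj ⟨hAB', hA', hB', eA, eB, gA, gB⟩ gAj gBj => by
        obtain ⟨-, hRj, hFj⟩ := ih j hj hA' hB' hAB' gAj
        have gA' : IsGreedy e l A' (nthPath A' (k + 1)) := by rw [eA]; exact gA
        refine ⟨hFj, hA'.step he hl j, hB'.step he hl j, ?_, ?_, ?_, ?_⟩
        · rw [hA'.nthPath_step_ne he hl gAj (by omega), eA]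
        · rw [hB'.nthPath_step_ne he hl gBj (by omega), eB]
        · rw [← eA, ← hA'.nthPath_step_ne he hl gAj (by omega)]
          exact hA'.greedy_step_ne he hl gAj gA' (by omega)
        -- The path `p'` stays greedy because it is not the pushed path: related paths are ordered
        -- in the same way, and the pushed path of `A'` lies below the `k`-th one.
        · refine gBj.mem_push he gB fun h => ?_
          have h1 : ∀ c, nthPath A' j c < nthPath A (k + 1) c := fun c => by
            rw [← eA]; exact hA'.nthPath_lt he hl hj c
          have h2 := (hF.lt_iff gAj gA gBj gB hRj hR).1 h1 0
          rw [h] at h2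
          omega)
      (fun A' B' h => ⟨h.2.1, h.2.2.1⟩) ⟨hAB, hA, hB, rfl, rfl, hk, hp'⟩
    obtain ⟨gAk, gBk⟩ := g k (by omega)
    obtain ⟨gAk', gBk'⟩ := g (k + 1) le_rfl
    obtain ⟨-, hRk, -⟩ := ih k (by omega) hA' hB' hAB' gAk
    have h1 : ∀ c, nthPath B' k c < p' c := (hF.lt_iff gAk gA gBk gB hRk hR).1 fun c => by
      rw [← eA]; exact hA'.nthPath_lt he hl (by omega) c
    rw [← eB]
    rcases gBk'.trichotomy he gB with h2 | h2 | h2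
    -- A greedy path of `B'` between the preceding path and `p'` would come from a greedy path of
    -- `A'` strictly between two successive paths.
    · obtain ⟨q, hq, hqR⟩ := hF.colift hA' hB' hAB' gBk'
      have h3 := (hF.lt_iff gAk hq gBk gBk' hRk hqR).2
        fun c => hB'.nthPath_lt he hl (by omega) c
      have h4 := (hF.lt_iff hq gA gBk' gB hqR hR).2 h2 0
      have h5 := hA'.nthPath_le_of_lt he hl hq.isPath h3 0
      rw [eA] at h5
      omega
    · exact h2
    · have h3 := hB'.nthPath_le_of_lt he hl gB.isPath h1 0
      have h4 := h2 0
      omega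

theorem Compatible.iterate_step (hF : Compatible e l F R) (he : 0 < e) (hl : 0 < l) (k n : ℕ)
    (hA : IsConfig e l A) (hB : IsConfig e l B) (hAB : F A B) (hk : HasSlack e l k n A) :
    F ((FockSpace.step k)^[n] A) ((FockSpace.step k)^[n] B) := by
  induction n generalizing A B with
  | zero => exact hAB
  | succ n ih =>
    exact ih (hA.step he hl k) (hB.step he hl k) (hF.step he hl k hA hB hAB hk.1).2.2 hk.2

theorem Compatible.pushAll (hF : Compatible e l F R) (he : 0 < e) (hl : 0 < l) {f : ℕ → ℕ}
    (hf : Antitone f) (n : ℕ) (hA : IsConfig e l A) (hB : IsConfig e l B) (hAB : F A B) :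
    F (FockSpace.pushAll f A n) (FockSpace.pushAll f B n) := by
  induction n with
  | zero => exact hAB
  | succ n ih =>
    exact hF.iterate_step he hl n _ (hA.pushAll he hl f n) (hB.pushAll he hl f n) ih
      (hA.hasSlack_pushAll he hl hf n)

/-- Every single push in `pushAll` is a push of a greedy path, so a property has to be checked for
these only. -/
theorem IsConfig.pushAll_induction (hA : IsConfig e l A) (he : 0 < e) (hl : 0 < l) {f : ℕ → ℕ}
    (hf : Antitone f) {P : Set (ℤ × ℤ) → Prop}
    (hP : ∀ A k, IsConfig e l A → IsGreedy e l A (nthPath A k) → P A → P (FockSpace.step k A))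
    (h : P A) (n : ℕ) : P (FockSpace.pushAll f A n) := by
  induction n with
  | zero => exact h
  | succ n ih =>
    have h1 := hA.hasSlack_pushAll he hl hf n
    have h2 := hA.pushAll he hl f n
    rw [FockSpace.pushAll]
    generalize FockSpace.pushAll f A n = B at ih h1 h2
    generalize f n = m at h1
    induction m generalizing B with
    | zero => exact ih
    | succ m ihm => exact ihm _ (hP B n h2 h1.1 ih) (h2.step he hl n) h1.2

end

/-! ### Good rows of a pair of adjacent columns -/

open Classical in
/-- The indicator function of a bead configuration. -/
noncomputable def ind (A : Set (ℤ × ℤ)) (c x : ℤ) : ℤ := if (c, x) ∈ A then 1 else 0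

theorem ind_of_mem {A : Set (ℤ × ℤ)} {c x : ℤ} (h : (c, x) ∈ A) : ind A c x = 1 := if_pos h

theorem ind_of_notMem {A : Set (ℤ × ℤ)} {c x : ℤ} (h : (c, x) ∉ A) : ind A c x = 0 := if_neg h

/-- `h` is a primitive of the difference of the columns `i` and `i + 1`. -/
def IsHeight (A : Set (ℤ × ℤ)) (i : ℤ) (h : ℤ → ℤ) : Prop :=
  ∀ x, h (x + 1) = h x + ind A i x - ind A (i + 1) x

theorem exists_isHeight (A : Set (ℤ × ℤ)) (i : ℤ) : ∃ h, IsHeight A i h := by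
  let w : ℤ → ℤ := fun x => ind A i x - ind A (i + 1) x
  refine ⟨fun x => match x with
    | Int.ofNat n => ∑ j ∈ Finset.range n, w j
    | Int.negSucc n => - ∑ j ∈ Finset.range (n + 1), w (-1 - j), fun x => ?_⟩
  match x with
  | Int.ofNat n =>
    change ∑ j ∈ Finset.range (n + 1), w j = _
    rw [Finset.sum_range_succ]
    simp only [w, Int.ofNat_eq_natCast]
    ring
  | Int.negSucc 0 =>
    change ∑ j ∈ Finset.range 0, w j = _
    simp [w, Int.negSucc_eq]
  | Int.negSucc (n + 1) =>
    have h1 : Int.negSucc (n + 1) + 1 = Int.negSucc n := by omega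
    rw [h1]
    change - ∑ j ∈ Finset.range (n + 1), w (-1 - j) = - ∑ j ∈ Finset.range (n + 1 + 1), w (-1 - j) + _ - _
    rw [Finset.sum_range_succ _ (n + 1)]
    have h2 : Int.negSucc (n + 1) = -1 - ((n + 1 : ℕ) : ℤ) := by omega
    rw [h2]
    simp only [w]
    ring

theorem IsHeight.sub_eq {A : Set (ℤ × ℤ)} {i : ℤ} {h h' : ℤ → ℤ} (H : IsHeight A i h)
    (H' : IsHeight A i h') (x y : ℤ) : h x - h y = h' x - h' y := by
  have key : ∀ x, h x - h' x = h 0 - h' 0 := fun x => by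
    induction x with
    | zero => rfl
    | succ n ih => rw [H, H']; linarith
    | pred n ih =>
      have h1 := H (-n - 1)
      have h2 := H' (-n - 1)
      simp only [sub_add_cancel] at h1 h2
      linarith
  linarith [key x, key y]

/-- The row of the good addable box, in the pair of columns `i`, `i + 1`. -/
structure IsAddRow (A : Set (ℤ × ℤ)) (i r : ℤ) : Prop where
  mem : (i, r) ∈ A
  notMem : (i + 1, r) ∉ A
  le : ∀ h, IsHeight A i h → ∀ x ≤ r, h r ≤ h x
  lt : ∀ h, IsHeight A i h → ∀ x, r < x → h r < h x

/-- The row of the good removable box, in the pair of columns `i`, `i + 1`. -/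
structure IsRemRow (A : Set (ℤ × ℤ)) (i r : ℤ) : Prop where
  notMem : (i, r) ∉ A
  mem : (i + 1, r) ∈ A
  lt : ∀ h, IsHeight A i h → ∀ x ≤ r, h (r + 1) < h x
  le : ∀ h, IsHeight A i h → ∀ x, r < x → h (r + 1) ≤ h x

theorem IsHeight.isAddRow {A : Set (ℤ × ℤ)} {i r : ℤ} {h : ℤ → ℤ} (H : IsHeight A i h)
    (h1 : (i, r) ∈ A) (h2 : (i + 1, r) ∉ A) (h3 : ∀ x ≤ r, h r ≤ h x) (h4 : ∀ x, r < x → h r < h x) :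
    IsAddRow A i r :=
  ⟨h1, h2, fun h' H' x hx => by have := H.sub_eq H' r x; have := h3 x hx; omega,
    fun h' H' x hx => by have := H.sub_eq H' r x; have := h4 x hx; omega⟩

theorem IsHeight.isRemRow {A : Set (ℤ × ℤ)} {i r : ℤ} {h : ℤ → ℤ} (H : IsHeight A i h)
    (h1 : (i, r) ∉ A) (h2 : (i + 1, r) ∈ A) (h3 : ∀ x ≤ r, h (r + 1) < h x)
    (h4 : ∀ x, r < x → h (r + 1) ≤ h x) : IsRemRow A i r :=
  ⟨h1, h2, fun h' H' x hx => by have := H.sub_eq H' (r + 1) x; have := h3 x hx; omega,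
    fun h' H' x hx => by have := H.sub_eq H' (r + 1) x; have := h4 x hx; omega⟩

/-- The good addable row is the greatest global minimum of the height. The good removable row `r` is
the one for which `r + 1` is the least global minimum. Heights differ by constants, so the choice of
the height is irrelevant. -/
theorem IsAddRow.unique {A : Set (ℤ × ℤ)} {i r r' : ℤ} (h : IsAddRow A i r) (h' : IsAddRow A i r') :
    r = r' := by
  obtain ⟨g, hg⟩ := exists_isHeight A i
  rcases lt_trichotomy r r' with hlt | hlt | hlt
  · have := h.lt g hg _ hlt
    have := h'.le g hg _ hlt.le
    omega
  · exact hlt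
  · have := h'.lt g hg _ hlt
    have := h.le g hg _ hlt.le
    omega

theorem IsRemRow.unique {A : Set (ℤ × ℤ)} {i r r' : ℤ} (h : IsRemRow A i r) (h' : IsRemRow A i r') :
    r = r' := by
  obtain ⟨g, hg⟩ := exists_isHeight A i
  rcases lt_trichotomy r r' with hlt | hlt | hlt
  · have := h.le g hg (r' + 1) (by omega)
    have := h'.lt g hg (r + 1) (by omega)
    omega
  · exact hlt
  · have := h'.le g hg (r + 1) (by omega)
    have := h.lt g hg (r' + 1) (by omega)
    omega

/-! ### Existence of good rows. -/

section
variable {e l : ℤ} {A B : Set (ℤ × ℤ)}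

theorem IsHeight.mem_of_lt {i r : ℤ} {h : ℤ → ℤ} (H : IsHeight A i h) (hr : h r < h (r + 1)) :
    (i, r) ∈ A ∧ (i + 1, r) ∉ A := by
  have := H r
  unfold ind at this
  split_ifs at this with h1 h2 h2
  · omega
  · exact ⟨h1, h2⟩
  · omega
  · omega

theorem IsHeight.mem_of_gt {i r : ℤ} {h : ℤ → ℤ} (H : IsHeight A i h) (hr : h (r + 1) < h r) :
    (i, r) ∉ A ∧ (i + 1, r) ∈ A := by
  have := H r
  unfold ind at this
  split_ifs at this with h1 h2 h2
  · omega
  · omega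
  · exact ⟨h1, h2⟩
  · omega

theorem IsConfig.height_low (hA : IsConfig e l A) {i : ℤ} {h : ℤ → ℤ} (H : IsHeight A i h) :
    ∃ X, ∀ x ≤ X, h x = h X := by
  obtain ⟨m, hm⟩ := hA.low i
  obtain ⟨m', hm'⟩ := hA.low (i + 1)
  refine ⟨min m m' , fun x hx => ?_⟩
  induction x, hx using Int.leInductionDown with
  | base => rfl
  | pred n hn ih =>
    have h1 : (i, n - 1) ∉ A := fun h => by have := hm _ h; omega
    have h2 : (i + 1, n - 1) ∉ A := fun h => by have := hm' _ h; omega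
    have := H (n - 1)
    rw [ind_of_notMem h1, ind_of_notMem h2] at this
    simp at this
    omega

theorem IsConfig.height_high (hA : IsConfig e l A) {i : ℤ} {h : ℤ → ℤ} (H : IsHeight A i h) :
    ∃ X, ∀ x, X ≤ x → h x = h X := by
  obtain ⟨m, hm⟩ := hA.high i
  obtain ⟨m', hm'⟩ := hA.high (i + 1)
  refine ⟨max m m' , fun x hx => ?_⟩
  induction x, hx using Int.leInduction with
  | base => rfl
  | succ n hn ih =>
    have := H n
    rw [ind_of_mem (hm n (by omega)), ind_of_mem (hm' n (by omega))] at this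
    omega

theorem IsConfig.exists_height_min (hA : IsConfig e l A) {i : ℤ} {h : ℤ → ℤ} (H : IsHeight A i h) :
    ∃ x, ∀ y, h x ≤ h y := by
  obtain ⟨X, hX⟩ := hA.height_low H
  obtain ⟨Y, hY⟩ := hA.height_high H
  obtain ⟨x, -, hx⟩ := Finset.exists_min_image (insert X (insert Y (Finset.Icc X Y))) h ⟨X, by simp⟩
  refine ⟨x, fun y => ?_⟩
  rcases le_total y X with h1 | h1
  · rw [hX y h1]; exact hx X (by simp)
  · rcases le_total Y y with h2 | h2
    · rw [hY y h2]; exact hx Y (by simp)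
    · exact hx y (by simp [h1, h2])

/-- The height is eventually constant in both directions, so it has a global minimum. A greatest one
exists when the value far above exceeds some other value; the height rises just after it, which
forces a bead in column `i` and a vacancy in column `i + 1`. -/
theorem IsConfig.exists_isAddRow (hA : IsConfig e l A) {i : ℤ} {h : ℤ → ℤ} (H : IsHeight A i h)
    {x Y : ℤ} (hx : ∀ y, Y ≤ y → h x < h y) : ∃ r, IsAddRow A i r := by
  obtain ⟨z, hz⟩ := hA.exists_height_min H
  obtain ⟨r, hr, hmax⟩ := Int.exists_greatest_of_bdd (P := fun r => h r = h z)
    ⟨Y, fun y hy => by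
      by_contra! hlt
      have := hx y hlt.le
      have := hz x
      omega⟩ ⟨z, rfl⟩
  have hlt : ∀ x, r < x → h r < h x := fun x hx => by
    by_contra! hle
    have := hmax x (by have := hz x; omega)
    omega
  have := H.mem_of_lt (hlt (r + 1) (by omega))
  exact ⟨r, H.isAddRow this.1 this.2 (fun x _ => hr ▸ hz x) hlt⟩

theorem IsConfig.exists_isRemRow (hA : IsConfig e l A) {i : ℤ} {h : ℤ → ℤ} (H : IsHeight A i h)
    {x X : ℤ} (hx : ∀ y ≤ X, h x < h y) : ∃ r, IsRemRow A i r := by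
  obtain ⟨z, hz⟩ := hA.exists_height_min H
  obtain ⟨r, hr, hmin⟩ := Int.exists_least_of_bdd (P := fun r => h r = h z)
    ⟨X, fun y hy => by
      by_contra! hlt
      have := hx y hlt.le
      have := hz x
      omega⟩ ⟨z, rfl⟩
  have hlt : ∀ x < r, h r < h x := fun x hx => by
    by_contra! hle
    have := hmin x (by have := hz x; omega)
    omega
  have := H.mem_of_gt (r := r - 1) (by rw [sub_add_cancel]; exact hlt (r - 1) (by omega))
  refine ⟨r - 1, H.isRemRow this.1 this.2 (fun x hx => ?_) fun x _ => ?_⟩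
  · rw [sub_add_cancel]; exact hlt x (by omega)
  · rw [sub_add_cancel, hr]; exact hz x

/-! ### Heights and greedy paths -/

/-- The height function after the beads of the path `p` are pushed. -/
def pushHeight (p : ℤ → ℤ) (i : ℤ) (h : ℤ → ℤ) (x : ℤ) : ℤ :=
  h x + (if p (i - 1) < x ∧ x ≤ p i then 1 else 0) - (if p i < x ∧ x ≤ p (i + 1) then 1 else 0)

theorem IsGreedy.ind_push {p : ℤ → ℤ} (hp : IsGreedy e l A p) (c x : ℤ) :
    ind (push A p) c x =
      ind A c x - (if x = p c then 1 else 0) + if x = p (c - 1) then 1 else 0 := by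
  have h := hp.le c
  have hm := hp.mem c
  by_cases a2 : x = p (c - 1)
  · rw [ind_of_mem (Or.inr a2), if_pos a2]
    by_cases a1 : x = p c
    · rw [if_pos a1, a1, ind_of_mem hm]; rfl
    · rw [if_neg a1, ind_of_notMem (hp.gap c x (by omega) (by omega))]; rfl
  · rw [if_neg a2]
    by_cases a1 : x = p c
    · rw [if_pos a1, ind_of_notMem (A := push A p), a1, ind_of_mem hm]
      · rfl
      · rintro (h' | h')
        · exact h'.2 a1
        · exact a2 h'
    · rw [if_neg a1]
      by_cases m : (c, x) ∈ A
      · rw [ind_of_mem m, ind_of_mem (A := push A p) (Or.inl ⟨m, a1⟩)]; rfl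
      · rw [ind_of_notMem m, ind_of_notMem (A := push A p)]
        · rfl
        · rintro (h' | h')
          · exact m h'.1
          · exact a2 h'

/-- Column `i` loses row `p i` and gains row `p (i - 1)`, column `i + 1` loses row `p (i + 1)` and
gains row `p i`. So the height goes up by one between `p (i - 1)` and `p i`, and down by one between
`p i` and `p (i + 1)`. -/
theorem IsGreedy.isHeight_push {p : ℤ → ℤ} (hp : IsGreedy e l A p) {i : ℤ} {h : ℤ → ℤ}
    (H : IsHeight A i h) : IsHeight (push A p) i (pushHeight p i h) := by
  intro x
  have h1 := hp.le i
  have h2 := hp.le (i + 1)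
  simp only [add_sub_cancel_right] at h2
  have e1 := hp.ind_push i x
  have e2 := hp.ind_push (i + 1) x
  rw [add_sub_cancel_right] at e2
  rw [e1, e2, pushHeight, pushHeight, H x]
  have : p (i - 1) ≤ p i := h1
  split_ifs <;> omega

/-- Column `i` has no beads from row `p (i - 1)` up to `p i`, and column `i + 1` has none from row
`p i` up to `p (i + 1)`. So the height falls weakly towards `p i` and rises weakly after it
(`IsGreedy.height_mono`). -/
theorem IsGreedy.height_anti {p : ℤ → ℤ} (hp : IsGreedy e l A p) {i : ℤ} {h : ℤ → ℤ}
    (H : IsHeight A i h) {x y : ℤ} (h1 : p (i - 1) ≤ x) (h2 : x ≤ y) (h3 : y ≤ p i) : h y ≤ h x := by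
  induction y, h2 using Int.leInduction with
  | base => rfl
  | succ n hn ih =>
    have := H n
    rw [ind_of_notMem (hp.gap i n (by omega) (by omega))] at this
    have : 0 ≤ ind A (i + 1) n := by unfold ind; split_ifs <;> simp
    have := ih (by omega)
    omega

theorem IsGreedy.height_mono {p : ℤ → ℤ} (hp : IsGreedy e l A p) {i : ℤ} {h : ℤ → ℤ}
    (H : IsHeight A i h) {x y : ℤ} (h1 : p i ≤ x) (h2 : x ≤ y) (h3 : y ≤ p (i + 1)) : h x ≤ h y := by
  induction y, h2 using Int.leInduction with
  | base => rfl
  | succ n hn ih =>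
    have := H n
    rw [ind_of_notMem (hp.gap (i + 1) n (by simp; omega) (by omega))] at this
    have : 0 ≤ ind A i n := by unfold ind; split_ifs <;> simp
    have := ih (by omega)
    omega

theorem IsGreedy.height_succ {p : ℤ → ℤ} (hp : IsGreedy e l A p) {i : ℤ} {h : ℤ → ℤ}
    (H : IsHeight A i h) (h1 : p i < p (i + 1)) : h (p i + 1) = h (p i) + 1 := by
  rw [H, ind_of_mem (hp.mem i), ind_of_notMem (hp.gap (i + 1) _ (by simp) h1)]
  omega

theorem IsGreedy.height_gt {p : ℤ → ℤ} (hp : IsGreedy e l A p) {i : ℤ} {h : ℤ → ℤ}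
    (H : IsHeight A i h) {x : ℤ} (h1 : p i < x) (h2 : x ≤ p (i + 1)) : h (p i) < h x := by
  have := hp.height_succ H (by omega)
  have := hp.height_mono H (x := p i + 1) (y := x) (by omega) (by omega) h2
  omega

/-- The push lowers the height only on the range above `p i` where it exceeds the height at `p i`.
So its minimum does not decrease, while its values far away do not change. Hence a push creates no
good addable or removable row. -/
theorem IsGreedy.exists_height_le {p : ℤ → ℤ} (hp : IsGreedy e l A p) {i : ℤ} {h : ℤ → ℤ}
    (H : IsHeight A i h) (x : ℤ) : ∃ y, h y ≤ pushHeight p i h x := by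
  by_cases h1 : p i < x ∧ x ≤ p (i + 1)
  · refine ⟨p i, ?_⟩
    have := hp.height_gt H h1.1 h1.2
    unfold pushHeight
    split_ifs <;> omega
  · refine ⟨x, ?_⟩
    unfold pushHeight
    rw [if_neg h1]
    split_ifs <;> omega

theorem IsGreedy.exists_isAddRow_of_push {p : ℤ → ℤ} (hp : IsGreedy e l A p) (hA : IsConfig e l A)
    {i : ℤ} (h : ∃ r, IsAddRow (push A p) i r) : ∃ r, IsAddRow A i r := by
  obtain ⟨r, hr⟩ := h
  obtain ⟨h, H⟩ := exists_isHeight A i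
  obtain ⟨x, hx⟩ := hp.exists_height_le H r
  refine hA.exists_isAddRow H (x := x) (Y := max (r + 1) (p (i + 1) + 1)) fun y hy => ?_
  have h1 := hr.lt _ (hp.isHeight_push H) y (by omega)
  have h2 : pushHeight p i h y = h y := by
    have := hp.monotone (show i ≤ i + 1 by omega)
    unfold pushHeight
    split_ifs <;> omega
  omega

theorem IsGreedy.exists_isRemRow_of_push {p : ℤ → ℤ} (hp : IsGreedy e l A p) (hA : IsConfig e l A)
    {i : ℤ} (h : ∃ r, IsRemRow (push A p) i r) : ∃ r, IsRemRow A i r := by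
  obtain ⟨r, hr⟩ := h
  obtain ⟨h, H⟩ := exists_isHeight A i
  obtain ⟨x, hx⟩ := hp.exists_height_le H (r + 1)
  refine hA.exists_isRemRow H (x := x) (X := min r (p (i - 1))) fun y hy => ?_
  have h1 := hr.lt _ (hp.isHeight_push H) y (by omega)
  have h2 : pushHeight p i h y = h y := by
    have := hp.monotone (show i - 1 ≤ i by omega)
    unfold pushHeight
    split_ifs <;> omega
  omega

end

/-! ### Moving a bead to the next column -/

/-- The bead in position `(i, r)`, with all its translates, moves one step to the right. -/
def moveBead (e l : ℤ) (A : Set (ℤ × ℤ)) (i r : ℤ) : Set (ℤ × ℤ) :=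
  {x | (x ∈ A ∧ ¬ ∃ k, x.1 = i + k * e ∧ x.2 = r + k * l) ∨ ∃ k, x.1 = i + 1 + k * e ∧ x.2 = r + k * l}

/-- The good addable bead of the columns `i` and `i + 1` moves to the right. -/
def AddRel (e l i : ℤ) (A B : Set (ℤ × ℤ)) : Prop := ∃ r, IsAddRow A i r ∧ B = moveBead e l A i r

/-- The two paths agree outside of the columns congruent to `i`. -/
def Agree (e i : ℤ) (p p' : ℤ → ℤ) : Prop := ∀ c, ¬ e ∣ c - i → p c = p' c

/-- The path `p` with its value in column `i`, and in the translates of this column, changed. -/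
def updatePath (e l : ℤ) (p : ℤ → ℤ) (i b c : ℤ) : ℤ :=
  if e ∣ c - i then b + (c - i) / e * l else p c

/-- The greedy rule at a single column, to be checked separately in the two columns touched by a
move and in the others. -/
def GreedyAt (A : Set (ℤ × ℤ)) (p : ℤ → ℤ) (c : ℤ) : Prop :=
  p (c - 1) ≤ p c ∧ (c, p c) ∈ A ∧ ∀ r, p (c - 1) ≤ r → r < p c → (c, r) ∉ A

section
variable {e l : ℤ} {A B : Set (ℤ × ℤ)}

theorem not_dvd_add_one_sub (he : 2 ≤ e) (i : ℤ) : ¬ e ∣ i + 1 - i := by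
  rw [add_sub_cancel_left]
  intro h
  have := Int.le_of_dvd one_pos h
  omega

theorem not_dvd_sub_one_sub (he : 2 ≤ e) (i : ℤ) : ¬ e ∣ i - 1 - i := by
  intro h
  have := Int.le_of_dvd one_pos ((dvd_neg.2 h).trans (by simp))
  omega

theorem add_mul_ne_add_one (he : 2 ≤ e) (i k : ℤ) : i + 1 ≠ i + k * e := fun h =>
  not_dvd_add_one_sub he i ⟨k, by rw [h]; ring⟩

theorem ne_add_one_add_mul (he : 2 ≤ e) (i k : ℤ) : i ≠ i + 1 + k * e := fun h =>
  not_dvd_sub_one_sub he i ⟨k, by linarith⟩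

theorem mem_moveBead_left (he : 2 ≤ e) {i r x : ℤ} :
    (i, x) ∈ moveBead e l A i r ↔ (i, x) ∈ A ∧ x ≠ r := by
  have h1 : (∃ k, i = i + k * e ∧ x = r + k * l) ↔ x = r :=
    ⟨fun ⟨k, hk, hx⟩ => by
      have : k = 0 := by
        rcases mul_eq_zero.1 (show k * e = 0 by linarith) with h | h
        · exact h
        · omega
      simpa [this] using hx, fun h => ⟨0, by simp [h]⟩⟩
  have h2 : ¬ ∃ k, i = i + 1 + k * e ∧ x = r + k * l := fun ⟨k, hk, _⟩ => ne_add_one_add_mul he i k hk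
  simp only [moveBead, Set.mem_ofPred_eq, h1, h2, or_false, ne_eq]

theorem mem_moveBead_right (he : 2 ≤ e) {i r x : ℤ} :
    (i + 1, x) ∈ moveBead e l A i r ↔ (i + 1, x) ∈ A ∨ x = r := by
  have h1 : (∃ k, i + 1 = i + 1 + k * e ∧ x = r + k * l) ↔ x = r :=
    ⟨fun ⟨k, hk, hx⟩ => by
      have : k = 0 := by
        rcases mul_eq_zero.1 (show k * e = 0 by linarith) with h | h
        · exact h
        · omega
      simpa [this] using hx, fun h => ⟨0, by simp [h]⟩⟩
  have h2 : ¬ ∃ k, i + 1 = i + k * e ∧ x = r + k * l := fun ⟨k, hk, _⟩ => add_mul_ne_add_one he i k hk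
  simp only [moveBead, Set.mem_ofPred_eq, h1, h2, not_false_eq_true, and_true]

theorem mem_moveBead_other {i r c x : ℤ} (h : ¬ e ∣ c - i) (h' : ¬ e ∣ c - (i + 1)) :
    (c, x) ∈ moveBead e l A i r ↔ (c, x) ∈ A := by
  have h1 : ¬ ∃ k, c = i + k * e ∧ x = r + k * l := fun ⟨k, hk, _⟩ => h ⟨k, by rw [hk]; ring⟩
  have h2 : ¬ ∃ k, c = i + 1 + k * e ∧ x = r + k * l := fun ⟨k, hk, _⟩ => h' ⟨k, by rw [hk]; ring⟩
  simp only [moveBead, Set.mem_ofPred_eq, h1, h2, not_false_eq_true, and_true, or_false]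

theorem IsConfig.moveBead (hA : IsConfig e l A) (he : 2 ≤ e) (i r : ℤ) :
    IsConfig e l (moveBead e l A i r) := by
  refine hA.congr_far (fun c x => ?_) fun c => ?_
  · have key : ∀ i, (∃ k, c + e = i + k * e ∧ x + l = r + k * l) ↔ ∃ k, c = i + k * e ∧ x = r + k * l :=
      fun i => ⟨fun ⟨k, h1, h2⟩ => ⟨k - 1, by linarith, by linarith⟩,
        fun ⟨k, h1, h2⟩ => ⟨k + 1, by linarith, by linarith⟩⟩
    simp only [FockSpace.moveBead, Set.mem_ofPred_eq, hA.periodic, key]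
  · have key : ∀ i x, (∃ k, c = i + k * e ∧ x = r + k * l) → x = r + (c - i) / e * l := by
      rintro i x ⟨k, h1, h2⟩
      rw [h1, add_sub_cancel_left, Int.mul_ediv_cancel _ (by omega), h2]
    refine ⟨min (r + (c - i) / e * l) (r + (c - (i + 1)) / e * l),
      max (r + (c - i) / e * l) (r + (c - (i + 1)) / e * l), fun x hx => ?_⟩
    have h1 : ¬ ∃ k, c = i + k * e ∧ x = r + k * l := fun h => by
      have := key _ _ h
      omega
    have h2 : ¬ ∃ k, c = i + 1 + k * e ∧ x = r + k * l := fun h => by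
      have := key _ _ h
      omega
    simp only [FockSpace.moveBead, Set.mem_ofPred_eq, h1, h2, not_false_eq_true, and_true, or_false]

/-- A property of columns that is invariant under translation can be checked in the columns `i`,
`i + 1` and those not congruent to them. -/
theorem forall_columns {P : ℤ → Prop} (hP : ∀ c k, P (c + k * e) ↔ P c) (i : ℤ)
    (h1 : P i) (h2 : P (i + 1)) (h3 : ∀ c, ¬ e ∣ c - i → ¬ e ∣ c - (i + 1) → P c) (c : ℤ) : P c := by
  by_cases hi : e ∣ c - i
  · obtain ⟨k, hk⟩ := hi
    rw [show c = i + k * e by linarith, hP]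
    exact h1
  · by_cases hi' : e ∣ c - (i + 1)
    · obtain ⟨k, hk⟩ := hi'
      rw [show c = i + 1 + k * e by linarith, hP]
      exact h2
    · exact h3 c hi hi'

theorem IsConfig.ext_columns (hA : IsConfig e l A) (hB : IsConfig e l B) (i : ℤ)
    (h1 : ∀ x, (i, x) ∈ A ↔ (i, x) ∈ B) (h2 : ∀ x, (i + 1, x) ∈ A ↔ (i + 1, x) ∈ B)
    (h3 : ∀ c, ¬ e ∣ c - i → ¬ e ∣ c - (i + 1) → ∀ x, (c, x) ∈ A ↔ (c, x) ∈ B) : A = B := by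
  have := forall_columns (e := e) (P := fun c => ∀ x, (c, x) ∈ A ↔ (c, x) ∈ B) (fun c k => ?_) i h1 h2 h3
  · ext ⟨c, x⟩
    exact this c x
  · constructor
    · intro h x
      have := h (x + k * l)
      rwa [hA.add_mul, hB.add_mul] at this
    · intro h x
      have := h (x - k * l)
      rw [← hA.add_mul c _ k, ← hB.add_mul c _ k] at this
      simpa using this

theorem greedyAt_add_mul (hA : IsConfig e l A) {p : ℤ → ℤ} (hp : IsPeriodic e l p) (c k : ℤ) :
    GreedyAt A p (c + k * e) ↔ GreedyAt A p c := by
  unfold GreedyAt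
  rw [show c + k * e - 1 = c - 1 + k * e by ring, hp.add_mul, hp.add_mul, hA.add_mul]
  refine and_congr (by simp) (and_congr Iff.rfl ⟨fun h r h1 h2 => ?_, fun h r h1 h2 => ?_⟩)
  · rw [← hA.add_mul c r k]
    exact h _ (by omega) (by omega)
  · have := h (r - k * l) (by omega) (by omega)
    rw [← hA.add_mul c _ k] at this
    simpa using this

theorem IsGreedy.greedyAt {p : ℤ → ℤ} (hp : IsGreedy e l A p) (c : ℤ) : GreedyAt A p c :=
  ⟨hp.le c, hp.mem c, hp.gap c⟩

theorem IsConfig.isGreedy_of_columns (hA : IsConfig e l A) {p : ℤ → ℤ} (hp : IsPeriodic e l p) (i : ℤ)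
    (h1 : GreedyAt A p i) (h2 : GreedyAt A p (i + 1))
    (h3 : ∀ c, ¬ e ∣ c - i → ¬ e ∣ c - (i + 1) → GreedyAt A p c) : IsGreedy e l A p := by
  have := forall_columns (greedyAt_add_mul hA hp) i h1 h2 h3
  exact ⟨hp, fun c => (this c).1, fun c => (this c).2.1, fun c => (this c).2.2⟩

theorem IsPeriodic.updatePath {p : ℤ → ℤ} (hp : IsPeriodic e l p) (he : 2 ≤ e) (i b : ℤ) :
    IsPeriodic e l (updatePath e l p i b) := by
  intro c
  unfold FockSpace.updatePath
  have h1 : e ∣ c + e - i ↔ e ∣ c - i := by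
    rw [show c + e - i = c - i + e by ring]; exact dvd_add_self_right
  have h2 : (c + e - i) / e = (c - i) / e + 1 := by
    rw [show c + e - i = c - i + 1 * e by ring, Int.add_mul_ediv_right _ _ (by omega)]
  by_cases h : e ∣ c - i
  · rw [if_pos (h1.2 h), if_pos h, h2]; ring
  · rw [if_neg (mt h1.1 h), if_neg h, hp]

@[simp] theorem updatePath_self (p : ℤ → ℤ) (i b : ℤ) : updatePath e l p i b i = b := by
  simp [updatePath]

theorem updatePath_of_not_dvd (p : ℤ → ℤ) {i b c : ℤ} (h : ¬ e ∣ c - i) :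
    updatePath e l p i b c = p c := if_neg h

theorem agree_updatePath (p : ℤ → ℤ) (i b : ℤ) : Agree e i p (updatePath e l p i b) :=
  fun _ hc => (updatePath_of_not_dvd p hc).symm

theorem updatePath_agree (p : ℤ → ℤ) (i b : ℤ) : Agree e i (updatePath e l p i b) p :=
  fun _ hc => updatePath_of_not_dvd p hc

theorem not_dvd_pred {i c : ℤ} (h : ¬ e ∣ c - (i + 1)) : ¬ e ∣ c - 1 - i := by
  rwa [show c - 1 - i = c - (i + 1) by ring]

/-- The case in which the good row is not the row of the path. -/
theorem IsGreedy.lift_of_ne (he : 2 ≤ e) (hA : IsConfig e l A) {p : ℤ → ℤ} (hp : IsGreedy e l A p)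
    {i r : ℤ} (hr : IsAddRow A i r) (hne : r ≠ p i) :
    IsGreedy e l (moveBead e l A i r) p ∧
      AddRel e l i (push A p) (push (moveBead e l A i r) p) := by
  obtain ⟨h, H⟩ := exists_isHeight A i
  have hB := hA.moveBead he i r
  have h1 := hp.le i
  have h2 := hp.le (i + 1)
  rw [add_sub_cancel_right] at h2
  -- Column `i` is empty between `p (i - 1)` and `p i`, and between `p i` and `p (i + 1)` the height
  -- exceeds the one at `p i`. So the good row lies outside of the range in which the path interacts
  -- with the two columns.
  have hpos : r < p (i - 1) ∨ p (i + 1) < r := by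
    by_contra! hcon
    rcases lt_or_gt_of_ne hne with hlt | hlt
    · exact hp.gap i r hcon.1 hlt hr.mem
    · have := hp.height_gt H hlt hcon.2
      have := hr.le h H (p i) hlt.le
      omega
  constructor
  · refine hB.isGreedy_of_columns hp.periodic i ⟨hp.le i, ?_, fun x hx hx' => ?_⟩
      ⟨hp.le _, ?_, fun x hx hx' => ?_⟩ fun c hc hc' => ⟨hp.le c, ?_, fun x hx hx' => ?_⟩
    · rw [mem_moveBead_left he]; exact ⟨hp.mem i, hne.symm⟩
    · rw [mem_moveBead_left he]; exact fun h => hp.gap i x hx hx' h.1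
    · rw [mem_moveBead_right he]; exact Or.inl (hp.mem _)
    · rw [mem_moveBead_right he]
      rintro (h | h)
      · exact hp.gap _ x hx hx' h
      · rw [add_sub_cancel_right] at hx
        omega
    · rw [mem_moveBead_other hc hc']; exact hp.mem c
    · rw [mem_moveBead_other hc hc']; exact hp.gap c x hx hx'
  · refine ⟨r, ?_, ?_⟩
    · refine (hp.isHeight_push H).isAddRow (Or.inl ⟨hr.mem, hne⟩) ?_ (fun x hx => ?_) fun x hx => ?_
      · rintro (h | h)
        · exact hr.notMem h.1
        · simp only [add_sub_cancel_right] at h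
          omega
      · have h3 := hr.le h H x hx
        have h4 := fun a b => hp.height_gt H (x := x) a b
        have h5 := hr.le h H (p i)
        unfold pushHeight
        split_ifs <;> omega
      · have h3 := hr.lt h H x hx
        have h4 := fun a b => hp.height_gt H (x := x) a b
        have h5 := hr.lt h H (p i)
        unfold pushHeight
        split_ifs <;> omega
    · refine (hB.push hp.periodic).ext_columns ((hA.push hp.periodic).moveBead he i r) i
        (fun x => ?_) (fun x => ?_) fun c hc hc' x => ?_
      · rw [mem_moveBead_left he, FockSpace.mem_push, FockSpace.mem_push, mem_moveBead_left he]
        have : p (i - 1) ≠ r := by omega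
        constructor
        · rintro (h | h)
          · exact ⟨Or.inl ⟨h.1.1, h.2⟩, h.1.2⟩
          · exact ⟨Or.inr h, by omega⟩
        · rintro ⟨h | h, h'⟩
          · exact Or.inl ⟨⟨h.1, h'⟩, h.2⟩
          · exact Or.inr h
      · rw [mem_moveBead_right he, FockSpace.mem_push, FockSpace.mem_push, mem_moveBead_right he]
        have : p (i + 1) ≠ r := by omega
        constructor
        · rintro (⟨h | h, h'⟩ | h)
          · exact Or.inl (Or.inl ⟨h, h'⟩)
          · exact Or.inr h
          · exact Or.inl (Or.inr h)
        · rintro ((h | h) | h)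
          · exact Or.inl ⟨Or.inl h.1, h.2⟩
          · exact Or.inr h
          · exact Or.inl ⟨Or.inr h, by omega⟩
      · rw [mem_moveBead_other hc hc', FockSpace.mem_push, FockSpace.mem_push, mem_moveBead_other hc hc']

/-- The case in which the good row is the row of the path. -/
theorem IsGreedy.lift_of_eq (he : 2 ≤ e) (hA : IsConfig e l A) {p : ℤ → ℤ} (hp : IsGreedy e l A p)
    {i : ℤ} (hr : IsAddRow A i (p i)) : ∃ b,
    IsGreedy e l (moveBead e l A i (p i)) (updatePath e l p i b) ∧
      AddRel e l i (push A p) (push (moveBead e l A i (p i)) (updatePath e l p i b)) := by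
  obtain ⟨h, H⟩ := exists_isHeight A i
  have hB := hA.moveBead he i (p i)
  have h1 := hp.le i
  have h2 := hp.le (i + 1)
  rw [add_sub_cancel_right] at h2
  have hlt : p i < p (i + 1) := lt_of_le_of_ne h2 fun h => hr.notMem (h ▸ hp.mem (i + 1))
  -- When the bead of the path in column `i` is moved away, the path has to take the next bead `b`
  -- of this column.
  obtain ⟨b, ⟨hb, hbm⟩, hmin⟩ := Int.exists_least_of_bdd (P := fun x => p i < x ∧ (i, x) ∈ A)
    ⟨p i, fun x hx => hx.1.le⟩ (by
      obtain ⟨M, hM⟩ := hA.high i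
      exact ⟨max M (p i + 1), by omega, hM _ (by omega)⟩)
  have hgap : ∀ x, p i < x → x < b → (i, x) ∉ A := fun x h3 h4 h5 => by
    have := hmin x ⟨h3, h5⟩
    omega
  -- Both columns are empty in this range.
  have hconst : ∀ y, p i + 1 ≤ y → y ≤ p (i + 1) → y ≤ b → h y = h (p i + 1) := by
    intro y hy
    induction y, hy using Int.leInduction with
    | base => exact fun _ _ => rfl
    | succ n hn ih =>
      intro h3 h4
      rw [H, ind_of_notMem (hgap n (by omega) (by omega)),
        ind_of_notMem (hp.gap (i + 1) n (by simp; omega) (by omega)), ih (by omega) (by omega)]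
      ring
  -- Otherwise the bead of the path in column `i + 1` would bring the height back to its value at `p
  -- i`, which is the last global minimum.
  have hbc : b ≤ p (i + 1) := by
    by_contra! hcon
    have h3 := hconst (p (i + 1)) (by omega) le_rfl hcon.le
    have h4 := H (p (i + 1))
    rw [ind_of_notMem (hgap _ hlt hcon), ind_of_mem (hp.mem (i + 1))] at h4
    have h5 := hr.lt h H (p (i + 1) + 1) (by omega)
    have h6 := hp.height_succ H hlt
    omega
  have hpu := hp.periodic.updatePath he i b
  have u1 : updatePath e l p i b (i + 1) = p (i + 1) :=
    updatePath_of_not_dvd p (not_dvd_add_one_sub he i)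
  have u2 : updatePath e l p i b (i - 1) = p (i - 1) :=
    updatePath_of_not_dvd p (not_dvd_sub_one_sub he i)
  refine ⟨b, ?_, ?_⟩
  · refine hB.isGreedy_of_columns hpu i ?_ ?_ fun c hc hc' => ?_
    · rw [GreedyAt, u2, updatePath_self, mem_moveBead_left he]
      refine ⟨by omega, ⟨hbm, by omega⟩, fun x hx hx' => ?_⟩
      rw [mem_moveBead_left he]
      rintro ⟨h3, h4⟩
      rcases lt_or_gt_of_ne h4 with h5 | h5
      · exact hp.gap i x hx h5 h3
      · exact hgap x h5 hx' h3
    · rw [GreedyAt, add_sub_cancel_right, updatePath_self, u1, mem_moveBead_right he]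
      refine ⟨hbc, Or.inl (hp.mem _), fun x hx hx' => ?_⟩
      rw [mem_moveBead_right he]
      rintro (h3 | h3)
      · exact hp.gap (i + 1) x (by simp; omega) hx' h3
      · omega
    · rw [GreedyAt, updatePath_of_not_dvd p hc, updatePath_of_not_dvd p (not_dvd_pred hc'),
        mem_moveBead_other hc hc']
      simp only [mem_moveBead_other hc hc']
      exact hp.greedyAt c
  · refine ⟨b, ?_, ?_⟩
    · refine (hp.isHeight_push H).isAddRow (Or.inl ⟨hbm, by simp only; omega⟩) ?_ (fun x hx => ?_)
        fun x hx => ?_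
      · rintro (h3 | h3)
        · simp only at h3
          rcases hbc.lt_or_eq with h4 | h4
          · exact hp.gap (i + 1) b (by simp; omega) h4 h3.1
          · exact h3.2 h4
        · simp only [add_sub_cancel_right] at h3
          omega
      · have h3 := hconst b (by omega) hbc le_rfl
        have h4 := hp.height_succ H hlt
        -- After the push, the minimal value of the height is attained at `b`, which replaces `p i`
        -- as the last minimum.
        have h5 : pushHeight p i h b = h (p i) := by
          unfold pushHeight
          split_ifs <;> omega
        rw [h5]
        have h6 := fun a b => hp.height_gt H (x := x) a b
        have h7 := hr.le h H x
        have h8 := hp.height_anti H (x := x) (y := p i)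
        unfold pushHeight
        split_ifs <;> omega
      · have h3 := hconst b (by omega) hbc le_rfl
        have h4 := hp.height_succ H hlt
        have h5 : pushHeight p i h b = h (p i) := by
          unfold pushHeight
          split_ifs <;> omega
        rw [h5]
        have h6 := hr.lt h H x (by omega)
        by_cases h7 : x ≤ p (i + 1)
        · have h8 := hp.height_mono H (x := b + 1) (y := x) (by omega) (by omega) h7
          have h9 := H b
          rw [ind_of_mem hbm, ind_of_notMem (hp.gap (i + 1) b (by simp; omega) (by omega))] at h9
          unfold pushHeight
          split_ifs <;> omega
        · unfold pushHeight
          split_ifs <;> omega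
    · refine (hB.push hpu).ext_columns ((hA.push hp.periodic).moveBead he i b) i
        (fun x => ?_) (fun x => ?_) fun c hc hc' x => ?_
      · rw [mem_moveBead_left he, FockSpace.mem_push, FockSpace.mem_push, mem_moveBead_left he, updatePath_self, u2]
        constructor
        · rintro (h | h)
          · exact ⟨Or.inl h.1, h.2⟩
          · exact ⟨Or.inr h, by omega⟩
        · rintro ⟨h | h, h'⟩
          · exact Or.inl ⟨h, h'⟩
          · exact Or.inr h
      · rw [mem_moveBead_right he, FockSpace.mem_push, FockSpace.mem_push, mem_moveBead_right he, u1,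
          add_sub_cancel_right, updatePath_self]
        constructor
        · rintro (⟨h | h, h'⟩ | h)
          · exact Or.inl (Or.inl ⟨h, h'⟩)
          · exact Or.inl (Or.inr h)
          · exact Or.inr h
        · rintro ((h | h) | h)
          · exact Or.inl ⟨Or.inl h.1, h.2⟩
          · exact Or.inl ⟨Or.inr h, by omega⟩
          · exact Or.inr h
      · rw [mem_moveBead_other hc hc', FockSpace.mem_push, FockSpace.mem_push, mem_moveBead_other hc hc',
          updatePath_of_not_dvd p hc, updatePath_of_not_dvd p (not_dvd_pred hc')]

/-- Before the move, `q` is still greedy unless the moved bead lies in column `i` between `q (i -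
1)` and `q i`. In that case the path through this bead is the greedy one. -/
theorem IsAddRow.colift (he : 2 ≤ e) (hA : IsConfig e l A) {q : ℤ → ℤ} {i r : ℤ}
    (hr : IsAddRow A i r) (hq : IsGreedy e l (moveBead e l A i r) q) :
    ∃ p, IsGreedy e l A p ∧ Agree e i p q := by
  obtain ⟨h, H⟩ := exists_isHeight A i
  have m1 := (mem_moveBead_left he).1 (hq.mem i)
  have g1 : ∀ x, q (i - 1) ≤ x → x < q i → (i, x) ∈ A → x = r := fun x h1 h2 h3 => by
    by_contra h4
    exact hq.gap i x h1 h2 ((mem_moveBead_left he).2 ⟨h3, h4⟩)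
  have g2 : ∀ x, q i ≤ x → x < q (i + 1) → (i + 1, x) ∉ A := fun x h1 h2 h3 =>
    hq.gap (i + 1) x (by simpa using h1) h2 ((mem_moveBead_right he).2 (Or.inl h3))
  have h1 := hq.le i
  have h2 := hq.le (i + 1)
  rw [add_sub_cancel_right] at h2
  -- The path cannot use the bead that has arrived in column `i + 1`: the height would exceed its
  -- value at `q i` all the way up to row `r`, which is a global minimum.
  have hne : q (i + 1) ≠ r := by
    intro heq
    have key : ∀ y, q i + 1 ≤ y → y ≤ r → h (q i) < h y := by
      intro y hy
      induction y, hy using Int.leInduction with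
      | base =>
        intro h4
        rw [H, ind_of_mem m1.1, ind_of_notMem (g2 _ le_rfl (by omega))]
        omega
      | succ n hn ih =>
        intro h4
        have h5 := ih (by omega)
        have h6 := H n
        rw [ind_of_notMem (g2 n (by omega) (by omega))] at h6
        have : 0 ≤ ind A i n := by unfold ind; split_ifs <;> simp
        omega
    have h4 := key r (by omega) le_rfl
    have h5 := hr.le h H (q i) (by omega)
    omega
  have m2 : (i + 1, q (i + 1)) ∈ A := ((mem_moveBead_right he).1 (hq.mem (i + 1))).resolve_right hne
  by_cases hcase : q (i - 1) ≤ r ∧ r < q i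
  · obtain ⟨hc1, hc2⟩ := hcase
    refine ⟨updatePath e l q i r, ?_, updatePath_agree q i r⟩
    have u1 : updatePath e l q i r (i + 1) = q (i + 1) :=
      updatePath_of_not_dvd q (not_dvd_add_one_sub he i)
    have u2 : updatePath e l q i r (i - 1) = q (i - 1) :=
      updatePath_of_not_dvd q (not_dvd_sub_one_sub he i)
    refine hA.isGreedy_of_columns (hq.periodic.updatePath he i r) i ?_ ?_ fun c hc hc' => ?_
    · rw [GreedyAt, u2, updatePath_self]
      refine ⟨hc1, hr.mem, fun x h3 h4 h5 => ?_⟩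
      have := g1 x h3 (by omega) h5
      omega
    · rw [GreedyAt, u1, add_sub_cancel_right, updatePath_self]
      refine ⟨by omega, m2, fun x h3 h4 h5 => ?_⟩
      by_cases h6 : q i ≤ x
      · exact g2 x h6 h4 h5
      · have h7 : x ≠ r := fun h => hr.notMem (h ▸ h5)
        -- Column `i` is empty above `r` up to `q i`, so the height does not rise there. A bead of
        -- column `i + 1` in this range would bring the height back to its value at `r`, the last
        -- minimum.
        have key : ∀ y, r + 1 ≤ y → y ≤ q i → h y ≤ h (r + 1) := by
          intro y hy
          induction y, hy using Int.leInduction with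
          | base => exact fun _ => le_rfl
          | succ n hn ih =>
            intro h8
            have h9 := ih (by omega)
            have h10 := H n
            rw [ind_of_notMem (fun hm => by have := g1 n (by omega) (by omega) hm; omega)] at h10
            have : 0 ≤ ind A (i + 1) n := by unfold ind; split_ifs <;> simp
            omega
        have h8 := key x (by omega) (by omega)
        have h9 := H x
        rw [ind_of_notMem (fun hm => h7 (g1 x (by omega) (by omega) hm)), ind_of_mem h5] at h9
        have h10 := H r
        rw [ind_of_mem hr.mem, ind_of_notMem hr.notMem] at h10
        have h11 := hr.lt h H (x + 1) (by omega)
        omega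
    · rw [GreedyAt, updatePath_of_not_dvd q hc, updatePath_of_not_dvd q (not_dvd_pred hc')]
      have := hq.greedyAt c
      unfold GreedyAt at this
      simpa only [mem_moveBead_other hc hc'] using this
  · refine ⟨q, hA.isGreedy_of_columns hq.periodic i ⟨h1, m1.1, fun x h3 h4 h5 => ?_⟩
      ⟨hq.le _, m2, fun x h3 h4 => g2 x (by simpa using h3) h4⟩ fun c hc hc' => ?_, fun _ _ => rfl⟩
    · have := g1 x h3 h4 h5
      omega
    · have := hq.greedyAt c
      unfold GreedyAt at this ⊢
      simpa only [mem_moveBead_other hc hc'] using this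

/-- Related paths agree in column `i + 1`, which is not congruent to `i` because `e ≥ 2`, and greedy
paths can be compared in a single column. -/
theorem compatible_addRel (he : 2 ≤ e) (i : ℤ) : Compatible e l (AddRel e l i) (Agree e i) where
  lift := by
    rintro A B p hA - ⟨r, hr, rfl⟩ hp
    by_cases h : r = p i
    · subst h
      obtain ⟨b, h1, h2⟩ := hp.lift_of_eq he hA hr
      exact ⟨_, h1, agree_updatePath p i b, h2⟩
    · exact ⟨p, (hp.lift_of_ne he hA hr h).1, fun _ _ => rfl, (hp.lift_of_ne he hA hr h).2⟩
  colift := by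
    rintro A B q hA - ⟨r, hr, rfl⟩ hq
    exact hr.colift he hA hq
  lt_iff := by
    intro A B p q p' q' hp hq hp' hq' h h'
    have e1 := h _ (not_dvd_add_one_sub he i)
    have e2 := h' _ (not_dvd_add_one_sub he i)
    constructor
    · intro hlt
      exact hp'.lt_of_lt (by omega) hq' (c := i + 1) (by rw [← e1, ← e2]; exact hlt _)
    · intro hlt
      exact hp.lt_of_lt (by omega) hq (c := i + 1) (by rw [e1, e2]; exact hlt _)

end

/-! ### The transposed complement of a configuration -/

/-- The complement of `A`, reflected in the diagonal and translated. -/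
def star (a b : ℤ) (A : Set (ℤ × ℤ)) : Set (ℤ × ℤ) := {x | (x.2 + a, x.1 + b) ∉ A}

theorem mem_star {a b : ℤ} {A : Set (ℤ × ℤ)} {c r : ℤ} : (c, r) ∈ star a b A ↔ (r + a, c + b) ∉ A :=
  Iff.rfl

/-- The paths `p` and `q` form the same staircase, seen from its two sides. -/
def Conj (a b : ℤ) (p q : ℤ → ℤ) : Prop := ∀ r c, p (r + a) ≤ c + b ↔ r < q c

section
variable {e l a b : ℤ} {A B : Set (ℤ × ℤ)}

/-- By periodicity, going `e` columns to the left in a row amounts to going `l` rows up in a fixed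
column. So the rows are full far to the left and empty far to the right, which makes the reflected
complement a configuration again. -/
theorem IsConfig.row_low (hA : IsConfig e l A) (he : 0 < e) (hl : 0 < l) (x : ℤ) :
    ∃ m, ∀ c ≤ m, (c, x) ∈ A := by
  choose m hm using hA.high
  refine ⟨-(∑ c ∈ Finset.Ico 0 e, |m c| + |x|) * e, fun c hc => ?_⟩
  have h1 : c = c % e + c / e * e := by rw [mul_comm]; exact (Int.emod_add_mul_ediv c e).symm
  have h2 := hA.add_mul (c % e) (x - c / e * l) (c / e)
  rw [← h1, sub_add_cancel] at h2
  rw [h2]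
  apply hm
  have h3 : |m (c % e)| ≤ ∑ c ∈ Finset.Ico 0 e, |m c| :=
    Finset.single_le_sum (f := fun c => |m c|) (fun _ _ => abs_nonneg _)
      (Finset.mem_Ico.2 ⟨Int.emod_nonneg c he.ne', Int.emod_lt_of_pos c he⟩)
  have h4 : c / e ≤ -(∑ c ∈ Finset.Ico 0 e, |m c| + |x|) := by
    have := Int.ediv_le_ediv he hc
    rwa [Int.mul_ediv_cancel _ he.ne'] at this
  have h5 := le_abs_self (m (c % e))
  have h6 := neg_abs_le x
  have h7 := abs_nonneg (m (c % e))
  have h8 := abs_nonneg x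
  nlinarith

theorem IsConfig.row_high (hA : IsConfig e l A) (he : 0 < e) (hl : 0 < l) (x : ℤ) :
    ∃ m, ∀ c, m ≤ c → (c, x) ∉ A := by
  choose m hm using hA.low
  refine ⟨(∑ c ∈ Finset.Ico 0 e, |m c| + |x| + 1) * e, fun c hc hcx => ?_⟩
  have h1 : c = c % e + c / e * e := by rw [mul_comm]; exact (Int.emod_add_mul_ediv c e).symm
  have h2 := hA.add_mul (c % e) (x - c / e * l) (c / e)
  rw [← h1, sub_add_cancel] at h2
  have h0 := hm _ _ (h2.1 hcx)
  have h3 : |m (c % e)| ≤ ∑ c ∈ Finset.Ico 0 e, |m c| :=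
    Finset.single_le_sum (f := fun c => |m c|) (fun _ _ => abs_nonneg _)
      (Finset.mem_Ico.2 ⟨Int.emod_nonneg c he.ne', Int.emod_lt_of_pos c he⟩)
  have h4 : ∑ c ∈ Finset.Ico 0 e, |m c| + |x| + 1 ≤ c / e := by
    have := Int.ediv_le_ediv he hc
    rwa [Int.mul_ediv_cancel _ he.ne'] at this
  have h5 := neg_abs_le (m (c % e))
  have h6 := le_abs_self x
  have h7 := abs_nonneg (m (c % e))
  have h8 := abs_nonneg x
  nlinarith

theorem IsConfig.star (hA : IsConfig e l A) (he : 0 < e) (hl : 0 < l) (a b : ℤ) :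
    IsConfig l e (star a b A) := by
  refine ⟨fun c r => ?_, fun c => ?_, fun c => ?_⟩
  · rw [mem_star, mem_star, show r + e + a = r + a + e by ring, show c + l + b = c + b + l by ring,
      hA.periodic]
  · obtain ⟨m, hm⟩ := hA.row_low he hl (c + b)
    refine ⟨m - a, fun r hr => ?_⟩
    by_contra! hlt
    exact hr (hm _ (by omega))
  · obtain ⟨m, hm⟩ := hA.row_high he hl (c + b)
    exact ⟨m - a, fun r hr => hm _ (by omega)⟩

theorem IsPeriodic.exists_le (hl : 0 < l) {p : ℤ → ℤ} (hp : IsPeriodic e l p) (y : ℤ) :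
    ∃ c, p c ≤ y := by
  refine ⟨0 + (-(|p 0| + |y|)) * e, ?_⟩
  rw [hp.add_mul]
  have h1 := le_abs_self (p 0)
  have h2 := neg_abs_le y
  have h3 := abs_nonneg (p 0)
  have h4 := abs_nonneg y
  nlinarith

theorem IsPeriodic.exists_gt (hl : 0 < l) {p : ℤ → ℤ} (hp : IsPeriodic e l p) (y : ℤ) :
    ∃ c, y < p c := by
  refine ⟨0 + (|p 0| + |y| + 1) * e, ?_⟩
  rw [hp.add_mul]
  have h1 := neg_abs_le (p 0)
  have h2 := le_abs_self y
  have h3 := abs_nonneg (p 0)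
  have h4 := abs_nonneg y
  nlinarith

theorem exists_conj (hl : 0 < l) {p : ℤ → ℤ} (hp : IsPeriodic e l p) (hm : Monotone p) (a b : ℤ) :
    ∃ q, Conj a b p q := by
  have key : ∀ c, ∃ q, ∀ r, p (r + a) ≤ c + b ↔ r < q := fun c => by
    obtain ⟨x, hx⟩ := hp.exists_le hl (c + b)
    obtain ⟨y, hy⟩ := hp.exists_gt hl (c + b)
    obtain ⟨q, hq, hmax⟩ := Int.exists_greatest_of_bdd (P := fun r => p (r + a) ≤ c + b)
      ⟨y - a, fun z hz => by
        by_contra! hlt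
        have := hm (show y ≤ z + a by omega)
        omega⟩ ⟨x - a, by simpa using hx⟩
    refine ⟨q + 1, fun r => ⟨fun h => ?_, fun h => ?_⟩⟩
    · have := hmax r h
      omega
    · exact (hm (by omega)).trans hq
  choose q hq using key
  exact ⟨q, fun r c => hq c r⟩

theorem exists_conj' (hl : 0 < l) {q : ℤ → ℤ} (hq : IsPeriodic e l q) (hm : Monotone q) (a b : ℤ) :
    ∃ p, Conj a b p q := by
  obtain ⟨p, hp⟩ := exists_conj hl hq hm 0 0
  refine ⟨fun c => p (c - a) + b, fun r c => ?_⟩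
  have := hp c r
  simp only [add_zero] at this
  simp only [add_sub_cancel_right]
  omega

theorem Conj.right_unique {p q q' : ℤ → ℤ} (h : Conj a b p q) (h' : Conj a b p q') : q = q' := by
  funext c
  have h1 := (h (q c) c).symm.trans (h' (q c) c)
  have h2 := (h (q' c) c).symm.trans (h' (q' c) c)
  omega

theorem Conj.left_unique {p p' q : ℤ → ℤ} (h : Conj a b p q) (h' : Conj a b p' q) : p = p' := by
  funext c
  have h1 := (h (c - a) (p c - b)).trans (h' (c - a) (p c - b)).symm
  have h2 := (h (c - a) (p' c - b)).trans (h' (c - a) (p' c - b)).symm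
  simp only [sub_add_cancel] at h1 h2
  omega

/-- The vacancies that `p` skips between its values in successive columns are the beads of `q` in
the complement, and the beads of `p` are the vacancies that `q` skips. So the membership and gap
conditions exchange their roles. -/
theorem Conj.greedy {p q : ℤ → ℤ} (h : Conj a b p q) (hp : IsGreedy e l A p) :
    IsGreedy l e (FockSpace.star a b A) q := by
  refine ⟨fun c => ?_, fun c => ?_, fun c => ?_, fun c r h1 h2 h3 => ?_⟩
  · have key : ∀ r, r < q (c + l) ↔ r - e < q c := fun r => by
      rw [← h, ← h]
      have := hp.periodic (r - e + a)
      rw [show r - e + a + e = r + a by ring] at this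
      omega
    have h1 := key (q (c + l))
    have h2 := key (q c + e)
    omega
  · by_contra! hlt
    have h1 := (h (q c) (c - 1)).2 hlt
    have h2 := h (q c) c
    omega
  · have h1 := h (q c) c
    have h2 := h (q c - 1) c
    rw [mem_star]
    refine hp.gap _ _ ?_ (by omega)
    rw [show q c + a - 1 = q c - 1 + a by ring]
    omega
  · have h4 := h r c
    have h5 := h r (c - 1)
    have h6 : p (r + a) = c + b := by omega
    exact h3 (h6 ▸ hp.mem (r + a))

theorem Conj.greedy' {p q : ℤ → ℤ} (h : Conj a b p q) (hq : IsGreedy l e (FockSpace.star a b A) q) :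
    IsGreedy e l A p := by
  have h' : ∀ c y, p c ≤ y ↔ c - a < q (y - b) := fun c y => by
    rw [← h]; simp
  refine ⟨fun c => ?_, fun c => ?_, fun c => ?_, fun c r h1 h2 => ?_⟩
  · have key : ∀ y, p (c + e) ≤ y ↔ p c ≤ y - l := fun y => by
      rw [h', h']
      have := hq.periodic (y - l - b)
      rw [show y - l - b + l = y - b by ring] at this
      omega
    have h1 := key (p (c + e))
    have h2 := key (p c + l)
    omega
  · have h1 := (h' c (p c)).1 le_rfl
    exact (h' (c - 1) (p c)).2 (by omega)
  · have h1 := (h' c (p c)).1 le_rfl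
    have h2 := h' c (p c - 1)
    have h3 := hq.gap (p c - b) (c - a) (by
      rw [show p c - b - 1 = p c - 1 - b by ring]; omega) h1
    rw [mem_star, not_not] at h3
    simpa using h3
  · have h3 := h' (c - 1) r
    have h4 := h' c r
    have h5 : q (r - b) = c - a := by omega
    have h6 := hq.mem (r - b)
    rw [h5, mem_star] at h6
    simpa using h6

/-- Moving the beads of a staircase one step to the right has the same effect as moving the
vacancies along it up by one row, and upwards is to the right after the reflection. -/
theorem Conj.star_push {p q : ℤ → ℤ} (h : Conj a b p q) (hp : IsGreedy e l A p) :
    FockSpace.star a b (push A p) = push (FockSpace.star a b A) q := by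
  ext ⟨c, r⟩
  rw [mem_star, mem_push, mem_push, mem_star]
  have h1 := h r c
  have h2 := h (r - 1) c
  have h3 := h r (c - 1)
  have h4 := h (r - 1) (c - 1)
  have h5 := hp.le (r + a)
  have h6 := hp.gap (r + a) (c + b)
  have h7 : c + b = p (r + a) → (r + a, c + b) ∈ A := fun h => h ▸ hp.mem (r + a)
  rw [show r - 1 + a = r + a - 1 by ring] at h2 h4
  by_cases hm : (r + a, c + b) ∈ A
  · simp only [hm, true_and, not_true_eq_false, false_and, false_or]
    have h8 : ¬ (p (r + a - 1) ≤ c + b ∧ c + b < p (r + a)) := fun h => h6 h.1 h.2 hm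
    omega
  · have : c + b ≠ p (r + a) := fun h => hm (h7 h)
    simp only [hm, false_and, not_false_eq_true, true_and, false_or]
    omega

/-- A lower staircase, seen from the other side, is a higher one: the correspondence reverses the
order. -/
theorem Conj.lt {p q p' q' : ℤ → ℤ} (hl : 0 < l) (h : Conj a b p q) (h' : Conj a b p' q')
    (hp : IsGreedy e l A p) (hp' : IsGreedy e l A p') (hlt : ∀ c, p c < p' c) (c : ℤ) :
    q' c < q c := by
  rcases (h.greedy hp).trichotomy hl (h'.greedy hp') with h1 | h1 | h1
  · have h2 := h (q 0) 0
    have h3 := h' (q 0) 0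
    have h4 := h1 0
    have h5 := hlt (q 0 + a)
    omega
  · rw [← h1] at h'
    have := h.left_unique h'
    have h5 := hlt 0
    rw [this] at h5
    omega
  · exact h1 c

theorem Conj.lt_iff {p q p' q' : ℤ → ℤ} (he : 0 < e) (hl : 0 < l) (h : Conj a b p q)
    (h' : Conj a b p' q') (hp : IsGreedy e l A p) (hp' : IsGreedy e l A p') :
    (∀ c, p c < p' c) ↔ ∀ c, q' c < q c := by
  refine ⟨fun hlt => h.lt hl h' hp hp' hlt, fun hlt => ?_⟩
  rcases hp.trichotomy he hp' with h1 | h1 | h1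
  · exact h1
  · subst h1
    have h2 := hlt 0
    rw [h.right_unique h'] at h2
    omega
  · have h2 := h'.lt hl h hp' hp h1 0
    have h3 := hlt 0
    omega

/-- The relation `AddRel` for the transposed complements. -/
def DualRel (e l a b j : ℤ) (A B : Set (ℤ × ℤ)) : Prop := AddRel l e j (star a b A) (star a b B)

def DualAgree (l a b j : ℤ) (p p' : ℤ → ℤ) : Prop :=
  ∃ q q', Conj a b p q ∧ Conj a b p' q' ∧ Agree l j q q'

/-- The statement for the reflected complement is carried back along `Conj`. The order is reversed
on both sides of the equivalence, so the order isomorphism persists. -/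
theorem compatible_dualRel (he : 2 ≤ e) (hl : 2 ≤ l) (a b j : ℤ) :
    Compatible e l (DualRel e l a b j) (DualAgree l a b j) := by
  have he0 : 0 < e := by omega
  have hl0 : 0 < l := by omega
  have hc := compatible_addRel (e := l) (l := e) hl j
  constructor
  · intro A B p hA hB hAB hp
    obtain ⟨q, hq⟩ := exists_conj hl0 hp.periodic hp.monotone a b
    obtain ⟨q', hq', hR, hF⟩ := hc.lift (hA.star he0 hl0 a b) (hB.star he0 hl0 a b) hAB (hq.greedy hp)
    obtain ⟨p', hp'⟩ := exists_conj' he0 hq'.periodic hq'.monotone a b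
    refine ⟨p', hp'.greedy' hq', ⟨q, q', hq, hp', hR⟩, ?_⟩
    rw [DualRel, hq.star_push hp, hp'.star_push (hp'.greedy' hq')]
    exact hF
  · intro A B p' hA hB hAB hp'
    obtain ⟨q', hq'⟩ := exists_conj hl0 hp'.periodic hp'.monotone a b
    obtain ⟨q, hq, hR⟩ := hc.colift (hA.star he0 hl0 a b) (hB.star he0 hl0 a b) hAB (hq'.greedy hp')
    obtain ⟨p, hp⟩ := exists_conj' he0 hq.periodic hq.monotone a b
    exact ⟨p, hp.greedy' hq, q, q', hp, hq', hR⟩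
  · rintro A B p₁ p₂ p₁' p₂' h₁ h₂ h₁' h₂' ⟨q₁, q₁', c₁, c₁', r₁⟩ ⟨q₂, q₂', c₂, c₂', r₂⟩
    rw [c₁.lt_iff he0 hl0 c₂ h₁ h₂, c₁'.lt_iff he0 hl0 c₂' h₁' h₂']
    exact hc.lt_iff (c₂.greedy h₂) (c₁.greedy h₁) (c₂'.greedy h₂') (c₁'.greedy h₁') r₂ r₁

/-! ### Good rows after pushing paths -/

/-- Together with its variants below, this shows that a crystal operator with value `0` keeps the
value `0` after the paths are pushed. -/
theorem IsConfig.exists_isAddRow_pushAll (hA : IsConfig e l A) (he : 0 < e) (hl : 0 < l) {f : ℕ → ℕ}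
    (hf : Antitone f) (n : ℕ) {i : ℤ} (h : ∃ r, IsAddRow (FockSpace.pushAll f A n) i r) :
    ∃ r, IsAddRow A i r := by
  by_contra hno
  exact hA.pushAll_induction he hl hf (P := fun A => ¬ ∃ r, IsAddRow A i r)
    (fun A k hA hk h h' => h (hk.exists_isAddRow_of_push hA h')) hno n h

theorem IsConfig.not_exists_isRemRow_pushAll (hA : IsConfig e l A) (he : 0 < e) (hl : 0 < l)
    {f : ℕ → ℕ} (hf : Antitone f) (n : ℕ) {i : ℤ} (h : ¬ ∃ r, IsRemRow A i r) :
    ¬ ∃ r, IsRemRow (FockSpace.pushAll f A n) i r :=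
  hA.pushAll_induction he hl hf (P := fun A => ¬ ∃ r, IsRemRow A i r)
    (fun _ _ hA hk h h' => h (hk.exists_isRemRow_of_push hA h')) h n

theorem IsConfig.exists_isAddRow_star_pushAll (hA : IsConfig e l A) (he : 0 < e) (hl : 0 < l)
    {f : ℕ → ℕ} (hf : Antitone f) (n : ℕ) {i : ℤ}
    (h : ∃ r, IsAddRow (FockSpace.star a b (FockSpace.pushAll f A n)) i r) :
    ∃ r, IsAddRow (FockSpace.star a b A) i r := by
  by_contra hno
  refine hA.pushAll_induction he hl hf (P := fun A => ¬ ∃ r, IsAddRow (FockSpace.star a b A) i r)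
    (fun A k hA hk h h' => h ?_) hno n h
  obtain ⟨q, hq⟩ := exists_conj hl hk.periodic hk.monotone a b
  rw [FockSpace.step, hq.star_push hk] at h'
  exact (hq.greedy hk).exists_isAddRow_of_push (hA.star he hl a b) h'

theorem IsConfig.exists_isRemRow_star_pushAll (hA : IsConfig e l A) (he : 0 < e) (hl : 0 < l)
    {f : ℕ → ℕ} (hf : Antitone f) (n : ℕ) {i : ℤ}
    (h : ∃ r, IsRemRow (FockSpace.star a b (FockSpace.pushAll f A n)) i r) :
    ∃ r, IsRemRow (FockSpace.star a b A) i r := by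
  by_contra hno
  refine hA.pushAll_induction he hl hf (P := fun A => ¬ ∃ r, IsRemRow (FockSpace.star a b A) i r)
    (fun A k hA hk h h' => h ?_) hno n h
  obtain ⟨q, hq⟩ := exists_conj hl hk.periodic hk.monotone a b
  rw [FockSpace.step, hq.star_push hk] at h'
  exact (hq.greedy hk).exists_isRemRow_of_push (hA.star he hl a b) h'

end

/-! ### Highest weight configurations -/

/-- No pair of adjacent columns has a good removable row. -/
def IsHighest (A : Set (ℤ × ℤ)) : Prop := ∀ i, ¬ ∃ r, IsRemRow A i r

section
variable {e l : ℤ} {A : Set (ℤ × ℤ)}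

/-- If the lowest bead of column `c + 1` were below that of column `c`, the height would drop there
below the constant value that it has further down. Its least minimum would then give a good
removable row. -/
theorem IsHighest.isPath_min (hA : IsConfig e l A) (h : IsHighest A) {m : ℤ → ℤ}
    (hm : ∀ c, (c, m c) ∈ A) (hmin : ∀ c x, (c, x) ∈ A → m c ≤ x) : IsPath A m := by
  refine ⟨monotone_int_of_le_succ fun c => ?_, hm⟩
  by_contra! hlt
  obtain ⟨g, hg⟩ := exists_isHeight A c
  have hconst : ∀ x ≤ m (c + 1), g x = g (m (c + 1)) := by
    intro x hx
    induction x, hx using Int.leInductionDown with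
    | base => rfl
    | pred n hn ih =>
      have h1 := hg (n - 1)
      rw [ind_of_notMem fun h => by have := hmin _ _ h; omega,
        ind_of_notMem fun h => by have := hmin _ _ h; omega, sub_add_cancel] at h1
      omega
  refine h c (hA.exists_isRemRow hg (x := m (c + 1) + 1) (X := m (c + 1)) fun y hy => ?_)
  rw [hconst y hy, hg, ind_of_notMem fun h => by have := hmin _ _ h; omega, ind_of_mem (hm _)]
  omega

theorem IsHighest.minPath_le (hA : IsConfig e l A) (h : IsHighest A) {c x : ℤ}
    (hx : (c, x) ∈ A) : minPath A c ≤ x := by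
  have key : ∀ c, ∃ m, (c, m) ∈ A ∧ ∀ x, (c, x) ∈ A → m ≤ x := fun c => by
    obtain ⟨M, hM⟩ := hA.high c
    obtain ⟨m, hm⟩ := hA.low c
    exact Int.exists_least_of_bdd (P := fun x => (c, x) ∈ A) ⟨m, hm⟩ ⟨M, hM M le_rfl⟩
  choose m hm hmin using key
  exact (hA.minPath_le (h.isPath_min hA hm hmin) c).trans (hmin c x hx)

theorem ind_peel (hA : IsPath A (minPath A)) (c x : ℤ) :
    ind (peel A) c x = ind A c x - if x = minPath A c then 1 else 0 := by
  by_cases h : x = minPath A c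
  · rw [if_pos h, ind_of_notMem fun h' => h'.2 h, ind_of_mem (h ▸ hA.2 c)]; rfl
  · rw [if_neg h, sub_zero]
    by_cases h' : (c, x) ∈ A
    · rw [ind_of_mem h', ind_of_mem (show (c, x) ∈ peel A from ⟨h', h⟩)]
    · rw [ind_of_notMem h', ind_of_notMem fun h'' => h' h''.1]

/-- Removing the minimal path lowers the height between its rows in the two columns only. A
removable row of the rest lies above the bead of the minimal path in column `i + 1`, where the
height is unchanged, so it would force a removable row of `A`. -/
theorem IsHighest.peel (hA : IsConfig e l A) (he : 0 < e) (hl : 0 < l) (h : IsHighest A) :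
    IsHighest (peel A) := by
  rintro i ⟨r, hr⟩
  have hp := hA.isPath_minPath he hl
  have hmono := hp.1 (show i ≤ i + 1 by omega)
  obtain ⟨g, hg⟩ := exists_isHeight A i
  have hg' : IsHeight (FockSpace.peel A) i
      fun x => g x - if minPath A i < x ∧ x ≤ minPath A (i + 1) then 1 else 0 := by
    intro x
    simp only
    rw [ind_peel hp, ind_peel hp, hg]
    split_ifs <;> omega
  have h1 := h.minPath_le hA hr.mem.1
  have h2 : r ≠ minPath A (i + 1) := hr.mem.2
  refine h i (hA.exists_isRemRow hg (x := r + 1) (X := minPath A i) fun y hy => ?_)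
  have := hr.lt _ hg' y (by omega)
  rw [if_neg (by omega), if_neg (by omega)] at this
  omega

theorem IsHighest.iterate_peel (hA : IsConfig e l A) (he : 0 < e) (hl : 0 < l) (h : IsHighest A)
    (k : ℕ) : IsHighest (FockSpace.peel^[k] A) := by
  induction k with
  | zero => exact h
  | succ k ih =>
    rw [Function.iterate_succ_apply']
    exact ih.peel (hA.iterate_peel he hl k) he hl

theorem IsHighest.nthPath_le (hA : IsConfig e l A) (he : 0 < e) (hl : 0 < l) (h : IsHighest A)
    {k : ℕ} {c x : ℤ} (hx : (c, x) ∈ FockSpace.peel^[k] A) : nthPath A k c ≤ x :=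
  (h.iterate_peel hA he hl k).minPath_le (hA.iterate_peel he hl k) hx

/-- The paths take the lowest remaining bead of each column, and their values in a column increase
strictly with the index. So each bead is reached. -/
theorem IsHighest.mem_iff (hA : IsConfig e l A) (he : 0 < e) (hl : 0 < l) (h : IsHighest A)
    {c x : ℤ} : (c, x) ∈ A ↔ ∃ k, x = nthPath A k c := by
  constructor
  · intro hx
    by_contra! hne
    have h1 : ∀ k, nthPath A k c ≤ x := fun k =>
      h.nthPath_le hA he hl (mem_iterate_peel.2 ⟨hx, fun j _ => hne j⟩)
    have h2 : ∀ k : ℕ, nthPath A 0 c + k ≤ nthPath A k c := fun k => by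
      induction k with
      | zero => simp
      | succ k ih =>
        have := hA.nthPath_lt he hl (Nat.lt_succ_self k) c
        push_cast
        simp only [Nat.succ_eq_add_one] at this
        omega
    have := h1 (x - nthPath A 0 c + 1).toNat
    have := h2 (x - nthPath A 0 c + 1).toNat
    have := Int.self_le_toNat (x - nthPath A 0 c + 1)
    omega
  · rintro ⟨k, rfl⟩
    exact (hA.nthPath_isPath he hl k).2 c

theorem IsHighest.step (hA : IsConfig e l A) (h : IsHighest A) {k : ℕ}
    (hk : IsGreedy e l A (nthPath A k)) : IsHighest (FockSpace.step k A) :=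
  fun i h' => h i (hk.exists_isRemRow_of_push hA h')

/-- In general there is only the inequality `IsConfig.nthPath_step_self_le`. Here the pushed bead
must lie on some path, and the earlier paths are too low for it while the later ones are too high.
-/
theorem IsHighest.nthPath_step (hA : IsConfig e l A) (he : 0 < e) (hl : 0 < l) (h : IsHighest A)
    {k : ℕ} (hk : IsGreedy e l A (nthPath A k)) (c : ℤ) :
    nthPath (FockSpace.step k A) k c = nthPath A k (c - 1) := by
  have h1 : (c, nthPath A k (c - 1)) ∈ FockSpace.step k A := Or.inr rfl
  obtain ⟨j, hj⟩ := ((h.step hA hk).mem_iff (hA.step he hl k) he hl).1 h1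
  rcases lt_trichotomy j k with hlt | rfl | hlt
  · rw [hA.nthPath_step_lt he hl hk hlt] at hj
    have := hA.lt_nthPath_pred he hl hk hlt c
    omega
  · exact hj.symm
  · rw [hA.nthPath_step_gt he hl hk hlt] at hj
    have := hA.nthPath_lt he hl hlt c
    have := hk.le c
    omega

theorem IsHighest.nthPath_iterate_step (hA : IsConfig e l A) (he : 0 < e) (hl : 0 < l)
    (h : IsHighest A) {k n : ℕ} (hk : HasSlack e l k n A) (j : ℕ) (c : ℤ) :
    nthPath ((FockSpace.step k)^[n] A) j c = nthPath A j (c - if j = k then n else 0) := by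
  induction n generalizing A c with
  | zero => simp
  | succ n ih =>
    rw [Function.iterate_succ_apply, ih (hA.step he hl k) (h.step hA hk.1) hk.2]
    by_cases hj : j = k
    · subst hj
      simp only [if_true]
      rw [h.nthPath_step hA he hl hk.1]
      congr 1
      push_cast
      ring
    · rw [hA.nthPath_step_ne he hl hk.1 hj]
      simp [hj]

theorem IsHighest.nthPath_pushAll (hA : IsConfig e l A) (he : 0 < e) (hl : 0 < l)
    (h : IsHighest A) {f : ℕ → ℕ} (hf : Antitone f) (n j : ℕ) (c : ℤ) :
    nthPath (FockSpace.pushAll f A n) j c = nthPath A j (c - if j < n then f j else 0) := by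
  induction n generalizing c with
  | zero => simp [FockSpace.pushAll]
  | succ n ih =>
    have hn : IsHighest (FockSpace.pushAll f A n) := fun i =>
      hA.not_exists_isRemRow_pushAll he hl hf n (h i)
    rw [FockSpace.pushAll, hn.nthPath_iterate_step (hA.pushAll he hl f n) he hl
      (hA.hasSlack_pushAll he hl hf n), ih]
    congr 1
    rcases lt_trichotomy j n with h1 | h1 | h1
    · rw [if_neg (by omega), if_pos h1, if_pos (by omega)]; simp
    · subst h1; simp
    · rw [if_neg (by omega), if_neg (by omega), if_neg (by omega)]; simp

theorem IsHighest.mem_pushAll (hA : IsConfig e l A) (he : 0 < e) (hl : 0 < l) (h : IsHighest A)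
    {f : ℕ → ℕ} (hf : Antitone f) {n : ℕ} (hn : ∀ k, n ≤ k → f k = 0) {c x : ℤ} :
    (c, x) ∈ FockSpace.pushAll f A n ↔ ∃ k, x = nthPath A k (c - f k) := by
  have h' : IsHighest (FockSpace.pushAll f A n) := fun i =>
      hA.not_exists_isRemRow_pushAll he hl hf n (h i)
  rw [h'.mem_iff (hA.pushAll he hl f n) he hl]
  refine exists_congr fun k => ?_
  rw [h.nthPath_pushAll hA he hl hf]
  split_ifs with hk
  · rfl
  · rw [hn k (by omega)]

end

/-! ### Partitions and bead sequences -/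

/-- The position of the `k`-th bead. -/
def beadSeq (lam : YoungDiagram) (s : ℤ) (k : ℕ) : ℤ := (lam.rowLen k : ℤ) + s - (k : ℤ)

theorem mem_beads {lam : YoungDiagram} {s c : ℤ} : c ∈ beads lam s ↔ ∃ k, c = beadSeq lam s k := Iff.rfl

theorem beads_eq_range (lam : YoungDiagram) (s : ℤ) : beads lam s = Set.range (beadSeq lam s) := by
  ext c
  rw [mem_beads, Set.mem_range]
  exact exists_congr fun k => eq_comm

theorem beadSeq_strictAnti (lam : YoungDiagram) (s : ℤ) : StrictAnti (beadSeq lam s) :=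
  strictAnti_nat_of_succ_lt fun k => by
    have := lam.rowLen_anti _ _ (Nat.le_succ k)
    simp only [beadSeq, Nat.succ_eq_add_one] at this ⊢
    push_cast
    omega

theorem strictAnti_eq_of_range_eq {f g : ℕ → ℤ} (hf : StrictAnti f) (hg : StrictAnti g)
    (h : Set.range f = Set.range g) : f = g := by
  have hf' : StrictMono fun k => -f k := fun a b hab => by have := hf hab; simp only; omega
  have hg' : StrictMono fun k => -g k := fun a b hab => by have := hg hab; simp only; omega
  have : (fun k => -f k) = fun k => -g k := by
    rw [← StrictMono.range_inj hf' hg']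
    have e1 : (fun k => -f k) = Neg.neg ∘ f := rfl
    have e2 : (fun k => -g k) = Neg.neg ∘ g := rfl
    rw [e1, e2, Set.range_comp, Set.range_comp, h]
  funext k
  exact neg_injective (congrFun this k)

theorem rowLen_eq_zero {lam : YoungDiagram} {k : ℕ} (h : lam.colLen 0 ≤ k) : lam.rowLen k = 0 := by
  by_contra hne
  have h1 : (k, 0) ∈ lam := YoungDiagram.mem_iff_lt_rowLen.2 (Nat.pos_of_ne_zero hne)
  have := YoungDiagram.mem_iff_lt_colLen.1 h1
  omega

theorem youngDiagram_ext {lam mu : YoungDiagram} (h : ∀ k, lam.rowLen k = mu.rowLen k) : lam = mu := by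
  ext ⟨i, j⟩
  rw [YoungDiagram.mem_cells, YoungDiagram.mem_cells, YoungDiagram.mem_iff_lt_rowLen,
    YoungDiagram.mem_iff_lt_rowLen, h]

theorem exists_youngDiagram {f : ℕ → ℕ} (hf : Antitone f) {N : ℕ} (hN : ∀ k, N ≤ k → f k = 0) :
    ∃ lam : YoungDiagram, ∀ k, lam.rowLen k = f k := by
  let lam : YoungDiagram :=
    { cells := ((Finset.range N) ×ˢ (Finset.range (f 0))).filter fun p => p.2 < f p.1
      isLowerSet := by
        rintro ⟨i, j⟩ ⟨i', j'⟩ ⟨h1, h2⟩ h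
        simp only at h1 h2
        simp only [Finset.coe_filter, Finset.mem_product, Finset.mem_range, Set.mem_ofPred_eq] at h ⊢
        have := hf h1
        omega }
  have hmem : ∀ i j, (i, j) ∈ lam ↔ j < f i := fun i j => by
    have : (i, j) ∈ lam ↔ (i, j) ∈ lam.cells := (YoungDiagram.mem_cells _).symm
    rw [this]
    simp only [lam, Finset.mem_filter, Finset.mem_product, Finset.mem_range]
    refine ⟨fun h => h.2, fun h => ⟨⟨?_, ?_⟩, h⟩⟩
    · by_contra! hle
      rw [hN i hle] at h
      omega
    · have := hf (Nat.zero_le i)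
      omega
  refine ⟨lam, fun k => ?_⟩
  have key : ∀ j, j < lam.rowLen k ↔ j < f k := fun j => by
    rw [← YoungDiagram.mem_iff_lt_rowLen, hmem]
  have h1 := key (lam.rowLen k)
  have h2 := key (f k)
  omega

theorem beads_le {lam : YoungDiagram} {s c : ℤ} (h : c ∈ beads lam s) : c ≤ lam.rowLen 0 + s := by
  obtain ⟨k, rfl⟩ := h
  have := lam.rowLen_anti _ _ (Nat.zero_le k)
  omega

theorem mem_beads_of_le {lam : YoungDiagram} {s c : ℤ} (h : c ≤ s - lam.colLen 0) :
    c ∈ beads lam s := by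
  refine ⟨(s - c).toNat, ?_⟩
  rw [rowLen_eq_zero (by omega)]
  have := Int.toNat_of_nonneg (a := s - c) (by omega)
  omega

theorem beads_injective {lam mu : YoungDiagram} {s t : ℤ} (h : beads lam s = beads mu t) :
    lam = mu ∧ s = t := by
  rw [beads_eq_range, beads_eq_range] at h
  have h1 := strictAnti_eq_of_range_eq (beadSeq_strictAnti _ _) (beadSeq_strictAnti _ _) h
  have h2 := congrFun h1 (max (lam.colLen 0) (mu.colLen 0))
  simp only [beadSeq] at h2
  rw [rowLen_eq_zero (le_max_left _ _), rowLen_eq_zero (le_max_right _ _)] at h2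
  have h3 : s = t := by omega
  refine ⟨youngDiagram_ext fun k => ?_, h3⟩
  have := congrFun h1 k
  simp only [beadSeq] at this
  omega

/-- The elements of `M` are enumerated from the right by `Nat.nth`, applied to the distances from
`u`. Beyond distance `m` all positions are occupied, which makes the row lengths vanish eventually.
-/
theorem exists_beads_eq {M : Set ℤ} {u v : ℤ} (hu : ∀ c ∈ M, c ≤ u) (hv : ∀ c ≤ v, c ∈ M) :
    ∃ lam s, beads lam s = M := by
  classical
  let p : ℕ → Prop := fun n => u - (n : ℤ) ∈ M
  let m : ℕ := (u - v).toNat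
  have hm : ∀ n, m ≤ n → p n := fun n hn => hv _ (by
    have := Int.self_le_toNat (u - v)
    omega)
  have hinf : (Set.ofPred p).Infinite := Set.infinite_of_forall_exists_gt fun n =>
    ⟨max m n + 1, hm _ (by omega), by omega⟩
  have hcount : ∀ n, Nat.count p (m + n) = Nat.count p m + n := fun n => by
    induction n with
    | zero => rfl
    | succ n ih =>
      rw [← add_assoc, Nat.count_succ, ih, if_pos (hm _ (by omega))]; ring
  have hnth : ∀ n, Nat.nth p (Nat.count p m + n) = m + n := fun n => by
    rw [← hcount, Nat.nth_count (hm _ (by omega))]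
  have hmono := Nat.nth_strictMono hinf
  have hle : Nat.count p m ≤ m := Nat.count_le _
  have hstep : ∀ k n, Nat.nth p k + n ≤ Nat.nth p (k + n) := fun k n => by
    induction n with
    | zero => rfl
    | succ n ih =>
      have := hmono (show k + n < k + (n + 1) by omega)
      omega
  have hbound : ∀ k, Nat.nth p k ≤ m - Nat.count p m + k := fun k => by
    have h1 := hstep k (Nat.count p m)
    have h2 := hnth k
    rw [add_comm] at h2
    omega
  -- The `k`-th row length is the number of vacancies to the left of the `k`-th bead: there are `m -
  -- Nat.count p m` in total, and `Nat.nth p k - k` of them are to its right.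
  obtain ⟨lam, hlam⟩ := exists_youngDiagram (f := fun k => m - Nat.count p m + k - Nat.nth p k)
    (antitone_nat_of_succ_le fun k => by
      have := hstep k 1
      omega) (N := Nat.count p m) fun k hk => by
      obtain ⟨n, rfl⟩ := Nat.exists_eq_add_of_le hk
      rw [hnth]
      omega
  have hseq : ∀ k, beadSeq lam (u - m + Nat.count p m) k = u - Nat.nth p k := fun k => by
    have := hbound k
    rw [beadSeq, hlam]
    omega
  refine ⟨lam, u - m + Nat.count p m, ?_⟩
  ext c
  rw [mem_beads]
  constructor
  · rintro ⟨k, rfl⟩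
    rw [hseq]
    exact Nat.nth_mem_of_infinite hinf k
  · intro hc
    have hpc : p (u - c).toNat := by
      have := hu c hc
      simp only [p]
      rwa [Int.toNat_of_nonneg (by omega), sub_sub_cancel]
    refine ⟨Nat.count p (u - c).toNat, ?_⟩
    rw [hseq, Nat.nth_count hpc, Int.toNat_of_nonneg (by have := hu c hc; omega)]
    ring

/-- Conjugation replaces a bead configuration by its complement, reflected in `1 / 2`. -/
theorem mem_beads_transpose {lam : YoungDiagram} {s c : ℤ} :
    c ∈ beads lam.transpose (-s) ↔ 1 - c ∉ beads lam s := by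
  have hT : ∀ m k, m < lam.transpose.rowLen k ↔ k < lam.rowLen m := fun m k => by
    rw [← YoungDiagram.mem_iff_lt_rowLen, ← YoungDiagram.mem_iff_lt_rowLen, YoungDiagram.mem_transpose]
    rfl
  constructor
  · rintro ⟨m, rfl⟩ ⟨k, hk⟩
    have := hT k m
    omega
  · intro h
    -- Let `k` be the first row whose bead is to the left of the vacancy `1 - c`. The column of the
    -- diagram with index `k - c - s` has length exactly `k`, and this gives the bead `c` of the
    -- conjugate.
    have hex : ∃ k, (lam.rowLen k : ℤ) + s - k < 1 - c := by
      refine ⟨lam.colLen 0 + (s + c).toNat, ?_⟩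
      rw [rowLen_eq_zero (by omega)]
      have := Int.self_le_toNat (s + c)
      push_cast
      omega
    classical
    have hk := Nat.find_spec hex
    have hmin : ∀ j < Nat.find hex, 1 - c < (lam.rowLen j : ℤ) + s - j := fun j hj => by
      have h1 := Nat.find_min hex hj
      have h2 : 1 - c ≠ (lam.rowLen j : ℤ) + s - j := fun h' => h ⟨j, h'⟩
      omega
    set k := Nat.find hex
    have hm : 0 ≤ k - c - s := by
      have := hk
      omega
    refine ⟨(k - c - s).toNat, ?_⟩
    have hm' := Int.toNat_of_nonneg hm
    set m := (k - c - s).toNat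
    have h1 : lam.transpose.rowLen m = k := by
      apply le_antisymm
      · by_contra! hlt
        have := (hT k m).1 hlt
        omega
      · by_contra! hlt
        have h2 := hmin (k - 1) (by omega)
        have h3 := hT (k - 1) m
        omega
    rw [h1]
    omega

/-- The charge is expressed as a count of beads, so that its behaviour under moves of beads becomes
visible. -/
theorem exists_ncard_beads (lam : YoungDiagram) (s : ℤ) : ∃ K₀ : ℤ, ∀ K, K₀ ≤ K →
    {c | c ∈ beads lam s ∧ -K < c}.Finite ∧ ({c | c ∈ beads lam s ∧ -K < c}.ncard : ℤ) = s + K := by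
  refine ⟨lam.colLen 0 - s, fun K hK => ?_⟩
  have h : {c | c ∈ beads lam s ∧ -K < c} = beadSeq lam s '' (Finset.range (s + K).toNat) := by
    ext c
    simp only [Set.mem_ofPred_eq, Set.mem_image, Finset.coe_range, Set.mem_Iio]
    constructor
    · rintro ⟨⟨k, rfl⟩, hk⟩
      refine ⟨k, ?_, rfl⟩
      by_contra! hlt
      have := Int.self_le_toNat (s + K)
      rw [rowLen_eq_zero (by omega)] at hk
      omega
    · rintro ⟨k, hk, rfl⟩
      refine ⟨⟨k, rfl⟩, ?_⟩
      simp only [beadSeq]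
      omega
  rw [h]
  refine ⟨(Finset.finite_toSet _).image _, ?_⟩
  rw [Set.ncard_image_of_injective _ (beadSeq_strictAnti lam s).injective, Set.ncard_coe_finset,
    Finset.card_range, Int.toNat_of_nonneg (by omega)]

/-! ### Boxes and beads -/

section
variable {ℓ : ℕ} {x y : ChargedPartition ℓ}

/-- The position of the bead of a row. -/
def rowBead (x : ChargedPartition ℓ) (j : Fin ℓ) (k : ℕ) : ℤ := beadSeq (x.shape j) (x.charge j) k

theorem rowBead_strictAnti (x : ChargedPartition ℓ) (j : Fin ℓ) : StrictAnti (rowBead x j) :=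
  beadSeq_strictAnti _ _

theorem rowBead_mem (x : ChargedPartition ℓ) (j : Fin ℓ) (k : ℕ) : (j, rowBead x j k) ∈ abacus x :=
  ⟨k, rfl⟩

theorem abacus_injective (h : abacus x = abacus y) : x = y := by
  have h1 : ∀ j, beads (x.shape j) (x.charge j) = beads (y.shape j) (y.charge j) := fun j => by
    ext d
    exact (Set.ext_iff.1 h (j, d))
  ext1
  · funext j
    exact (beads_injective (h1 j)).1
  · funext j
    exact (beads_injective (h1 j)).2

theorem exists_abacus_eq {M : Set (Fin ℓ × ℤ)} (hu : ∀ j, ∃ u, ∀ d, (j, d) ∈ M → d ≤ u)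
    (hv : ∀ j, ∃ v, ∀ d ≤ v, (j, d) ∈ M) : ∃ x : ChargedPartition ℓ, abacus x = M := by
  have key : ∀ j, ∃ lam s, beads lam s = {d | (j, d) ∈ M} := fun j => by
    obtain ⟨u, hu⟩ := hu j
    obtain ⟨v, hv⟩ := hv j
    exact exists_beads_eq hu hv
  choose lam s h using key
  refine ⟨⟨lam, s⟩, ?_⟩
  ext ⟨j, d⟩
  exact Set.ext_iff.1 (h j) d

theorem mem_boxes {g : Box ℓ} : g ∈ boxes x ↔ g.col < (x.shape g.comp).rowLen g.row :=
  YoungDiagram.mem_iff_lt_rowLen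

theorem mem_rightBoxes {g : Box ℓ} :
    g ∈ rightBoxes x ↔ g.col = (x.shape g.comp).rowLen g.row := by
  simp only [rightBoxes, Set.mem_ofPred_eq, YoungDiagram.mem_iff_lt_rowLen]
  omega

theorem content_of_rightBoxes {g : Box ℓ} (hg : g ∈ rightBoxes x) :
    content x g = rowBead x g.comp g.row := by
  rw [mem_rightBoxes] at hg
  simp only [content, rowBead, beadSeq, hg]
  ring

/-- The box to the right of a row. -/
def endBox (x : ChargedPartition ℓ) (j : Fin ℓ) (k : ℕ) : Box ℓ := ⟨k, (x.shape j).rowLen k, j⟩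

theorem endBox_mem (x : ChargedPartition ℓ) (j : Fin ℓ) (k : ℕ) : endBox x j k ∈ rightBoxes x :=
  mem_rightBoxes.2 rfl

theorem eq_endBox {g : Box ℓ} (hg : g ∈ rightBoxes x) : g = endBox x g.comp g.row := by
  rw [mem_rightBoxes] at hg
  ext <;> simp [endBox, hg]

theorem content_mem_abacus {g : Box ℓ} (hg : g ∈ rightBoxes x) : (g.comp, content x g) ∈ abacus x := by
  rw [content_of_rightBoxes hg]
  exact rowBead_mem _ _ _

theorem rightBoxes_injective {g g' : Box ℓ} (hg : g ∈ rightBoxes x) (hg' : g' ∈ rightBoxes x)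
    (h : g.comp = g'.comp) (h' : content x g = content x g') : g = g' := by
  rw [content_of_rightBoxes hg, content_of_rightBoxes hg', ← h] at h'
  rw [eq_endBox hg, eq_endBox hg', h, (rowBead_strictAnti x g.comp).injective h']

theorem exists_rightBox {j : Fin ℓ} {d : ℤ} (h : (j, d) ∈ abacus x) :
    ∃ g ∈ rightBoxes x, g.comp = j ∧ content x g = d := by
  obtain ⟨k, hk⟩ := h
  change d = rowBead x j k at hk
  subst hk
  exact ⟨endBox x j k, endBox_mem x j k, rfl, content_of_rightBoxes (endBox_mem x j k)⟩

/-- The beads of a set of boxes. -/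
def boxBeads (x : ChargedPartition ℓ) (X : Set (Box ℓ)) : Set (Fin ℓ × ℤ) :=
  (fun g => (g.comp, content x g)) '' X

open Classical in
theorem addBoxes_iff_rowLen {X : Set (Box ℓ)} (hX : X ⊆ rightBoxes x) :
    AddBoxes x X y ↔ y.charge = x.charge ∧ ∀ j k, (y.shape j).rowLen k =
      (x.shape j).rowLen k + if endBox x j k ∈ X then 1 else 0 := by
  have hmem : ∀ j k c, (⟨k, c, j⟩ : Box ℓ) ∈ X ↔ c = (x.shape j).rowLen k ∧ endBox x j k ∈ X :=
    fun j k c => by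
      constructor
      · intro h
        have := eq_endBox (hX h)
        exact ⟨mem_rightBoxes.1 (hX h), this ▸ h⟩
      · rintro ⟨rfl, h⟩
        exact h
  unfold AddBoxes
  refine and_congr_right fun _ => ?_
  have hdisj : Disjoint X (boxes x) := Set.disjoint_left.2 fun g hg hg' => by
    have h1 := mem_rightBoxes.1 (hX hg)
    have h2 := mem_boxes.1 hg'
    omega
  simp only [hdisj, true_and]
  constructor
  · intro h j k
    have key : ∀ c, c < (y.shape j).rowLen k ↔
        c < (x.shape j).rowLen k ∨ c = (x.shape j).rowLen k ∧ endBox x j k ∈ X := fun c => by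
      have := Set.ext_iff.1 h ⟨k, c, j⟩
      rwa [mem_boxes, Set.mem_union, mem_boxes, hmem] at this
    have h1 := key ((x.shape j).rowLen k)
    have h2 := key ((x.shape j).rowLen k + 1)
    have h3 := key ((y.shape j).rowLen k)
    split_ifs with hc
    · simp only [hc, and_true] at h1 h2 h3
      have h4 := h1.2 (Or.inr trivial)
      have h5 : ¬ (x.shape j).rowLen k + 1 < (y.shape j).rowLen k := fun h => by
        have := h2.1 h
        omega
      omega
    · simp only [hc, and_false, or_false] at h1 h2 h3
      omega
  · intro h
    ext ⟨k, c, j⟩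
    rw [mem_boxes, Set.mem_union, mem_boxes, hmem]
    simp only
    rw [h]
    split_ifs with hc
    · simp only [hc, and_true]
      exact Nat.lt_succ_iff_lt_or_eq
    · simp only [hc, and_false, or_false, add_zero]

open Classical in
theorem AddBoxes.rowBead_eq {X : Set (Box ℓ)} (hX : X ⊆ rightBoxes x) (h : AddBoxes x X y)
    (j : Fin ℓ) (k : ℕ) : rowBead y j k = rowBead x j k + if endBox x j k ∈ X then 1 else 0 := by
  obtain ⟨h1, h2⟩ := (addBoxes_iff_rowLen hX).1 h
  simp only [rowBead, beadSeq, h1, h2]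
  push_cast
  ring

theorem mem_boxBeads {X : Set (Box ℓ)} (hX : X ⊆ rightBoxes x) {j : Fin ℓ} {k : ℕ} :
    (j, rowBead x j k) ∈ boxBeads x X ↔ endBox x j k ∈ X := by
  constructor
  · rintro ⟨g, hg, h⟩
    rw [Prod.mk.injEq] at h
    have := rightBoxes_injective (hX hg) (endBox_mem x j k) h.1
      (by rw [h.2, content_of_rightBoxes (endBox_mem x j k)]; rfl)
    exact this ▸ hg
  · intro h
    exact ⟨_, h, Prod.ext rfl (content_of_rightBoxes (hX h))⟩

/-- The beads of `X` move one step to the right. -/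
def shiftBeads (A B : Set (Fin ℓ × ℤ)) : Set (Fin ℓ × ℤ) :=
  {p | (p ∈ A ∧ p ∉ B) ∨ (p.1, p.2 - 1) ∈ B}

theorem AddBoxes.abacus_eq {X : Set (Box ℓ)} (hX : X ⊆ rightBoxes x) (h : AddBoxes x X y) :
    abacus y = shiftBeads (abacus x) (boxBeads x X) := by
  classical
  ext ⟨j, d⟩
  constructor
  · rintro ⟨k, hk⟩
    change d = rowBead y j k at hk
    rw [h.rowBead_eq hX] at hk
    split_ifs at hk with hc
    · right
      rw [hk, add_sub_cancel_right]
      exact (mem_boxBeads hX).2 hc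
    · left
      rw [hk, add_zero]
      exact ⟨rowBead_mem _ _ _, mt (mem_boxBeads hX).1 hc⟩
  · rintro (⟨⟨k, hk⟩, h2⟩ | ⟨g, hg, hgd⟩)
    · change d = rowBead x j k at hk
      refine ⟨k, ?_⟩
      change d = rowBead y j k
      rw [hk, mem_boxBeads hX] at h2
      rw [h.rowBead_eq hX, if_neg h2, add_zero, hk]
    · rw [Prod.mk.injEq, content_of_rightBoxes (hX hg)] at hgd
      refine ⟨g.row, ?_⟩
      change d = rowBead y j g.row
      simp only at hgd
      rw [h.rowBead_eq hX, ← hgd.1, if_pos (eq_endBox (hX hg) ▸ hg), hgd.2, sub_add_cancel]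

/-- By `hfree`, a shifted bead lands on another one only if that one is shifted too. So the shifted
sequence is still strictly decreasing and must be the bead sequence of `y`, row by row. As `X` is
finite, rows far down are unaffected, and they give the charge. -/
theorem addBoxes_of_abacus_eq {X : Set (Box ℓ)} (hX : X ⊆ rightBoxes x) (hfin : X.Finite)
    (hfree : ∀ g ∈ X, (g.comp, content x g + 1) ∈ abacus x → (g.comp, content x g + 1) ∈ boxBeads x X)
    (h : abacus y = shiftBeads (abacus x) (boxBeads x X)) : AddBoxes x X y := by
  classical
  have hanti : ∀ j, StrictAnti fun k => rowBead x j k + if endBox x j k ∈ X then 1 else 0 := by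
    refine fun j => strictAnti_nat_of_succ_lt fun k => ?_
    have h1 := rowBead_strictAnti x j (Nat.lt_succ_self k)
    simp only [Nat.succ_eq_add_one] at h1
    split_ifs with h2 h3 h3
    · omega
    · by_contra! hle
      have h4 : content x (endBox x j (k + 1)) + 1 = rowBead x j k := by
        rw [content_of_rightBoxes (endBox_mem x j _)]
        change rowBead x j (k + 1) + 1 = _
        omega
      have h5 := hfree _ h2
      rw [h4] at h5
      exact h3 ((mem_boxBeads hX).1 (h5 (rowBead_mem x j k)))
    · omega
    · omega
  have hseq : ∀ j, rowBead y j = fun k => rowBead x j k + if endBox x j k ∈ X then 1 else 0 := by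
    refine fun j => strictAnti_eq_of_range_eq (rowBead_strictAnti y j) (hanti j) ?_
    ext d
    have h1 : d ∈ Set.range (rowBead y j) ↔ (j, d) ∈ abacus y := exists_congr fun k => eq_comm
    rw [h1, h]
    constructor
    · rintro (⟨⟨k, hk⟩, h2⟩ | ⟨g, hg, hgd⟩)
      · change d = rowBead x j k at hk
        rw [hk, mem_boxBeads hX] at h2
        exact ⟨k, by simp only [if_neg h2, add_zero, hk]⟩
      · rw [Prod.mk.injEq, content_of_rightBoxes (hX hg)] at hgd
        refine ⟨g.row, ?_⟩
        simp only at hgd ⊢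
        rw [← hgd.1, if_pos (eq_endBox (hX hg) ▸ hg), hgd.2, sub_add_cancel]
    · rintro ⟨k, rfl⟩
      simp only
      split_ifs with hc
      · right
        rw [add_sub_cancel_right]
        exact (mem_boxBeads hX).2 hc
      · left
        rw [add_zero]
        exact ⟨rowBead_mem _ _ _, mt (mem_boxBeads hX).1 hc⟩
  obtain ⟨N, hN⟩ : ∃ N, ∀ g ∈ X, g.row < N := by
    obtain ⟨N, hN⟩ := (hfin.image Box.row).bddAbove
    exact ⟨N + 1, fun g hg => Nat.lt_succ_of_le (hN ⟨g, hg, rfl⟩)⟩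
  have hcharge : y.charge = x.charge := by
    funext j
    have h1 := congrFun (hseq j) (max N (max ((x.shape j).colLen 0) ((y.shape j).colLen 0)))
    simp only [rowBead, beadSeq] at h1
    rw [if_neg, rowLen_eq_zero (by omega), rowLen_eq_zero (by omega)] at h1
    · omega
    · intro h2
      have := hN _ h2
      simp only [endBox] at this
      omega
  refine (addBoxes_iff_rowLen hX).2 ⟨hcharge, fun j k => ?_⟩
  have h1 := congrFun (hseq j) k
  simp only [rowBead, beadSeq, hcharge] at h1
  split_ifs at h1 ⊢ <;> omega

theorem AddBoxes.mem_rightBoxes {g : Box ℓ} (h : AddBoxes x {g} y) : g ∈ rightBoxes x := by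
  obtain ⟨-, h1, h2⟩ := h
  have h3 : g ∉ boxes x := fun h => Set.disjoint_left.1 h1 rfl h
  have h4 : g ∈ boxes y := by rw [h2]; exact Or.inr rfl
  rw [FockSpace.mem_rightBoxes]
  rw [mem_boxes] at h3 h4
  by_contra hne
  have h5 : (⟨g.row, g.col - 1, g.comp⟩ : Box ℓ) ∈ boxes y := by
    rw [mem_boxes]; simp only; omega
  rw [h2] at h5
  rcases h5 with h5 | h5
  · rw [mem_boxes] at h5
    simp only at h5
    omega
  · have := congrArg Box.col (Set.mem_singleton_iff.1 h5)
    simp only at this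
    omega

theorem boxBeads_singleton (g : Box ℓ) : boxBeads x {g} = {(g.comp, content x g)} := by
  simp [boxBeads]

theorem shiftBeads_singleton (A : Set (Fin ℓ × ℤ)) (j : Fin ℓ) (d : ℤ) :
    shiftBeads A {(j, d)} = insert (j, d + 1) (A \ {(j, d)}) := by
  ext ⟨j', d'⟩
  simp only [shiftBeads, Set.mem_ofPred_eq, Set.mem_singleton_iff, Set.mem_insert_iff, Set.mem_sdiff,
    Prod.mk.injEq]
  rw [or_comm, sub_eq_iff_eq_add]

/-- Adding a box moves a bead to an adjacent vacant position. -/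
theorem addBoxes_singleton_iff {g : Box ℓ} : AddBoxes x {g} y ↔ g ∈ rightBoxes x ∧
    (g.comp, content x g + 1) ∉ abacus x ∧
    abacus y = insert (g.comp, content x g + 1) (abacus x \ {(g.comp, content x g)}) := by
  classical
  rw [← shiftBeads_singleton, ← boxBeads_singleton]
  constructor
  · intro h
    have hg := h.mem_rightBoxes
    have hX : {g} ⊆ rightBoxes x := Set.singleton_subset_iff.2 hg
    refine ⟨hg, ?_, h.abacus_eq hX⟩
    rintro ⟨k, hk⟩
    change content x g + 1 = rowBead x g.comp k at hk
    have h1 := h.rowBead_eq hX g.comp g.row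
    have h2 := h.rowBead_eq hX g.comp k
    rw [if_pos (Set.mem_singleton_iff.2 (eq_endBox hg).symm), ← content_of_rightBoxes hg, hk] at h1
    have h3 : endBox x g.comp k ∉ ({g} : Set (Box ℓ)) := fun h3 => by
      rw [Set.mem_singleton_iff] at h3
      have h4 := congrArg (content x) h3
      rw [content_of_rightBoxes (endBox_mem x g.comp k)] at h4
      change rowBead x g.comp k = _ at h4
      omega
    rw [if_neg h3, add_zero, ← h1] at h2
    have := (rowBead_strictAnti y g.comp).injective h2
    subst this
    exact h3 (eq_endBox hg).symm
  · rintro ⟨hg, h1, h2⟩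
    refine addBoxes_of_abacus_eq (Set.singleton_subset_iff.2 hg) (Set.finite_singleton g) ?_ h2
    rintro g' rfl h
    exact absurd h h1

theorem abacus_bounded (x : ChargedPartition ℓ) :
    ∃ u v : ℤ, (∀ p ∈ abacus x, p.2 ≤ u) ∧ ∀ p : Fin ℓ × ℤ, p.2 ≤ v → p ∈ abacus x := by
  refine ⟨∑ j, |(x.shape j).rowLen 0 + x.charge j|, -∑ j, |x.charge j - (x.shape j).colLen 0|, ?_, ?_⟩
  · rintro ⟨j, d⟩ h
    refine (beads_le h).trans ((le_abs_self _).trans ?_)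
    exact Finset.single_le_sum (f := fun j => |((x.shape j).rowLen 0 : ℤ) + x.charge j|)
      (fun _ _ => abs_nonneg _) (Finset.mem_univ j)
  · rintro ⟨j, d⟩ h
    refine mem_beads_of_le (h.trans ?_)
    simp only
    have h1 := Finset.single_le_sum (f := fun j => |x.charge j - ((x.shape j).colLen 0 : ℤ)|)
      (fun _ _ => abs_nonneg _) (Finset.mem_univ j)
    have h2 := neg_abs_le (x.charge j - ((x.shape j).colLen 0 : ℤ))
    have h3 : |x.charge j - ((x.shape j).colLen 0 : ℤ)| ≤ _ := h1
    omega

end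

/-! ### The periodic configuration of a charged multipartition -/

section
variable {ℓ : ℕ} {x y : ChargedPartition ℓ}

/-- The abacus, continued to a periodic configuration on the plane: the rows `j + k ℓ` contain the
row `j` of the abacus, translated by `k m`. -/
def cover (m : ℕ) (x : ChargedPartition ℓ) : Set (ℤ × ℤ) :=
  {p | ∃ (j : Fin ℓ) (k : ℤ), p.2 = j + k * ℓ ∧ (j, p.1 - k * m) ∈ abacus x}

theorem fin_add_mul_injective {j j' : Fin ℓ} {k k' : ℤ} (h : (j : ℤ) + k * ℓ = j' + k' * ℓ) :
    j = j' ∧ k = k' := by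
  have h1 := j.isLt
  have h2 := j'.isLt
  have hk : k = k' := by
    rcases lt_trichotomy k k' with hlt | hlt | hlt
    · nlinarith
    · exact hlt
    · nlinarith
  subst hk
  exact ⟨Fin.ext (by omega), rfl⟩

theorem exists_fin_add_mul (hl : 0 < ℓ) (r : ℤ) : ∃ (j : Fin ℓ) (k : ℤ), r = j + k * ℓ := by
  have hl' : (0 : ℤ) < ℓ := by omega
  have h1 := Int.emod_nonneg r hl'.ne'
  have h2 := Int.emod_lt_of_pos r hl'
  refine ⟨⟨(r % ℓ).toNat, by omega⟩, r / ℓ, ?_⟩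
  simp only [Int.toNat_of_nonneg h1]
  rw [mul_comm]
  exact (Int.emod_add_mul_ediv r ℓ).symm

theorem mem_cover {m : ℕ} {j : Fin ℓ} {d k : ℤ} :
    (d + k * m, (j : ℤ) + k * ℓ) ∈ cover m x ↔ (j, d) ∈ abacus x := by
  constructor
  · rintro ⟨j', k', h, h'⟩
    obtain ⟨rfl, rfl⟩ := fin_add_mul_injective h
    simpa using h'
  · intro h
    exact ⟨j, k, rfl, by simpa using h⟩

theorem mem_cover_zero {m : ℕ} {j : Fin ℓ} {d : ℤ} :
    (d, (j : ℤ)) ∈ cover m x ↔ (j, d) ∈ abacus x := by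
  simpa using mem_cover (x := x) (m := m) (j := j) (d := d) (k := 0)

theorem isConfig_cover {m : ℕ} (hm : 0 < m) (hl : 0 < ℓ) (x : ChargedPartition ℓ) :
    IsConfig m ℓ (cover m x) := by
  have hm' : (0 : ℤ) < m := by omega
  have hl' : (0 : ℤ) < ℓ := by omega
  obtain ⟨u, v, hu, hv⟩ := abacus_bounded x
  refine ⟨fun c r => ?_, fun c => ?_, fun c => ?_⟩
  · constructor
    · rintro ⟨j, k, h, h'⟩
      exact ⟨j, k - 1, by simp only at h ⊢; linarith,
        by simp only at h' ⊢; rwa [show c - (k - 1) * m = c + m - k * m by ring]⟩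
    · rintro ⟨j, k, h, h'⟩
      exact ⟨j, k + 1, by simp only at h ⊢; linarith,
        by simp only at h' ⊢; rwa [show c + m - (k + 1) * m = c - k * m by ring]⟩
  · refine ⟨-|c - u| * ℓ, ?_⟩
    rintro r ⟨j, k, h, h'⟩
    have h1 := hu _ h'
    simp only at h h1
    have h2 : -|c - u| ≤ k := by
      have h3 := neg_abs_le (c - u)
      by_contra! hlt
      nlinarith [abs_nonneg (c - u)]
    rw [h]
    nlinarith [j.isLt]
  · refine ⟨(|c - v| + 1) * ℓ, fun r hr => ?_⟩
    obtain ⟨j, k, rfl⟩ := exists_fin_add_mul hl r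
    refine ⟨j, k, rfl, hv _ ?_⟩
    have h2 : |c - v| ≤ k := by
      by_contra! hlt
      have := j.isLt
      nlinarith
    have h3 := le_abs_self (c - v)
    simp only
    nlinarith [abs_nonneg (c - v)]

theorem cover_injective {m : ℕ} (h : cover m x = cover m y) : x = y := by
  apply abacus_injective
  ext ⟨j, d⟩
  rw [← mem_cover_zero (m := m), h, mem_cover_zero]

theorem exists_cover_eq {m : ℕ} (hm : 0 < m) (hl : 0 < ℓ) {A : Set (ℤ × ℤ)} (hA : IsConfig m ℓ A) :
    ∃ x : ChargedPartition ℓ, cover m x = A := by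
  have hm' : (0 : ℤ) < m := by omega
  have hl' : (0 : ℤ) < ℓ := by omega
  obtain ⟨x, hx⟩ := exists_abacus_eq (M := {p : Fin ℓ × ℤ | (p.2, (p.1 : ℤ)) ∈ A})
    (fun j => by
      obtain ⟨u, hu⟩ := hA.row_high hm' hl' j
      refine ⟨u, fun d hd => ?_⟩
      by_contra! hlt
      exact hu d hlt.le hd)
    fun j => hA.row_low hm' hl' j
  refine ⟨x, ?_⟩
  ext ⟨c, r⟩
  obtain ⟨j, k, rfl⟩ := exists_fin_add_mul hl r
  have h1 := mem_cover (x := x) (m := m) (j := j) (d := c - k * m) (k := k)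
  have h2 := hA.add_mul (c - k * m) j k
  rw [sub_add_cancel] at h1 h2
  rw [h1, h2, hx]
  rfl

/-- The translates of the bead at `(c, r)` are replaced by those of `(c', r')`. -/
def exchange (e l : ℤ) (A : Set (ℤ × ℤ)) (c r c' r' : ℤ) : Set (ℤ × ℤ) :=
  {x | (x ∈ A ∧ ¬ ∃ k, x.1 = c + k * e ∧ x.2 = r + k * l) ∨ ∃ k, x.1 = c' + k * e ∧ x.2 = r' + k * l}

theorem moveBead_eq_exchange (e l : ℤ) (A : Set (ℤ × ℤ)) (i r : ℤ) :
    moveBead e l A i r = exchange e l A i r (i + 1) r := rfl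

/-- Independent translates of source and target are allowed, so that a box can be brought to column
`i` and results about the complement can be brought back to the abacus. -/
theorem cover_eq_exchange_iff {m : ℕ} (hl : 0 < ℓ) {j j' : Fin ℓ} {d d' k k' : ℤ} :
    cover m y = exchange m ℓ (cover m x) (d + k * m) (j + k * ℓ) (d' + k' * m) (j' + k' * ℓ) ↔
      abacus y = insert (j', d') (abacus x \ {(j, d)}) := by
  have key : ∀ (J j : Fin ℓ) (D d t k : ℤ), (∃ k', D + t * m = d + k * m + k' * m ∧
      (J : ℤ) + t * ℓ = j + k * ℓ + k' * ℓ) ↔ (J, D) = (j, d) := by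
    intro J j D d t k
    rw [Prod.mk.injEq]
    constructor
    · rintro ⟨k', h1, h2⟩
      obtain ⟨rfl, rfl⟩ := fin_add_mul_injective (show (J : ℤ) + t * ℓ = j + (k + k') * ℓ by
        rw [h2]; ring)
      exact ⟨rfl, by linarith⟩
    · rintro ⟨rfl, rfl⟩
      exact ⟨t - k, by ring, by ring⟩
  have key2 : ∀ (J : Fin ℓ) (D t : ℤ), (D + t * m, (J : ℤ) + t * ℓ) ∈
      exchange m ℓ (cover m x) (d + k * m) (j + k * ℓ) (d' + k' * m) (j' + k' * ℓ) ↔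
      (J, D) ∈ insert (j', d') (abacus x \ {(j, d)}) := by
    intro J D t
    simp only [exchange, Set.mem_ofPred_eq, key, mem_cover, Set.mem_insert_iff, Set.mem_sdiff,
      Set.mem_singleton_iff]
    tauto
  constructor
  · intro h
    ext ⟨J, D⟩
    rw [← key2 J D 0, ← h, mem_cover]
  · intro h
    ext ⟨c, r⟩
    obtain ⟨J, t, rfl⟩ := exists_fin_add_mul hl r
    have h1 := key2 J (c - t * m) t
    have h2 := mem_cover (x := y) (m := m) (j := J) (d := c - t * m) (k := t)
    rw [sub_add_cancel] at h1 h2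
    rw [h1, h2, h]

/-! ### Addable and removable boxes -/

theorem exists_abacus_eq_insert {p q : Fin ℓ × ℤ} :
    ∃ y, abacus y = insert q (abacus x \ {p}) := by
  obtain ⟨u, v, hu, hv⟩ := abacus_bounded x
  refine exists_abacus_eq (fun j => ⟨max u q.2, fun d hd => ?_⟩) fun j => ⟨min v (p.2 - 1), fun d hd => ?_⟩
  · rcases hd with hd | hd
    · rw [← hd]; exact le_max_right _ _
    · exact (hu _ hd.1).trans (le_max_left _ _)
  · refine Or.inr ⟨hv _ (hd.trans (min_le_left _ _)), ?_⟩
    rintro rfl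
    simp only at hd
    omega

theorem addable_iff {g : Box ℓ} :
    (∃ y, AddBoxes x {g} y) ↔ g ∈ rightBoxes x ∧ (g.comp, content x g + 1) ∉ abacus x := by
  constructor
  · rintro ⟨y, hy⟩
    have := addBoxes_singleton_iff.1 hy
    exact ⟨this.1, this.2.1⟩
  · rintro ⟨h1, h2⟩
    obtain ⟨y, hy⟩ := exists_abacus_eq_insert (x := x) (p := (g.comp, content x g))
      (q := (g.comp, content x g + 1))
    exact ⟨y, addBoxes_singleton_iff.2 ⟨h1, h2, hy⟩⟩

theorem AddBoxes.content_eq {X : Set (Box ℓ)} (h : AddBoxes y X x) (g : Box ℓ) :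
    content x g = content y g := by
  rw [content, content, h.1]

theorem AddBoxes.abacus_singleton {g : Box ℓ} (h : AddBoxes y {g} x) :
    (g.comp, content x g) ∉ abacus x ∧ (g.comp, content x g + 1) ∈ abacus x ∧
      abacus y = insert (g.comp, content x g) (abacus x \ {(g.comp, content x g + 1)}) := by
  obtain ⟨h1, h2, h3⟩ := addBoxes_singleton_iff.1 h
  have h4 := content_mem_abacus h1
  rw [h.content_eq, h3]
  refine ⟨?_, Set.mem_insert _ _, ?_⟩
  · simp
  · ext p
    simp only [Set.mem_insert_iff, Set.mem_sdiff, Set.mem_singleton_iff]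
    by_cases hp : p = (g.comp, content y g)
    · simp [hp, h4]
    · by_cases hp' : p = (g.comp, content y g + 1)
      · simp only [hp', h2, false_iff, true_or, not_true_eq_false, and_false, or_false]
        simp
      · simp [hp, hp']

theorem exists_removable {j : Fin ℓ} {d : ℤ} (h : (j, d) ∉ abacus x) (h' : (j, d + 1) ∈ abacus x) :
    ∃ g y, AddBoxes y {g} x ∧ g.comp = j ∧ content x g = d := by
  obtain ⟨y, hy⟩ := exists_abacus_eq_insert (x := x) (p := (j, d + 1)) (q := (j, d))
  obtain ⟨g, hg, rfl, rfl⟩ := exists_rightBox (x := y) (j := j) (d := d) (by rw [hy]; exact Or.inl rfl)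
  have hadd : AddBoxes y {g} x := by
    refine addBoxes_singleton_iff.2 ⟨hg, ?_, ?_⟩
    · rw [hy]; simp
    · rw [hy]
      ext p
      simp only [Set.mem_insert_iff, Set.mem_sdiff, Set.mem_singleton_iff]
      by_cases hp : p = (g.comp, content y g)
      · simp [hp, h]
      · by_cases hp' : p = (g.comp, content y g + 1)
        · simp [hp', h']
        · simp [hp, hp']
  exact ⟨g, y, hadd, rfl, hadd.content_eq g⟩

theorem removable_unique {g g' : Box ℓ} {y' : ChargedPartition ℓ} (h : AddBoxes y {g} x)
    (h' : AddBoxes y' {g'} x) (hc : g.comp = g'.comp) (hd : content x g = content x g') :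
    g = g' ∧ y = y' := by
  have h1 := h.abacus_singleton.2.2
  have h2 := h'.abacus_singleton.2.2
  rw [hc, hd, ← h2] at h1
  have h3 := abacus_injective h1
  subst h3
  refine ⟨rightBoxes_injective h.mem_rightBoxes h'.mem_rightBoxes hc ?_, rfl⟩
  rw [← h.content_eq, ← h.content_eq, hd]

end

/-! ### Reduced words -/

section
variable {ℓ : ℕ}

/-- The sum of the signs of the letters in rows `≥ z`, addable boxes counting positively. -/
def signSum (ρ : Box ℓ × Bool → ℤ) (w : List (Box ℓ × Bool)) (z : ℤ) : ℤ :=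
  (w.map fun t => if z ≤ ρ t then (if t.2 then 1 else -1) else 0).sum

def addables (w : List (Box ℓ × Bool)) : List (Box ℓ × Bool) := (reduceWord w).filter fun t => t.2

def removables (w : List (Box ℓ × Bool)) : List (Box ℓ × Bool) := (reduceWord w).filter fun t => !t.2

variable {ρ : Box ℓ × Bool → ℤ} {w : List (Box ℓ × Bool)} {t : Box ℓ × Bool}

theorem reduceWord_cons_true (h : t.2 = true) : reduceWord (t :: w) = t :: reduceWord w := by
  obtain ⟨g, b⟩ := t
  simp only at h
  subst h
  rfl

theorem reduceWord_cons_cancel (h : t.2 = false) {t' : Box ℓ × Bool} {r : List (Box ℓ × Bool)}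
    (h' : t'.2 = true) (hr : reduceWord w = t' :: r) : reduceWord (t :: w) = r := by
  obtain ⟨g, b⟩ := t
  obtain ⟨g', b'⟩ := t'
  simp only at h h'
  subst h h'
  simp [reduceWord, hr]

theorem reduceWord_cons_false (h : t.2 = false) (h' : ∀ t' r, reduceWord w = t' :: r → t'.2 = false) :
    reduceWord (t :: w) = t :: reduceWord w := by
  obtain ⟨g, b⟩ := t
  simp only at h
  subst h
  rcases hr : reduceWord w with - | ⟨⟨g', b'⟩, r⟩
  · simp [reduceWord, hr]
  · have := h' _ _ hr
    simp only at this
    subst this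
    simp [reduceWord, hr]

/-- By induction on the word, the reduced tail has the form addable, then removable. A removable
letter in front cancels the first addable one if there is one, and otherwise is prepended. -/
theorem reduceWord_eq (w : List (Box ℓ × Bool)) : reduceWord w = addables w ++ removables w := by
  induction w with
  | nil => rfl
  | cons t w ih =>
    rcases ht : t.2
    · rcases hA : addables w with - | ⟨a, r⟩
      · rw [hA, List.nil_append] at ih
        have hne : ∀ s ∈ reduceWord w, s.2 = false := fun s hs => by
          rw [ih, removables, List.mem_filter] at hs
          simpa using hs.2
        have h1 : reduceWord (t :: w) = t :: reduceWord w :=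
          reduceWord_cons_false ht fun t' r h => hne t' (by rw [h]; simp)
        have h2 : ∀ s ∈ reduceWord (t :: w), s.2 = false := fun s hs => by
          rw [h1, List.mem_cons] at hs
          rcases hs with rfl | hs
          · exact ht
          · exact hne s hs
        rw [addables, removables, List.filter_eq_nil_iff.2 (by simpa using h2),
          List.filter_eq_self.2 (by simpa using h2), List.nil_append]
      · have ha : a.2 = true := by
          have : a ∈ addables w := by rw [hA]; simp
          rw [addables, List.mem_filter] at this
          simpa using this.2
        have h1 : reduceWord (t :: w) = r ++ removables w :=
          reduceWord_cons_cancel ht ha (by rw [ih, hA, List.cons_append])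
        have h2 : ∀ s ∈ r, s.2 = true := fun s hs => by
          have : s ∈ addables w := by rw [hA]; simp [hs]
          rw [addables, List.mem_filter] at this
          simpa using this.2
        have h3 : ∀ s ∈ removables w, s.2 = false := fun s hs => by
          rw [removables, List.mem_filter] at hs
          simpa using hs.2
        rw [addables, removables, h1, List.filter_append, List.filter_append,
          List.filter_eq_self.2 (by simpa using h2), List.filter_eq_nil_iff.2 (by simpa using h3),
          List.filter_eq_nil_iff.2 (by simpa using h2), List.filter_eq_self.2 (by simpa using h3)]
        simp
    · rw [addables, removables, reduceWord_cons_true ht, List.filter_cons_of_pos (by simpa using ht),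
        List.filter_cons_of_neg (by simpa using ht), List.cons_append, ← addables, ← removables, ← ih]

theorem addables_cons_true (h : t.2 = true) : addables (t :: w) = t :: addables w := by
  rw [addables, reduceWord_cons_true h, List.filter_cons_of_pos (by simpa using h), addables]

theorem removables_cons_true (h : t.2 = true) : removables (t :: w) = removables w := by
  rw [removables, reduceWord_cons_true h, List.filter_cons_of_neg (by simpa using h), removables]

theorem snd_of_mem_addables {s : Box ℓ × Bool} (h : s ∈ addables w) : s.2 = true := by
  rw [addables, List.mem_filter] at h
  simpa using h.2

theorem snd_of_mem_removables {s : Box ℓ × Bool} (h : s ∈ removables w) : s.2 = false := by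
  rw [removables, List.mem_filter] at h
  simpa using h.2

theorem reduceWord_cons_nil (h : t.2 = false) (hA : addables w = []) :
    reduceWord (t :: w) = t :: removables w := by
  have h1 := reduceWord_eq w
  rw [hA, List.nil_append] at h1
  rw [reduceWord_cons_false h fun t' r h' => snd_of_mem_removables (w := w) (by rw [← h1, h']; simp), h1]

theorem addables_cons_nil (h : t.2 = false) (hA : addables w = []) : addables (t :: w) = [] := by
  rw [addables, reduceWord_cons_nil h hA, List.filter_eq_nil_iff]
  intro s hs
  rcases List.mem_cons.1 hs with rfl | hs
  · simpa using h
  · simpa using snd_of_mem_removables hs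

theorem removables_cons_nil (h : t.2 = false) (hA : addables w = []) :
    removables (t :: w) = t :: removables w := by
  have h1 := reduceWord_eq (t :: w)
  rw [addables_cons_nil h hA, List.nil_append, reduceWord_cons_nil h hA] at h1
  exact h1.symm

theorem reduceWord_cons_cons (h : t.2 = false) {a : Box ℓ × Bool} {r : List (Box ℓ × Bool)}
    (hA : addables w = a :: r) : reduceWord (t :: w) = r ++ removables w :=
  reduceWord_cons_cancel h (snd_of_mem_addables (w := w) (s := a) (by rw [hA]; simp))
    (by rw [reduceWord_eq, hA, List.cons_append])

theorem addables_cons_cons (h : t.2 = false) {a : Box ℓ × Bool} {r : List (Box ℓ × Bool)}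
    (hA : addables w = a :: r) : addables (t :: w) = r := by
  rw [addables, reduceWord_cons_cons h hA, List.filter_append, List.filter_eq_self.2,
    List.filter_eq_nil_iff.2, List.append_nil]
  · intro s hs
    simpa using snd_of_mem_removables hs
  · intro s hs
    simpa using snd_of_mem_addables (w := w) (by rw [hA]; simp [hs])

theorem removables_cons_cons (h : t.2 = false) {a : Box ℓ × Bool} {r : List (Box ℓ × Bool)}
    (hA : addables w = a :: r) : removables (t :: w) = removables w := by
  have h1 := reduceWord_eq (t :: w)
  rw [addables_cons_cons h hA, reduceWord_cons_cons h hA] at h1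
  exact (List.append_cancel_left h1).symm

theorem signSum_cons (z : ℤ) : signSum ρ (t :: w) z =
    (if z ≤ ρ t then (if t.2 then 1 else -1) else 0) + signSum ρ w z := by
  simp [signSum]

theorem signSum_eq_zero {z : ℤ} (h : ∀ s ∈ w, ρ s < z) : signSum ρ w z = 0 := by
  induction w with
  | nil => rfl
  | cons t w ih =>
    rw [signSum_cons, ih fun s hs => h s (List.mem_cons_of_mem _ hs),
      if_neg (by have := h t (by simp); omega)]
    rfl

theorem signSum_low {z : ℤ} (h : ∀ s ∈ w, z ≤ ρ s) :
    signSum ρ w z = (addables w).length - (removables w).length := by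
  induction w with
  | nil => rfl
  | cons t w ih =>
    rw [signSum_cons, ih fun s hs => h s (List.mem_cons_of_mem _ hs), if_pos (h t (by simp))]
    rcases ht : t.2
    · rcases hA : addables w with - | ⟨a, r⟩
      · rw [addables_cons_nil ht hA, removables_cons_nil ht hA]
        simp
      · rw [addables_cons_cons ht hA, removables_cons_cons ht hA]
        simp
        ring
    · rw [addables_cons_true ht, removables_cons_true ht]
      simp
      ring

theorem exists_low (ρ : Box ℓ × Bool → ℤ) (w : List (Box ℓ × Bool)) : ∃ z, ∀ s ∈ w, z ≤ ρ s := by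
  induction w with
  | nil => exact ⟨0, by simp⟩
  | cons t w ih =>
    obtain ⟨z, hz⟩ := ih
    refine ⟨min z (ρ t), fun s hs => ?_⟩
    rcases List.mem_cons.1 hs with rfl | hs
    · exact min_le_right _ _
    · exact (min_le_left _ _).trans (hz s hs)

theorem exists_high (ρ : Box ℓ × Bool → ℤ) (w : List (Box ℓ × Bool)) : ∃ z, ∀ s ∈ w, ρ s < z := by
  induction w with
  | nil => exact ⟨0, by simp⟩
  | cons t w ih =>
    obtain ⟨z, hz⟩ := ih
    refine ⟨max z (ρ t + 1), fun s hs => ?_⟩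
    rcases List.mem_cons.1 hs with rfl | hs
    · omega
    · have := hz s hs
      omega

/-- As rows decrease along the word, `signSum` is the sum over a prefix. The maximal prefix sum
counts the surviving addable letters: an addable letter in front raises it by one, a removable one
lowers it by one, but not below the value `0` of the empty prefix. -/
theorem signSum_max (hw : w.Pairwise fun s t => ρ t < ρ s) :
    (∀ z, signSum ρ w z ≤ (addables w).length) ∧ ∃ z, signSum ρ w z = (addables w).length := by
  induction w with
  | nil => exact ⟨fun z => le_rfl, 0, rfl⟩
  | cons t w ih =>
    obtain ⟨h1, z₀, h2⟩ := ih hw.of_cons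
    have hlt : ∀ s ∈ w, ρ s < ρ t := (List.pairwise_cons.1 hw).1
    have hz : ∀ z, ρ t ≤ z → signSum ρ w z = 0 := fun z hz =>
      signSum_eq_zero fun s hs => (hlt s hs).trans_le hz
    obtain ⟨z₁, hz₁, h3⟩ : ∃ z ≤ ρ t, signSum ρ w z = (addables w).length := by
      rcases le_total z₀ (ρ t) with h | h
      · exact ⟨z₀, h, h2⟩
      · exact ⟨ρ t, le_rfl, by rw [← h2, hz _ h, hz _ le_rfl]⟩
    rcases ht : t.2
    · rcases hA : addables w with - | ⟨a, r⟩
      · rw [addables_cons_nil ht hA]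
        rw [hA] at h1
        refine ⟨fun z => ?_, ρ t + 1, ?_⟩
        · rw [signSum_cons, ht]
          have := h1 z
          split_ifs <;> simp at * <;> omega
        · rw [signSum_cons, if_neg (by omega), hz _ (by omega)]
          rfl
      · rw [addables_cons_cons ht hA]
        rw [hA, List.length_cons] at h1 h3
        refine ⟨fun z => ?_, z₁, ?_⟩
        · rw [signSum_cons, ht]
          have := h1 z
          have := hz z
          push_cast at *
          split_ifs <;> simp at * <;> omega
        · rw [signSum_cons, if_pos hz₁, h3, ht]
          push_cast
          simp
    · rw [addables_cons_true ht, List.length_cons]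
      refine ⟨fun z => ?_, z₁, ?_⟩
      · rw [signSum_cons, ht]
        have := h1 z
        push_cast
        split_ifs <;> simp at * <;> omega
      · rw [signSum_cons, if_pos hz₁, h3, ht]
        push_cast
        simp
        ring

/-- The last surviving addable letter ends the shortest prefix whose sum is maximal. In terms of
rows, it sits at the greatest row at which the sum attains its maximum. -/
theorem addables_getLast (hw : w.Pairwise fun s t => ρ t < ρ s) {g : Box ℓ × Bool}
    (hg : (addables w).getLast? = some g) : g ∈ w ∧ g.2 = true ∧
      (∀ z ≤ ρ g, signSum ρ w z ≤ signSum ρ w (ρ g)) ∧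
      ∀ z, ρ g < z → signSum ρ w z < signSum ρ w (ρ g) := by
  induction w with
  | nil => simp [addables, reduceWord] at hg
  | cons t w ih =>
    have hlt : ∀ s ∈ w, ρ s < ρ t := (List.pairwise_cons.1 hw).1
    have hz : ∀ z, ρ t ≤ z → signSum ρ w z = 0 := fun z hz =>
      signSum_eq_zero fun s hs => (hlt s hs).trans_le hz
    obtain ⟨hmax, z₀, hz₀⟩ := signSum_max hw.of_cons
    rcases ht : t.2
    · rcases hA : addables w with - | ⟨a, r⟩
      · rw [addables_cons_nil ht hA] at hg
        simp at hg
      · rw [addables_cons_cons ht hA] at hg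
        rcases r with - | ⟨a', r⟩
        · simp at hg
        obtain ⟨h1, h2, h3, h4⟩ := ih hw.of_cons (by rw [hA]; simpa using hg)
        have h5 := hlt g h1
        -- The leading removable letter has cancelled one addable letter and another one survives.
        -- So after one is subtracted, the maximum still exceeds the value `0` of the empty prefix.
        have h6 : 2 ≤ signSum ρ w (ρ g) := by
          have h7 : signSum ρ w z₀ ≤ signSum ρ w (ρ g) := by
            rcases le_or_gt z₀ (ρ g) with h | h
            · exact h3 _ h
            · exact (h4 _ h).le
          rw [hz₀, hA] at h7
          simp at h7
          omega
        refine ⟨List.mem_cons_of_mem _ h1, h2, fun z hz' => ?_, fun z hz' => ?_⟩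
        · rw [signSum_cons, signSum_cons, if_pos (show z ≤ ρ t by omega), if_pos (show ρ g ≤ ρ t by omega)]
          have := h3 z hz'
          omega
        · rw [signSum_cons, signSum_cons, if_pos h5.le, ht]
          have := h4 z hz'
          have := hz z
          split_ifs <;> simp at * <;> omega
    · rw [addables_cons_true ht] at hg
      rcases hA : addables w with - | ⟨a, r⟩
      · rw [hA] at hg hmax
        simp only [List.getLast?_singleton, Option.some.injEq] at hg
        subst hg
        refine ⟨by simp, ht, fun z hz' => ?_, fun z hz' => ?_⟩
        · rw [signSum_cons, signSum_cons, if_pos hz', if_pos le_rfl, hz _ le_rfl]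
          have := hmax z
          simp at this
          omega
        · rw [signSum_cons, signSum_cons, if_neg (by omega), if_pos le_rfl, hz _ le_rfl, hz z hz'.le, ht]
          simp
      · obtain ⟨h1, h2, h3, h4⟩ := ih hw.of_cons (by rw [hA] at hg ⊢; simpa using hg)
        have h5 := hlt g h1
        have h6 := h4 _ h5
        have h7 := hz _ le_rfl
        refine ⟨List.mem_cons_of_mem _ h1, h2, fun z hz' => ?_, fun z hz' => ?_⟩
        · rw [signSum_cons, signSum_cons, if_pos (by omega), if_pos (by omega)]
          have := h3 z hz'
          omega
        · rw [signSum_cons, signSum_cons, if_pos h5.le, ht]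
          have := h4 z hz'
          have := hz z
          split_ifs <;> simp at * <;> omega

/-- The first surviving removable letter follows the longest prefix whose sum is maximal; the rows
from `ρ g + 1` on form this prefix. -/
theorem removables_head (hw : w.Pairwise fun s t => ρ t < ρ s) {g : Box ℓ × Bool}
    (hg : (removables w).head? = some g) : g ∈ w ∧ g.2 = false ∧
      (∀ z ≤ ρ g, signSum ρ w z < signSum ρ w (ρ g + 1)) ∧
      ∀ z, ρ g < z → signSum ρ w z ≤ signSum ρ w (ρ g + 1) := by
  induction w with
  | nil => simp [removables, reduceWord] at hg
  | cons t w ih =>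
    have hlt : ∀ s ∈ w, ρ s < ρ t := (List.pairwise_cons.1 hw).1
    have hz : ∀ z, ρ t ≤ z → signSum ρ w z = 0 := fun z hz =>
      signSum_eq_zero fun s hs => (hlt s hs).trans_le hz
    obtain ⟨hmax, z₀, hz₀⟩ := signSum_max hw.of_cons
    have main : (removables w).head? = some g → (t.2 = true ∨ addables w ≠ []) →
        g ∈ t :: w ∧ g.2 = false ∧
        (∀ z ≤ ρ g, signSum ρ (t :: w) z < signSum ρ (t :: w) (ρ g + 1)) ∧
        ∀ z, ρ g < z → signSum ρ (t :: w) z ≤ signSum ρ (t :: w) (ρ g + 1) := by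
      intro hg hcase
      obtain ⟨h1, h2, h3, h4⟩ := ih hw.of_cons hg
      have h5 := hlt g h1
      have h6 := h4 _ h5
      rw [hz _ le_rfl] at h6
      have h7 : t.2 = false → 1 ≤ signSum ρ w (ρ g + 1) := fun ht => by
        have h8 : signSum ρ w z₀ ≤ signSum ρ w (ρ g + 1) := by
          rcases le_or_gt z₀ (ρ g) with h | h
          · exact (h3 _ h).le
          · exact h4 _ h
        rw [ht] at hcase
        have h9 := List.length_pos_iff.2 (hcase.resolve_left (by simp))
        omega
      refine ⟨List.mem_cons_of_mem _ h1, h2, fun z hz' => ?_, fun z hz' => ?_⟩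
      · rw [signSum_cons, signSum_cons, if_pos (show z ≤ ρ t by omega), if_pos (show ρ g + 1 ≤ ρ t by omega)]
        have := h3 z hz'
        omega
      · rw [signSum_cons, signSum_cons, if_pos (show ρ g + 1 ≤ ρ t by omega)]
        have := h4 z hz'
        have := hz z
        rcases ht : t.2
        · have := h7 ht
          split_ifs <;> simp at * <;> omega
        · split_ifs <;> simp at * <;> omega
    rcases ht : t.2
    · rcases hA : addables w with - | ⟨a, r⟩
      · rw [removables_cons_nil ht hA] at hg
        simp only [List.head?_cons, Option.some.injEq] at hg
        subst hg
        rw [hA] at hmax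
        refine ⟨by simp, ht, fun z hz' => ?_, fun z hz' => ?_⟩
        · rw [signSum_cons, signSum_cons, if_pos hz', if_neg (show ¬ ρ t + 1 ≤ ρ t by omega),
            hz (ρ t + 1) (by omega), ht]
          have := hmax z
          simp at this ⊢
          omega
        · rw [signSum_cons, signSum_cons, if_neg (by omega), if_neg (by omega), hz _ (by omega),
            hz (ρ t + 1) (by omega)]
      · rw [removables_cons_cons ht hA] at hg
        exact main hg (Or.inr (by rw [hA]; simp))
    · rw [removables_cons_true ht] at hg
      exact main hg (Or.inl ht)

theorem addables_ne_nil (hw : w.Pairwise fun s t => ρ t < ρ s) {r : ℤ}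
    (h : ∀ z, r < z → signSum ρ w z < signSum ρ w r) : addables w ≠ [] := by
  intro hA
  obtain ⟨z, hz⟩ := exists_high ρ w
  have h1 := h (max z (r + 1)) (by omega)
  rw [signSum_eq_zero fun s hs => (hz s hs).trans_le (le_max_left _ _)] at h1
  have h2 := (signSum_max hw).1 r
  rw [hA] at h2
  simp at h2
  omega

theorem removables_ne_nil (hw : w.Pairwise fun s t => ρ t < ρ s) {r : ℤ}
    (h : ∀ z ≤ r, signSum ρ w z < signSum ρ w (r + 1)) : removables w ≠ [] := by
  intro hR
  obtain ⟨z, hz⟩ := exists_low ρ w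
  have h1 := h (min z r) (by omega)
  rw [signSum_low fun s hs => (min_le_left _ _).trans (hz s hs), hR] at h1
  have h2 := (signSum_max hw).1 (r + 1)
  simp at h1
  omega

open Classical in
theorem signSum_sub (hw : w.Pairwise fun s t => ρ t < ρ s) (z : ℤ) :
    signSum ρ w z - signSum ρ w (z + 1) = (if ∃ s ∈ w, ρ s = z ∧ s.2 = true then 1 else 0) -
      if ∃ s ∈ w, ρ s = z ∧ s.2 = false then 1 else 0 := by
  induction w with
  | nil => simp [signSum]
  | cons t w ih =>
    have hlt : ∀ s ∈ w, ρ s < ρ t := (List.pairwise_cons.1 hw).1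
    have h1 := ih hw.of_cons
    rw [signSum_cons, signSum_cons]
    simp only [List.mem_cons, exists_eq_or_imp]
    by_cases hz : ρ t = z
    · have h2 : ∀ b, ¬ ∃ s ∈ w, ρ s = z ∧ s.2 = b := by
        rintro b ⟨s, hs, h, -⟩
        have := hlt s hs
        omega
      rw [if_neg (h2 _), if_neg (h2 _)] at h1
      simp only [hz, true_and, h2, or_false]
      rcases t.2 <;> simp at h1 ⊢ <;> omega
    · simp only [hz, false_and, false_or]
      rw [← h1]
      have h2 : (z ≤ ρ t) ↔ z + 1 ≤ ρ t := by omega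
      simp only [h2]
      ring

end

/-! ### Good boxes and good rows -/

theorem ind_congr {A B : Set (ℤ × ℤ)} {c x c' x' : ℤ} (h : (c, x) ∈ A ↔ (c', x') ∈ B) :
    ind A c x = ind B c' x' := by
  by_cases h' : (c', x') ∈ B
  · rw [ind_of_mem h', ind_of_mem (h.2 h')]
  · rw [ind_of_notMem h', ind_of_notMem fun h'' => h' (h.1 h'')]

/-- The move lowers the height by two in all rows above `r`. So `r` was the last global minimum
exactly when `r + 1` becomes the first one. This is why the lowering operators invert the raising
operators. -/
theorem isRemRow_moveBead {e l : ℤ} {A : Set (ℤ × ℤ)} (he : 2 ≤ e) {i r : ℤ} (h1 : (i, r) ∈ A)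
    (h2 : (i + 1, r) ∉ A) : IsRemRow (moveBead e l A i r) i r ↔ IsAddRow A i r := by
  obtain ⟨h, H⟩ := exists_isHeight A i
  have H' : IsHeight (moveBead e l A i r) i fun x => h x - if r < x then 2 else 0 := fun x => by
    have hx := H x
    by_cases hr : x = r
    · subst hr
      rw [ind_of_mem h1, ind_of_notMem h2] at hx
      have h3 : (i, x) ∉ moveBead e l A i x := fun h => ((mem_moveBead_left he).1 h).2 rfl
      have h4 : (i + 1, x) ∈ moveBead e l A i x := (mem_moveBead_right he).2 (Or.inr rfl)
      rw [ind_of_mem h4, ind_of_notMem h3]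
      simp only [lt_irrefl, if_false, if_pos (Int.lt_succ x)]
      omega
    · have h3 : ind (moveBead e l A i r) i x = ind A i x := by
        have : (i, x) ∈ moveBead e l A i r ↔ (i, x) ∈ A := by simp [mem_moveBead_left he, hr]
        exact ind_congr this
      have h4 : ind (moveBead e l A i r) (i + 1) x = ind A (i + 1) x := by
        have : (i + 1, x) ∈ moveBead e l A i r ↔ (i + 1, x) ∈ A := by
          simp [mem_moveBead_right he, hr]
        exact ind_congr this
      rw [h3, h4]
      have h5 : r < x + 1 ↔ r < x := by omega
      simp only [h5, hx]
      ring
  have hr : h (r + 1) = h r + 1 := by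
    have := H r
    rw [ind_of_mem h1, ind_of_notMem h2] at this
    omega
  have hr' : r < r + 1 := by omega
  constructor
  · intro h'
    refine H.isAddRow h1 h2 (fun x hx => ?_) fun x hx => ?_
    · have := h'.lt _ H' x hx
      simp only [hr', if_true, if_neg (not_lt.2 hx)] at this
      omega
    · have := h'.le _ H' x hx
      simp only [hr', if_true, hx] at this
      omega
  · intro h'
    refine H'.isRemRow (fun h => ((mem_moveBead_left he).1 h).2 rfl)
      ((mem_moveBead_right he).2 (Or.inr rfl)) (fun x hx => ?_) fun x hx => ?_
    · have := h'.le _ H x hx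
      simp only [hr', if_true, if_neg (not_lt.2 hx)]
      omega
    · have := h'.lt _ H x hx
      simp only [hr', if_true, hx]
      omega

theorem exists_list_of_finset {α : Type*} [DecidableEq α] (T : Finset α) (ρ : α → ℤ)
    (h : Set.InjOn ρ T) :
    ∃ w : List α, w.Pairwise (fun s t => ρ t < ρ s) ∧ ∀ s, s ∈ w ↔ s ∈ T := by
  induction T using Finset.induction_on_max_value (f := ρ) with
  | empty => exact ⟨[], List.Pairwise.nil, by simp⟩
  | insert a T ha hmax ih =>
    obtain ⟨w, hw, hm⟩ := ih (h.mono (by simp))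
    refine ⟨a :: w, List.pairwise_cons.2 ⟨fun t ht => ?_, hw⟩, fun s => by simp [hm]⟩
    have ht' := (hm t).1 ht
    refine lt_of_le_of_ne (hmax t ht') fun heq => ha ?_
    rwa [← h (by simp [ht']) (by simp) heq]

section
variable {ℓ : ℕ} {x y : ChargedPartition ℓ} {m : ℕ} {i : ℤ}

/-- The row in which the box with content congruent to `i` is found in column `i` of the cover. -/
def wordRow (m : ℕ) (i : ℤ) (x : ChargedPartition ℓ) (t : Box ℓ × Bool) : ℤ :=
  t.1.comp - (content x t.1 - i) / m * ℓ

theorem exists_content_eq (hm : 0 < m) {g : Box ℓ} (hg : (content x g : ZMod m) = i) :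
    ∃ q : ℤ, content x g = i + q * m ∧ ∀ b, wordRow m i x (g, b) = g.comp + -q * ℓ := by
  have h1 : (m : ℤ) ∣ content x g - i := (ZMod.intCast_eq_intCast_iff_dvd_sub _ _ _).1 hg.symm
  obtain ⟨q, hq⟩ := h1
  refine ⟨q, by linarith, fun b => ?_⟩
  rw [wordRow, hq, Int.mul_ediv_cancel_left _ (by omega)]
  ring

theorem mem_cover_wordRow (hm : 0 < m) {g : Box ℓ} (hg : (content x g : ZMod m) = i) (b : Bool)
    (z : ChargedPartition ℓ) :
    ((i, wordRow m i x (g, b)) ∈ cover m z ↔ (g.comp, content x g) ∈ abacus z) ∧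
    ((i + 1, wordRow m i x (g, b)) ∈ cover m z ↔ (g.comp, content x g + 1) ∈ abacus z) := by
  obtain ⟨q, hq, hr⟩ := exists_content_eq hm hg
  rw [hr]
  have h1 := mem_cover (x := z) (m := m) (j := g.comp) (d := content x g) (k := -q)
  have h2 := mem_cover (x := z) (m := m) (j := g.comp) (d := content x g + 1) (k := -q)
  rw [show content x g + -q * m = i by rw [hq]; ring] at h1
  rw [show content x g + 1 + -q * m = i + 1 by rw [hq]; ring] at h2
  exact ⟨h1, h2⟩

/-- A box of content `i + q m` in component `j` is found in row `j - q ℓ`. Greater content means a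
lower row, and for equal contents the order of the components is the reversed order of boxes. -/
theorem boxLT_iff_wordRow (hm : 0 < m) {g g' : Box ℓ} (hg : (content x g : ZMod m) = i)
    (hg' : (content x g' : ZMod m) = i) (b b' : Bool) :
    BoxLT x g g' ↔ wordRow m i x (g', b') < wordRow m i x (g, b) := by
  obtain ⟨q, hq, hr⟩ := exists_content_eq hm hg
  obtain ⟨q', hq', hr'⟩ := exists_content_eq hm hg'
  rw [hr, hr', BoxLT, hq, hq', Fin.lt_def]
  have h1 := g.comp.isLt
  have h2 := g'.comp.isLt
  have hm' : (0 : ℤ) < m := by omega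
  have hl' : (0 : ℤ) < ℓ := by omega
  rcases lt_trichotomy q q' with h | h | h
  · have h3 : i + q * m < i + q' * m := by nlinarith
    have h4 : (g'.comp : ℤ) + -q' * ℓ < g.comp + -q * ℓ := by nlinarith
    exact ⟨fun _ => h4, fun _ => Or.inl h3⟩
  · subst h
    simp
  · have h3 : ¬ i + q * m < i + q' * m := by nlinarith
    have h5 : ¬ i + q * m = i + q' * m := by nlinarith
    have h4 : ¬ (g'.comp : ℤ) + -q' * ℓ < g.comp + -q * ℓ := by nlinarith
    exact ⟨fun h => (h.elim h3 fun h => h5 h.1).elim, fun h => (h4 h).elim⟩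

/-- The letters of the word of `x`. -/
def letters (m : ℕ) (i : ZMod m) (x : ChargedPartition ℓ) : Set (Box ℓ × Bool) :=
  {t | (content x t.1 : ZMod m) = i ∧
    ((t.2 = true ∧ ∃ y, AddBoxes x {t.1} y) ∨ (t.2 = false ∧ ∃ y, AddBoxes y {t.1} x))}

theorem isWord_iff (hm : 0 < m) {w : List (Box ℓ × Bool)} : IsWord m i x w ↔
    w.Pairwise (fun s t => wordRow m i x t < wordRow m i x s) ∧ ∀ t, t ∈ w ↔ t ∈ letters m i x := by
  have h1 : (∀ g : Box ℓ,
    ((g, true) ∈ w ↔ (content x g : ZMod m) = i ∧ ∃ y, AddBoxes x {g} y) ∧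
    ((g, false) ∈ w ↔ (content x g : ZMod m) = i ∧ ∃ y, AddBoxes y {g} x)) ↔
      ∀ t, t ∈ w ↔ t ∈ letters m i x := by
    simp only [letters, Prod.forall, Bool.forall_bool, Set.mem_ofPred_eq, reduceCtorEq, false_and,
      true_and, or_false, false_or]
    exact forall_congr' fun _ => and_comm
  rw [IsWord, h1]
  refine and_congr_left fun h => ?_
  constructor <;> intro hw
  · exact hw.imp_of_mem fun {s t} hs ht hlt =>
      (boxLT_iff_wordRow hm ((h s).1 hs).1 ((h t).1 ht).1 s.2 t.2).1 hlt
  · exact hw.imp_of_mem fun {s t} hs ht hlt =>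
      (boxLT_iff_wordRow hm ((h s).1 hs).1 ((h t).1 ht).1 s.2 t.2).2 hlt

theorem cover_of_mem_letters (hm : 0 < m) {t : Box ℓ × Bool} (ht : t ∈ letters m i x) :
    ((i, wordRow m i x t) ∈ cover m x ↔ t.2 = true) ∧
    ((i + 1, wordRow m i x t) ∈ cover m x ↔ t.2 = false) := by
  obtain ⟨g, b⟩ := t
  obtain ⟨h1, h2⟩ := ht
  obtain ⟨h3, h4⟩ := mem_cover_wordRow hm h1 b x
  rw [h3, h4]
  rcases h2 with ⟨h2, y, hy⟩ | ⟨h2, y, hy⟩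
  · obtain ⟨h5, h6, -⟩ := addBoxes_singleton_iff.1 hy
    have h7 := content_mem_abacus h5
    simp only at h2
    simp [h2, h6, h7]
  · obtain ⟨h5, h6, -⟩ := hy.abacus_singleton
    simp only at h2 h5 h6
    simp [h2, h5, h6]

theorem injOn_wordRow (hm : 0 < m) : Set.InjOn (wordRow m i x) (letters m i x) := by
  rintro ⟨g, b⟩ ht ⟨g', b'⟩ ht' heq
  have hb : b = b' := by
    have h1 := (cover_of_mem_letters hm ht).1
    have h2 := (cover_of_mem_letters hm ht').1
    rw [heq, h2] at h1
    simpa [eq_comm] using Bool.eq_iff_iff.2 h1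
  obtain ⟨q, hq, hr⟩ := exists_content_eq hm ht.1
  obtain ⟨q', hq', hr'⟩ := exists_content_eq hm ht'.1
  simp only at hr hr' hq hq'
  rw [hr, hr'] at heq
  obtain ⟨h1, h2⟩ := fin_add_mul_injective heq
  have h3 : q = q' := by omega
  have h4 : content x g = content x g' := by rw [hq, hq', h3]
  subst hb
  congr 1
  rcases ht.2 with ⟨hb, y, hy⟩ | ⟨hb, y, hy⟩ <;> rcases ht'.2 with ⟨hb', y', hy'⟩ | ⟨hb', y', hy'⟩
  · exact rightBoxes_injective hy.mem_rightBoxes hy'.mem_rightBoxes h1 h4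
  · simp only at hb hb'; rw [hb] at hb'; cases hb'
  · simp only at hb hb'; rw [hb] at hb'; cases hb'
  · exact (removable_unique hy hy' h1 h4).1

theorem finite_letters (hm : 0 < m) : (letters m i x).Finite := by
  rcases Nat.eq_zero_or_pos ℓ with rfl | hl
  · exact (Set.finite_empty).subset fun t _ => t.1.comp.elim0
  have hA := isConfig_cover hm hl x
  obtain ⟨a, ha⟩ := hA.low i
  obtain ⟨a', ha'⟩ := hA.low (i + 1)
  obtain ⟨b, hb⟩ := hA.high i
  obtain ⟨b', hb'⟩ := hA.high (i + 1)
  refine Set.Finite.of_injOn (f := wordRow m i x) (t := Set.Icc (min a a') (max b b'))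
    (fun t ht => ?_) (injOn_wordRow hm) (Set.finite_Icc _ _)
  obtain ⟨h1, h2⟩ := cover_of_mem_letters hm ht
  have h3 := ha (wordRow m i x t)
  have h4 := ha' (wordRow m i x t)
  have h5 := hb (wordRow m i x t)
  have h6 := hb' (wordRow m i x t)
  rw [h1] at h3 h5
  rw [h2] at h4 h6
  rw [Set.mem_Icc]
  rcases ht2 : t.2 <;> simp only [ht2, reduceCtorEq, false_imp_iff, true_imp_iff, imp_false,
    not_le] at h3 h4 h5 h6 <;> omega

theorem exists_isWord (hm : 0 < m) : ∃ w, IsWord m i x w := by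
  classical
  obtain ⟨w, hw, h⟩ := exists_list_of_finset (finite_letters (i := i) (x := x) hm).toFinset
    (wordRow m i x) (by simpa using injOn_wordRow hm)
  exact ⟨w, (isWord_iff hm).2 ⟨hw, by simpa using h⟩⟩

theorem exists_letter (hm : 0 < m) (hl : 0 < ℓ) {r : ℤ} (h1 : (i, r) ∈ cover m x)
    (h2 : (i + 1, r) ∉ cover m x) : ∃ t ∈ letters m i x, wordRow m i x t = r ∧ t.2 = true := by
  obtain ⟨j, k, rfl⟩ := exists_fin_add_mul hl r
  have h3 := mem_cover (x := x) (m := m) (j := j) (d := i - k * m) (k := k)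
  have h4 := mem_cover (x := x) (m := m) (j := j) (d := i - k * m + 1) (k := k)
  rw [show i - k * m + k * m = i by ring] at h3
  rw [show i - k * m + 1 + k * m = i + 1 by ring] at h4
  rw [h3] at h1
  rw [h4] at h2
  obtain ⟨g, hg, rfl, hc⟩ := exists_rightBox h1
  have hi : (content x g : ZMod m) = i := by rw [hc]; push_cast; simp
  refine ⟨(g, true), ⟨hi, Or.inl ⟨rfl, addable_iff.2 ⟨hg, by rwa [hc]⟩⟩⟩, ?_, rfl⟩
  rw [wordRow, hc, show i - k * m - i = m * -k by ring, Int.mul_ediv_cancel_left _ (by omega)]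
  ring

theorem exists_letter' (hm : 0 < m) (hl : 0 < ℓ) {r : ℤ} (h1 : (i, r) ∉ cover m x)
    (h2 : (i + 1, r) ∈ cover m x) : ∃ t ∈ letters m i x, wordRow m i x t = r ∧ t.2 = false := by
  obtain ⟨j, k, rfl⟩ := exists_fin_add_mul hl r
  have h3 := mem_cover (x := x) (m := m) (j := j) (d := i - k * m) (k := k)
  have h4 := mem_cover (x := x) (m := m) (j := j) (d := i - k * m + 1) (k := k)
  rw [show i - k * m + k * m = i by ring] at h3
  rw [show i - k * m + 1 + k * m = i + 1 by ring] at h4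
  rw [h3] at h1
  rw [h4] at h2
  obtain ⟨g, y, hg, rfl, hc⟩ := exists_removable h1 h2
  have hi : (content x g : ZMod m) = i := by rw [hc]; push_cast; simp
  refine ⟨(g, false), ⟨hi, Or.inr ⟨rfl, y, hg⟩⟩, ?_, rfl⟩
  rw [wordRow, hc, show i - k * m - i = m * -k by ring, Int.mul_ediv_cancel_left _ (by omega)]
  ring

/-- The letters of the word are the rows in which the columns `i` and `i + 1` differ. So the
signature rule, a statement on prefix sums, becomes a statement on minima of the height. -/
theorem IsWord.isHeight (hm : 0 < m) (hl : 0 < ℓ) {w : List (Box ℓ × Bool)} (hw : IsWord m i x w) :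
    IsHeight (cover m x) i fun z => - signSum (wordRow m i x) w z := by
  classical
  obtain ⟨h1, h2⟩ := (isWord_iff hm).1 hw
  intro z
  have h3 := signSum_sub h1 z
  have h4 : (∃ s ∈ w, wordRow m i x s = z ∧ s.2 = true) ↔
      (i, z) ∈ cover m x ∧ (i + 1, z) ∉ cover m x := by
    constructor
    · rintro ⟨s, hs, rfl, hb⟩
      have := cover_of_mem_letters hm ((h2 s).1 hs)
      simp [this, hb]
    · rintro ⟨h4, h5⟩
      obtain ⟨t, ht, h⟩ := exists_letter hm hl h4 h5
      exact ⟨t, (h2 t).2 ht, h⟩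
  have h5 : (∃ s ∈ w, wordRow m i x s = z ∧ s.2 = false) ↔
      (i, z) ∉ cover m x ∧ (i + 1, z) ∈ cover m x := by
    constructor
    · rintro ⟨s, hs, rfl, hb⟩
      have := cover_of_mem_letters hm ((h2 s).1 hs)
      simp [this, hb]
    · rintro ⟨h4, h5⟩
      obtain ⟨t, ht, h⟩ := exists_letter' hm hl h4 h5
      exact ⟨t, (h2 t).2 ht, h⟩
  simp only [h4, h5] at h3
  simp only [ind]
  by_cases h6 : (i, z) ∈ cover m x <;> by_cases h7 : (i + 1, z) ∈ cover m x <;>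
    simp [h6, h7] at h3 ⊢ <;> omega

theorem IsGoodAddable.isAddRow (hm : 0 < m) (hl : 0 < ℓ) {g : Box ℓ} (h : IsGoodAddable m i x g) :
    (content x g : ZMod m) = i ∧ (∃ y, AddBoxes x {g} y) ∧
      IsAddRow (cover m x) i (wordRow m i x (g, true)) := by
  obtain ⟨w, hw, hg⟩ := h
  obtain ⟨h1, h2⟩ := (isWord_iff hm).1 hw
  obtain ⟨h3, -, h4, h5⟩ := addables_getLast h1 hg
  have h6 := (h2 _).1 h3
  have h7 := cover_of_mem_letters hm h6
  refine ⟨h6.1, by simpa using h6.2, (hw.isHeight hm hl).isAddRow (h7.1.2 rfl) (by simp [h7.2])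
    (fun z hz => ?_) fun z hz => ?_⟩
  · have := h4 z hz
    omega
  · have := h5 z hz
    omega

theorem IsGoodRemovable.isRemRow (hm : 0 < m) (hl : 0 < ℓ) {g : Box ℓ}
    (h : IsGoodRemovable m i x g) : (content x g : ZMod m) = i ∧ (∃ y, AddBoxes y {g} x) ∧
      IsRemRow (cover m x) i (wordRow m i x (g, false)) := by
  obtain ⟨w, hw, hg⟩ := h
  obtain ⟨h1, h2⟩ := (isWord_iff hm).1 hw
  obtain ⟨h3, -, h4, h5⟩ := removables_head h1 hg
  have h6 := (h2 _).1 h3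
  have h7 := cover_of_mem_letters hm h6
  refine ⟨h6.1, by simpa using h6.2, (hw.isHeight hm hl).isRemRow (by simp [h7.1]) (h7.2.2 rfl)
    (fun z hz => ?_) fun z hz => ?_⟩
  · have := h4 z hz
    omega
  · have := h5 z hz
    omega

theorem IsAddRow.exists_isGoodAddable (hm : 0 < m) (hl : 0 < ℓ) {r : ℤ}
    (h : IsAddRow (cover m x) i r) :
    ∃ g, IsGoodAddable m i x g ∧ wordRow m i x (g, true) = r := by
  obtain ⟨w, hw⟩ := exists_isWord (i := i) (x := x) hm
  obtain ⟨h1, h2⟩ := (isWord_iff hm).1 hw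
  have h3 := addables_ne_nil (r := r) h1 fun z hz => by
    have := h.lt _ (hw.isHeight hm hl) z hz
    omega
  have h4 := List.getLast?_eq_getLast_of_ne_nil h3
  obtain ⟨⟨g, b⟩, hg⟩ : ∃ t, (addables w).getLast? = some t := ⟨_, h4⟩
  obtain rfl : b = true := (addables_getLast h1 hg).2.1
  have h5 : IsGoodAddable m i x g := ⟨w, hw, hg⟩
  exact ⟨g, h5, (h5.isAddRow hm hl).2.2.unique h⟩

theorem IsRemRow.exists_isGoodRemovable (hm : 0 < m) (hl : 0 < ℓ) {r : ℤ}
    (h : IsRemRow (cover m x) i r) :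
    ∃ g, IsGoodRemovable m i x g ∧ wordRow m i x (g, false) = r := by
  obtain ⟨w, hw⟩ := exists_isWord (i := i) (x := x) hm
  obtain ⟨h1, h2⟩ := (isWord_iff hm).1 hw
  have h3 := removables_ne_nil (r := r) h1 fun z hz => by
    have := h.lt _ (hw.isHeight hm hl) z hz
    omega
  have h4 := List.head?_eq_some_head h3
  obtain ⟨⟨g, b⟩, hg⟩ : ∃ t, (removables w).head? = some t := ⟨_, h4⟩
  obtain rfl : b = false := (removables_head h1 hg).2.1
  have h5 : IsGoodRemovable m i x g := ⟨w, hw, hg⟩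
  exact ⟨g, h5, (h5.isRemRow hm hl).2.2.unique h⟩

theorem AddBoxes.cover_eq (hm : 0 < m) (hl : 0 < ℓ) {z : ChargedPartition ℓ} {g : Box ℓ}
    (hz : z.charge = x.charge) (h : AddBoxes x {g} y)
    (hg : (content z g : ZMod m) = i) (b : Bool) :
    cover m y = moveBead m ℓ (cover m x) i (wordRow m i z (g, b)) := by
  obtain ⟨q, hq, hr⟩ := exists_content_eq hm hg
  have h1 := (addBoxes_singleton_iff.1 h).2.2
  have h2 : content x g = content z g := by rw [content, content, hz]
  rw [h2] at h1
  have h3 := (cover_eq_exchange_iff (m := m) hl (k := -q) (k' := -q)).2 h1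
  rw [show content z g + -q * m = i by rw [hq]; ring,
    show content z g + 1 + -q * m = i + 1 by rw [hq]; ring] at h3
  rw [h3, hr, moveBead_eq_exchange]

theorem raisesTo_iff (hm : 0 < m) (hl : 0 < ℓ) :
    RaisesTo m i x y ↔ AddRel m ℓ i (cover m x) (cover m y) := by
  constructor
  · rintro ⟨g, hg, hy⟩
    obtain ⟨h1, -, h2⟩ := hg.isAddRow hm hl
    exact ⟨_, h2, hy.cover_eq hm hl rfl h1 _⟩
  · rintro ⟨r, hr, hy⟩
    obtain ⟨g, hg, rfl⟩ := hr.exists_isGoodAddable hm hl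
    obtain ⟨h1, ⟨y', hy'⟩, h2⟩ := hg.isAddRow hm hl
    rw [← hy'.cover_eq hm hl rfl h1] at hy
    rw [cover_injective hy]
    exact ⟨g, hg, hy'⟩

theorem exists_raisesTo_iff (hm : 0 < m) (hl : 0 < ℓ) :
    (∃ y, RaisesTo m i x y) ↔ ∃ r, IsAddRow (cover m x) i r := by
  constructor
  · rintro ⟨y, hy⟩
    obtain ⟨r, hr, -⟩ := (raisesTo_iff hm hl).1 hy
    exact ⟨r, hr⟩
  · rintro ⟨r, hr⟩
    obtain ⟨g, hg, rfl⟩ := hr.exists_isGoodAddable hm hl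
    obtain ⟨h1, ⟨y', hy'⟩, h2⟩ := hg.isAddRow hm hl
    exact ⟨y', g, hg, hy'⟩

theorem lowersTo_iff (hm : 2 ≤ m) (hl : 0 < ℓ) : LowersTo m i x y ↔ RaisesTo m i y x := by
  have hm' : 0 < m := by omega
  have hm2 : (2 : ℤ) ≤ m := by omega
  rw [raisesTo_iff hm' hl]
  constructor
  · rintro ⟨g, hg, hy⟩
    obtain ⟨h1, -, h2⟩ := hg.isRemRow hm' hl
    have h3 := hy.cover_eq hm' hl hy.1 h1 false
    refine ⟨_, ?_, h3⟩
    obtain ⟨h4, h5⟩ := mem_cover_wordRow hm' h1 false y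
    have h6 := addBoxes_singleton_iff.1 hy
    rw [h3] at h2
    refine (isRemRow_moveBead hm2 (h4.2 ?_) fun h => ?_).1 h2
    · rw [hy.content_eq]
      exact content_mem_abacus h6.1
    · rw [h5, hy.content_eq] at h
      exact h6.2.1 h
  · rintro ⟨r, hr, hx⟩
    have h1 := (isRemRow_moveBead (l := ℓ) hm2 hr.mem hr.notMem).2 hr
    rw [← hx] at h1
    obtain ⟨g, hg, rfl⟩ := h1.exists_isGoodRemovable hm' hl
    obtain ⟨h2, ⟨y', hy'⟩, -⟩ := hg.isRemRow hm' hl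
    have h3 := hy'.abacus_singleton.2.2
    obtain ⟨q, hq, hrow⟩ := exists_content_eq hm' h2
    rw [hrow] at hx hr
    have h4 := (cover_eq_exchange_iff (x := y) (y := x) (m := m) hl (k := -q) (k' := -q)
      (j := g.comp) (j' := g.comp) (d := content x g) (d' := content x g + 1)).1 (by
        rw [hx, moveBead_eq_exchange]
        congr 1
        · rw [hq]; ring
        · rw [hq]; ring)
    have h5 : (g.comp, content x g) ∈ abacus y := by
      have := mem_cover (x := y) (m := m) (j := g.comp) (d := content x g) (k := -q)
      rw [show content x g + -q * m = i by rw [hq]; ring] at this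
      exact this.1 hr.mem
    have h6 : (g.comp, content x g + 1) ∉ abacus y := by
      have := mem_cover (x := y) (m := m) (j := g.comp) (d := content x g + 1) (k := -q)
      rw [show content x g + 1 + -q * m = i + 1 by rw [hq]; ring] at this
      exact fun h => hr.notMem (this.2 h)
    -- Both arise from `x` by moving the same bead back to the left.
    have h7 : y = y' := by
      apply abacus_injective
      rw [h3, h4]
      ext p
      simp only [Set.mem_insert_iff, Set.mem_sdiff, Set.mem_singleton_iff]
      by_cases hp : p = (g.comp, content x g)
      · simp [hp, h5]
      · by_cases hp' : p = (g.comp, content x g + 1)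
        · simp [hp', h6]
        · simp [hp, hp']
    subst h7
    exact ⟨g, hg, hy'⟩

theorem exists_lowersTo_iff (hm : 2 ≤ m) (hl : 0 < ℓ) :
    (∃ y, LowersTo m i x y) ↔ ∃ r, IsRemRow (cover m x) i r := by
  have hm' : 0 < m := by omega
  constructor
  · rintro ⟨y, g, hg, -⟩
    exact ⟨_, (hg.isRemRow hm' hl).2.2⟩
  · rintro ⟨r, hr⟩
    obtain ⟨g, hg, rfl⟩ := hr.exists_isGoodRemovable hm' hl
    obtain ⟨h1, ⟨y', hy'⟩, h2⟩ := hg.isRemRow hm' hl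
    exact ⟨y', g, hg, hy'⟩

theorem RaisesTo.charge_eq {i : ZMod m} (h : RaisesTo m i x y) : y.charge = x.charge := by
  obtain ⟨g, -, h⟩ := h
  exact h.1

end

/-! ### Strips and paths -/

section
variable {ℓ : ℕ} {x y : ChargedPartition ℓ} {e : ℕ}

/-- The periodic path `p` runs through the beads to the right of which the boxes of the strip `X`
lie. -/
structure IsTrace (e : ℕ) (x : ChargedPartition ℓ) (X : Fin e → Box ℓ) (p : ℤ → ℤ) : Prop where
  periodic : IsPeriodic e ℓ p
  mono : Monotone p
  mem : ∀ i, X i ∈ rightBoxes x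
  eq : ∀ i, p (content x (X i)) = (X i).comp
  consecutive : ∃ d : ℤ, ∀ i : Fin e, content x (X i) = d - (i : ℕ)

theorem exists_col (he : 0 < e) (d c : ℤ) : ∃ (i : Fin e) (k : ℤ), c = d - (i : ℕ) + k * e := by
  obtain ⟨i, k, h⟩ := exists_fin_add_mul he (d - c)
  exact ⟨i, -k, by linarith⟩

/-- The strip is the part of the path within the rows of the abacus, and `d` is the last column in
which the path has not yet left these rows. -/
theorem IsTrace.lt_iff {X : Fin e → Box ℓ} {p : ℤ → ℤ} (h : IsTrace e x X p) {d : ℤ} (he : 0 < e)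
    (hd : ∀ i : Fin e, content x (X i) = d - (i : ℕ)) (c : ℤ) : p c < ℓ ↔ c ≤ d := by
  have h1 := h.eq ⟨0, he⟩
  have h2 := h.eq ⟨e - 1, by omega⟩
  have h3 := (X ⟨0, he⟩).comp.isLt
  rw [hd] at h1 h2
  simp only at h1 h2
  have h4 := h.periodic (d - ((e - 1 : ℕ) : ℤ))
  rw [show d - ((e - 1 : ℕ) : ℤ) + e = d + 1 by omega, h2] at h4
  constructor
  · intro hc
    by_contra! hlt
    have := h.mono (show d + 1 ≤ c by omega)
    omega
  · intro hc
    have := h.mono hc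
    simp at h1
    omega

theorem IsTrace.nonneg_iff {X : Fin e → Box ℓ} {p : ℤ → ℤ} (h : IsTrace e x X p) {d : ℤ} (he : 0 < e)
    (hd : ∀ i : Fin e, content x (X i) = d - (i : ℕ)) (c : ℤ) : 0 ≤ p c ↔ d - e < c := by
  have h1 := h.lt_iff he hd (c + e)
  have h2 := h.periodic c
  omega

theorem IsTrace.exists_eq {X : Fin e → Box ℓ} {p : ℤ → ℤ} (h : IsTrace e x X p) (he : 0 < e) {c : ℤ}
    (h1 : 0 ≤ p c) (h2 : p c < ℓ) : ∃ i, content x (X i) = c := by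
  obtain ⟨d, hd⟩ := h.consecutive
  rw [h.lt_iff he hd] at h2
  rw [h.nonneg_iff he hd] at h1
  exact ⟨⟨(d - c).toNat, by omega⟩, by rw [hd]; simp only; omega⟩

theorem IsTrace.isPath {X : Fin e → Box ℓ} {p : ℤ → ℤ}
    (h : IsTrace e x X p) (he : 0 < e) : IsPath (cover e x) p := by
  refine ⟨h.mono, fun c => ?_⟩
  obtain ⟨d, hd⟩ := h.consecutive
  obtain ⟨i, k, rfl⟩ := exists_col he d c
  rw [← hd, h.periodic.add_mul, h.eq, mem_cover]
  exact content_mem_abacus (h.mem i)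

theorem IsTrace.path_unique {X : Fin e → Box ℓ} {p p' : ℤ → ℤ} (he : 0 < e) (h : IsTrace e x X p)
    (h' : IsTrace e x X p') : p = p' := by
  funext c
  obtain ⟨d, hd⟩ := h.consecutive
  obtain ⟨i, k, rfl⟩ := exists_col he d c
  rw [← hd, h.periodic.add_mul, h'.periodic.add_mul, h.eq, h'.eq]

theorem IsTrace.box_eq {X X' : Fin e → Box ℓ} {p p' : ℤ → ℤ} (h : IsTrace e x X p)
    (h' : IsTrace e x X' p') {i i' : Fin e} (hc : content x (X i) = content x (X' i'))
    (hp : p (content x (X i)) = p' (content x (X i))) : X i = X' i' := by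
  refine rightBoxes_injective (h.mem i) (h'.mem i') ?_ hc
  have h1 := h.eq i
  have h2 := h'.eq i'
  rw [← hc] at h2
  exact Fin.ext (by omega)

theorem IsTrace.disjoint_iff {X X' : Fin e → Box ℓ} {p p' : ℤ → ℤ} (he : 0 < e) (h : IsTrace e x X p)
    (h' : IsTrace e x X' p') : Disjoint (Set.range X) (Set.range X') ↔ ∀ c, p c ≠ p' c := by
  rw [Set.disjoint_left]
  constructor
  · intro hd c hc
    obtain ⟨d, hd1⟩ := h.consecutive
    obtain ⟨i, k, rfl⟩ := exists_col he d c
    rw [← hd1, h.periodic.add_mul, h'.periodic.add_mul, add_left_inj] at hc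
    have h1 := h.eq i
    have h2 := (X i).comp.isLt
    obtain ⟨i', hi'⟩ := h'.exists_eq he (c := content x (X i)) (by omega) (by omega)
    exact hd ⟨i, rfl⟩ ⟨i', (h.box_eq h' hi'.symm hc).symm⟩
  · rintro hc _ ⟨i, rfl⟩ ⟨i', hi'⟩
    refine hc (content x (X i)) ?_
    rw [h.eq, ← hi', h'.eq]

theorem not_boxLT_self (g : Box ℓ) : ¬ BoxLT x g g := by simp [BoxLT]

theorem BoxLT.asymm {g g' : Box ℓ} (h : BoxLT x g g') (h' : BoxLT x g' g) : False := by
  unfold BoxLT at h h'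
  rw [Fin.lt_def] at h h'
  omega

theorem StripLT.asymm {X Y : Fin e → Box ℓ} (h : StripLT x X Y) (h' : StripLT x Y X) : False := by
  obtain ⟨i, h1, h2⟩ := h
  obtain ⟨i', h1', h2'⟩ := h'
  rcases lt_trichotomy i i' with hlt | rfl | hlt
  · rw [h1' _ hlt] at h2
    exact not_boxLT_self _ h2
  · exact h2.asymm h2'
  · rw [h1 _ hlt] at h2'
    exact not_boxLT_self _ h2'

theorem exists_first {n : ℕ} {P : Fin n → Prop} (h : ∃ i, P i) : ∃ i, P i ∧ ∀ i' < i, ¬ P i' := by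
  obtain ⟨i, hi, hmin⟩ := WellFounded.has_min (wellFounded_lt (α := Fin n)) {i | P i} h
  exact ⟨i, hi, fun i' hlt hP => hmin i' hP hlt⟩

/-- A lower path stays in the rows of the abacus at least as far to the right. Either its strip
starts with a greater content, or both start in the same column and the first difference is a
smaller component, that is, a greater box. -/
theorem IsTrace.stripLT {X X' : Fin e → Box ℓ} {p p' : ℤ → ℤ} (he : 0 < e) (h : IsTrace e x X p)
    (h' : IsTrace e x X' p') (hle : ∀ c, p c ≤ p' c) (hne : X' ≠ X) : StripLT x X' X := by
  obtain ⟨d, hd⟩ := h.consecutive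
  obtain ⟨d', hd'⟩ := h'.consecutive
  have h1 := h.lt_iff he hd
  have h2 := h'.lt_iff he hd'
  have h3 : d' ≤ d := (h1 d').1 ((hle d').trans_lt ((h2 d').2 le_rfl))
  rcases h3.lt_or_eq with h3 | rfl
  · refine ⟨⟨0, he⟩, fun i hi => absurd hi (by simp [Fin.lt_def]), Or.inl ?_⟩
    rw [hd, hd']
    simpa using h3
  · obtain ⟨i, hi, hlt⟩ := exists_first (Function.ne_iff.1 hne)
    refine ⟨i, fun i' hi' => not_not.1 (hlt i' hi'), Or.inr ⟨by rw [hd, hd'], ?_⟩⟩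
    have h4 := h.eq i
    have h5 := h'.eq i
    rw [hd] at h4
    rw [hd'] at h5
    have h6 := hle (d' - (i : ℕ))
    rw [Fin.lt_def]
    by_contra! hge
    refine hi (rightBoxes_injective (h'.mem i) (h.mem i) (Fin.ext ?_) (by rw [hd, hd']))
    omega

theorem exists_isTrace_of_mem_strips (he : 0 < e) {X : Fin e → Box ℓ} (hX : X ∈ strips e x) :
    ∃ p, IsTrace e x X p := by
  obtain ⟨-, ⟨h1, h2⟩, h3⟩ := hX
  obtain ⟨d, hd⟩ : ∃ d : ℤ, ∀ i : Fin e, content x (X i) = d - (i : ℕ) := by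
    refine ⟨content x (X ⟨0, he⟩), ?_⟩
    rintro ⟨n, hn⟩
    induction n with
    | zero => simp
    | succ n ih =>
      have := h1 ⟨n, by omega⟩ ⟨n + 1, hn⟩ rfl
      rw [ih] at this
      simp only at this ⊢
      push_cast
      omega
  choose I K hIK using exists_col he d
  have huniq : ∀ (i : Fin e) (k : ℤ), I (d - (i : ℕ) + k * e) = i ∧ K (d - (i : ℕ) + k * e) = k := by
    intro i k
    have h4 := hIK (d - (i : ℕ) + k * e)
    have h5 := fin_add_mul_injective (j := i) (j' := I (d - (i : ℕ) + k * e)) (k := -k)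
      (k' := -K (d - (i : ℕ) + k * e)) (by linarith)
    exact ⟨h5.1.symm, by omega⟩
  have heq : ∀ (i : Fin e) (k : ℤ), ((X (I (d - (i : ℕ) + k * e))).comp : ℤ) +
      K (d - (i : ℕ) + k * e) * ℓ = (X i).comp + k * ℓ := fun i k => by
    rw [(huniq i k).1, (huniq i k).2]
  refine ⟨fun c => (X (I c)).comp + K c * ℓ, fun c => ?_, monotone_of_pred_le fun c => ?_, h3,
    fun i => ?_, d, hd⟩
  · obtain ⟨i, k, rfl⟩ := exists_col he d c
    have := heq i (k + 1)
    rw [show d - ((i : ℕ) : ℤ) + (k + 1) * e = d - ((i : ℕ) : ℤ) + k * e + e by ring] at this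
    rw [heq, this]
    ring
  · obtain ⟨i, k, rfl⟩ := exists_col he d c
    rw [heq]
    by_cases hi : (i : ℕ) + 1 < e
    · have := heq ⟨i + 1, hi⟩ k
      rw [show d - ((i : ℕ) : ℤ) + k * e - 1 = d - (((i + 1 : ℕ) : ℕ) : ℤ) + k * e by push_cast; ring,
        this]
      have := h2 i ⟨i + 1, hi⟩ (by simp [Fin.lt_def])
      rw [Fin.le_def] at this
      omega
    -- At the seam between two translates of the strip, monotonicity holds because the components
    -- fill the rows `0, …, ℓ - 1` and successive translates differ by `ℓ` rows.
    · have hi' : ((i : ℕ) : ℤ) + 1 = e := by omega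
      have := heq ⟨0, he⟩ (k - 1)
      rw [show d - ((i : ℕ) : ℤ) + k * e - 1 = d - ((0 : ℕ) : ℤ) + (k - 1) * e by
        push_cast; linarith, this]
      have := (X ⟨0, he⟩).comp.isLt
      have : (k - 1) * (ℓ : ℤ) = k * ℓ - ℓ := by ring
      omega
  · have := heq i 0
    simp only [zero_mul, add_zero] at this
    rw [hd, this]

theorem IsTrace.mem_strips {X : Fin e → Box ℓ} {p : ℤ → ℤ} (h : IsTrace e x X p) : X ∈ strips e x := by
  obtain ⟨d, hd⟩ := h.consecutive
  refine ⟨fun i i' hi hX => ?_, ⟨fun i i' hi => ?_, fun i i' hi => ?_⟩, h.mem⟩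
  · have h1 : content x (X i') = content x (X i) := by
      rw [content_of_rightBoxes (h.mem i'), content_of_rightBoxes (h.mem i), hX.1, hX.2]
    rw [hd, hd] at h1
    omega
  · rw [hd, hd]
    omega
  · have h1 := h.mono (show content x (X i') ≤ content x (X i) by
      rw [hd, hd]
      rw [Fin.lt_def] at hi
      omega)
    rw [h.eq, h.eq] at h1
    rw [Fin.le_def]
    omega

theorem exists_isTrace_of_isPath (hl : 0 < ℓ) {p : ℤ → ℤ} (hp : IsPath (cover e x) p)
    (hper : IsPeriodic e ℓ p) : ∃ X, IsTrace e x X p := by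
  have hl' : (0 : ℤ) < ℓ := by omega
  obtain ⟨d, hd⟩ : ∃ d, ∀ c, p c < ℓ ↔ c ≤ d := by
    obtain ⟨c₁, h1⟩ := IsPeriodic.exists_le hl' hper (ℓ - 1)
    obtain ⟨c₂, h2⟩ := IsPeriodic.exists_gt hl' hper (ℓ - 1)
    obtain ⟨d, h3, h4⟩ := Int.exists_greatest_of_bdd (P := fun c => p c < ℓ)
      ⟨c₂, fun z hz => by
        by_contra! hlt
        have := hp.1 hlt.le
        omega⟩ ⟨c₁, by omega⟩
    exact ⟨d, fun c => ⟨h4 c, fun hc => (hp.1 hc).trans_lt h3⟩⟩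
  have h1 : ∀ i : Fin e, 0 ≤ p (d - (i : ℕ)) ∧ p (d - (i : ℕ)) < ℓ := fun i => by
    refine ⟨?_, (hd _).2 (by omega)⟩
    have := hper (d - (i : ℕ))
    have h2 := hd (d - (i : ℕ) + e)
    omega
  have h2 : ∀ i : Fin e, ∃ g ∈ rightBoxes x, (g.comp : ℤ) = p (d - (i : ℕ)) ∧
      content x g = d - (i : ℕ) := fun i => by
    have h3 := h1 i
    obtain ⟨g, hg, hgc, hgd⟩ := exists_rightBox (x := x) (j := ⟨(p (d - (i : ℕ))).toNat, by omega⟩)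
      (d := d - (i : ℕ)) (by
        rw [← mem_cover_zero (m := e)]
        simp only [Int.toNat_of_nonneg h3.1]
        exact hp.2 _)
    refine ⟨g, hg, ?_, hgd⟩
    rw [hgc]
    simp only [Int.toNat_of_nonneg h3.1]
  choose X hX hX1 hX2 using h2
  exact ⟨X, hper, hp.1, hX, fun i => by rw [hX2, hX1], d, hX2⟩

/-! ### Good strips -/

/-- The good strips are the traces of the successive minimal paths. -/
theorem isGoodSequence_iff (he : 0 < e) (hl : 0 < ℓ) {X : ℕ → Fin e → Box ℓ} :
    IsGoodSequence x X ↔ ∀ k, IsTrace e x (X k) (nthPath (cover e x) k) := by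
  have hA := isConfig_cover he hl x
  have he' : (0 : ℤ) < e := by omega
  have hl' : (0 : ℤ) < ℓ := by omega
  have avail : ∀ (X : ℕ → Fin e → Box ℓ) k, (∀ k' < k, IsTrace e x (X k') (nthPath (cover e x) k')) →
      ∀ Y, Y ∈ availableStrips x X k → ∃ q, IsTrace e x Y q ∧ ∀ c, nthPath (cover e x) k c ≤ q c := by
    rintro X k hX Y ⟨hY, hY'⟩
    obtain ⟨q, hq⟩ := exists_isTrace_of_mem_strips he hY
    refine ⟨q, hq, hA.nthPath_le he' hl' (hq.isPath he) fun k' hk' c => ?_⟩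
    exact ((hX k' hk').disjoint_iff he hq).1 (hY' k' hk').2 c |>.symm
  have mem : ∀ (X : ℕ → Fin e → Box ℓ) k, (∀ k' < k, IsTrace e x (X k') (nthPath (cover e x) k')) →
      ∀ Z, IsTrace e x Z (nthPath (cover e x) k) → Z ∈ availableStrips x X k := by
    intro X k hX Z hZ
    refine ⟨hZ.mem_strips, fun k' hk' => ⟨(hX k' hk').stripLT he hZ
      (fun c => (hA.nthPath_lt he' hl' hk' c).le) fun heq => ?_,
      ((hX k' hk').disjoint_iff he hZ).2 fun c => (hA.nthPath_lt he' hl' hk' c).ne⟩⟩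
    rw [heq] at hZ
    have := congrFun (hZ.path_unique he (hX k' hk')) 0
    exact (hA.nthPath_lt he' hl' hk' 0).ne' this
  constructor
  · intro h k
    induction k using Nat.strong_induction_on with
    | _ k ih =>
      obtain ⟨Z, hZ⟩ := exists_isTrace_of_isPath hl (hA.nthPath_isPath he' hl' k)
        (hA.nthPath_greedy he' hl' k).periodic
      by_contra hne
      have hZX : Z ≠ X k := fun heq => hne (heq ▸ hZ)
      obtain ⟨q, hq, hle⟩ := avail X k ih (X k) (h k).1
      exact (((h k).2 Z (mem X k ih Z hZ) hZX).asymm (hZ.stripLT he hq hle hZX.symm))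
  · intro h k
    refine ⟨mem X k (fun k' _ => h k') _ (h k), fun Y hY hne => ?_⟩
    obtain ⟨q, hq, hle⟩ := avail X k (fun k' _ => h k') Y hY
    exact (h k).stripLT he hq hle hne

theorem exists_isGoodSequence (he : 0 < e) (hl : 0 < ℓ) (x : ChargedPartition ℓ) :
    ∃ X : ℕ → Fin e → Box ℓ, IsGoodSequence x X := by
  have hA := isConfig_cover he hl x
  have he' : (0 : ℤ) < e := by omega
  have hl' : (0 : ℤ) < ℓ := by omega
  choose X hX using fun k => exists_isTrace_of_isPath hl (hA.nthPath_isPath he' hl' k)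
    (hA.nthPath_greedy he' hl' k).periodic
  exact ⟨X, (isGoodSequence_iff he hl).2 hX⟩

theorem IsTrace.mem_boxBeads {X : Fin e → Box ℓ} {p : ℤ → ℤ} (h : IsTrace e x X p) (he : 0 < e)
    {j : Fin ℓ} {d : ℤ} : (j, d) ∈ boxBeads x (Set.range X) ↔ (j : ℤ) = p d := by
  constructor
  · rintro ⟨_, ⟨i, rfl⟩, hi⟩
    simp only [Prod.mk.injEq] at hi
    rw [← hi.1, ← hi.2, h.eq]
  · intro hj
    have := j.isLt
    obtain ⟨i, hi⟩ := h.exists_eq he (c := d) (by omega) (by omega)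
    refine ⟨X i, ⟨i, rfl⟩, ?_⟩
    have h1 := h.eq i
    rw [hi, ← hj] at h1
    simp only [Prod.mk.injEq, hi, and_true]
    exact Fin.ext (by omega)

theorem IsTrace.abacus_eq_iff {X : Fin e → Box ℓ} {p : ℤ → ℤ} (h : IsTrace e x X p) (he : 0 < e)
    (hl : 0 < ℓ) : abacus y = shiftBeads (abacus x) (boxBeads x (Set.range X)) ↔
      cover e y = push (cover e x) p := by
  have key : ∀ (j : Fin ℓ) (d k : ℤ), (d + k * e, (j : ℤ) + k * ℓ) ∈ push (cover e x) p ↔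
      (j, d) ∈ shiftBeads (abacus x) (boxBeads x (Set.range X)) := fun j d k => by
    have h1 : (j : ℤ) + k * ℓ = p (d + k * e) ↔ (j : ℤ) = p d := by
      rw [h.periodic.add_mul]; omega
    have h2 : (j : ℤ) + k * ℓ = p (d + k * e - 1) ↔ (j : ℤ) = p (d - 1) := by
      rw [show d + k * e - 1 = d - 1 + k * e by ring, h.periodic.add_mul]; omega
    simp only [shiftBeads, Set.mem_ofPred_eq, h.mem_boxBeads he, mem_push, mem_cover, ne_eq, h1, h2]
  constructor
  · intro hy
    ext ⟨c, r⟩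
    obtain ⟨j, k, rfl⟩ := exists_fin_add_mul hl r
    have h1 := key j (c - k * e) k
    have h2 := mem_cover (x := y) (m := e) (j := j) (d := c - k * e) (k := k)
    rw [sub_add_cancel] at h1 h2
    rw [h1, h2, hy]
  · intro hy
    ext ⟨j, d⟩
    rw [← key j d 0, ← hy, mem_cover]

/-- Greediness makes the strip addable: if the position to the right of a bead of the path is
occupied, then by the bead of the path in the next column, which is pushed as well. -/
theorem IsTrace.addBoxes_iff {X : Fin e → Box ℓ} {p : ℤ → ℤ} (h : IsTrace e x X p) (he : 0 < e)
    (hl : 0 < ℓ) (hp : IsGreedy e ℓ (cover e x) p) :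
    AddBoxes x (Set.range X) y ↔ cover e y = push (cover e x) p := by
  have hX : Set.range X ⊆ rightBoxes x := Set.range_subset_iff.2 h.mem
  rw [← h.abacus_eq_iff he hl]
  refine ⟨fun h' => h'.abacus_eq hX, fun h' => addBoxes_of_abacus_eq hX (Set.finite_range X) ?_ h'⟩
  rintro _ ⟨i, rfl⟩ hmem
  rw [h.mem_boxBeads he]
  rw [← mem_cover_zero (m := e), ← h.eq] at hmem
  rw [← h.eq]
  have h1 := hp.gap (content x (X i) + 1) (p (content x (X i))) (by simp)
  have h2 := h.mono (show content x (X i) ≤ content x (X i) + 1 by omega)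
  by_contra hne
  exact h1 (by omega) hmem

/-! ### The steps in the definition of the map that adds good strips. -/

theorem partialMap_eq_some {α : Type*} {r : α → α → Prop} {a b : α} (h : r a b)
    (hu : ∀ b', r a b' → b' = b) : partialMap r a = some b := by
  have h' : ∃ b, r a b := ⟨b, h⟩
  rw [partialMap, dif_pos h', hu _ h'.choose_spec]

theorem rel_of_partialMap_eq_some {α : Type*} {r : α → α → Prop} {a b : α}
    (h : partialMap r a = some b) : r a b := by
  unfold partialMap at h
  split_ifs at h with h'
  rw [← Option.some.inj h]
  exact h'.choose_spec

theorem partialMap_eq_none_iff {α : Type*} {r : α → α → Prop} {a : α} :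
    partialMap r a = none ↔ ¬ ∃ b, r a b := by
  unfold partialMap
  split_ifs with h <;> simp [h]

variable {s : ℤ}

theorem exists_addGoodStrip_eq_some (he : 0 < e) (hl : 0 < ℓ) {k : ℕ} (x : Basis ℓ s)
    (hk : IsGreedy e ℓ (cover e x.1) (nthPath (cover e x.1) k)) :
    ∃ y : Basis ℓ s, y.1.charge = x.1.charge ∧ cover e y.1 = step k (cover e x.1) ∧
      addGoodStrip e k x = some y := by
  have hA := isConfig_cover he hl x.1
  obtain ⟨y, hy⟩ := exists_cover_eq he hl (hA.push hk.periodic)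
  obtain ⟨X, hX⟩ := exists_isGoodSequence he hl x.1
  have hadd := (((isGoodSequence_iff he hl).1 hX k).addBoxes_iff he hl hk).2 hy
  refine ⟨⟨y, by rw [hadd.1]; exact x.2⟩, hadd.1, hy, partialMap_eq_some ⟨X, hX, hadd⟩ ?_⟩
  rintro y' ⟨X', hX', hadd'⟩
  have h1 := (((isGoodSequence_iff he hl).1 hX' k).addBoxes_iff he hl hk).1 hadd'
  exact Subtype.ext (cover_injective (h1.trans hy.symm))

theorem exists_addGoodStripTimes_eq_some (he : 0 < e) (hl : 0 < ℓ) {k : ℕ} (n : ℕ) (x : Basis ℓ s)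
    (hk : HasSlack e ℓ k n (cover e x.1)) :
    ∃ y : Basis ℓ s, y.1.charge = x.1.charge ∧ cover e y.1 = (step k)^[n] (cover e x.1) ∧
      addGoodStripTimes e k n x = some y := by
  induction n with
  | zero => exact ⟨x, rfl, rfl, rfl⟩
  | succ n ih =>
    obtain ⟨y, h1, h2, h3⟩ := ih (hk.mono n.le_succ)
    have h4 := hk.iterate (m := n) (n := 1)
    rw [← h2] at h4
    obtain ⟨z, h5, h6, h7⟩ := exists_addGoodStrip_eq_some he hl y h4.1
    refine ⟨z, h5.trans h1, ?_, ?_⟩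
    · rw [h6, h2, Function.iterate_succ_apply']
    · rw [addGoodStripTimes, h3, Option.bind_some, h7]

theorem antitone_rowLen (sigma : YoungDiagram) : Antitone sigma.rowLen :=
  fun _ _ h => sigma.rowLen_anti _ _ h

/-- All steps in the definition of `c̃_σ` are possible. -/
theorem exists_cTilde_eq_some (he : 0 < e) (hl : 0 < ℓ) (sigma : YoungDiagram) (x : Basis ℓ s) :
    ∃ y : Basis ℓ s, y.1.charge = x.1.charge ∧
      cover e y.1 = pushAll sigma.rowLen (cover e x.1) (sigma.colLen 0) ∧
      cTilde e sigma x = some y := by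
  have hA := isConfig_cover he hl x.1
  have key : ∀ n, ∃ y : Basis ℓ s, y.1.charge = x.1.charge ∧
      cover e y.1 = pushAll sigma.rowLen (cover e x.1) n ∧
      (List.range n).foldlM (fun y k => addGoodStripTimes e k (sigma.rowLen k) y) x = some y := by
    intro n
    induction n with
    | zero => exact ⟨x, rfl, rfl, rfl⟩
    | succ n ih =>
      obtain ⟨y, h1, h2, h3⟩ := ih
      have h4 := hA.hasSlack_pushAll (by omega) (by omega) (antitone_rowLen sigma) n
      rw [← h2] at h4
      obtain ⟨z, h5, h6, h7⟩ := exists_addGoodStripTimes_eq_some he hl _ y h4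
      refine ⟨z, h5.trans h1, by rw [h6, h2]; rfl, ?_⟩
      rw [List.range_succ, List.foldlM_append, h3]
      simpa using h7
  exact key _

end

/-! ### Level-rank duality -/

section
variable {e l a b : ℤ} {A B : Set (ℤ × ℤ)}

theorem IsConfig.mem_of_orbit (hA : IsConfig e l A) {c r : ℤ} {x : ℤ × ℤ}
    (h : ∃ k, x.1 = c + k * e ∧ x.2 = r + k * l) : x ∈ A ↔ (c, r) ∈ A := by
  obtain ⟨k, h1, h2⟩ := h
  rw [← hA.add_mul c r k, ← h1, ← h2]

theorem IsConfig.exchange_symm (hA : IsConfig e l A) {c r c' r' : ℤ} (h : (c, r) ∈ A)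
    (h' : (c', r') ∉ A) : A = exchange e l (exchange e l A c r c' r') c' r' c r ∧
      (c', r') ∈ exchange e l A c r c' r' ∧ (c, r) ∉ exchange e l A c r c' r' := by
  have h1 : ∀ x : ℤ × ℤ, (∃ k, x.1 = c + k * e ∧ x.2 = r + k * l) → x ∈ A := fun x hx =>
    (hA.mem_of_orbit hx).2 h
  have h2 : ∀ x : ℤ × ℤ, (∃ k, x.1 = c' + k * e ∧ x.2 = r' + k * l) → x ∉ A := fun x hx hxA =>
    h' ((hA.mem_of_orbit hx).1 hxA)
  refine ⟨?_, Or.inr ⟨0, by simp⟩, ?_⟩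
  · ext x
    have h3 := h1 x
    have h4 := h2 x
    simp only [exchange, Set.mem_ofPred_eq]
    generalize (∃ k, x.1 = c + k * e ∧ x.2 = r + k * l) = P at h3 ⊢
    generalize (∃ k, x.1 = c' + k * e ∧ x.2 = r' + k * l) = Q at h4 ⊢
    tauto
  · rintro (⟨-, h3⟩ | h3)
    · exact h3 ⟨0, by simp⟩
    · exact h2 _ h3 h

/-- Because of the reflection and the complement, a bead of `star a b A` that moves to the right is
a bead of `A` that moves down by one row. -/
theorem IsConfig.eq_exchange_of_star (hA : IsConfig e l A) {i r : ℤ}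
    (h1 : (i, r) ∈ FockSpace.star a b A) (h2 : (i + 1, r) ∉ FockSpace.star a b A)
    (hB : FockSpace.star a b B = FockSpace.moveBead l e (FockSpace.star a b A) i r) :
    (r + a, i + 1 + b) ∈ A ∧ (r + a, i + b) ∉ A ∧
      B = exchange e l A (r + a) (i + 1 + b) (r + a) (i + b) := by
  rw [mem_star] at h1
  rw [mem_star, not_not] at h2
  refine ⟨h2, h1, ?_⟩
  ext ⟨u, v⟩
  have h3 := Set.ext_iff.1 hB (v - b, u - a)
  simp only [FockSpace.moveBead, Set.mem_ofPred_eq, mem_star, sub_add_cancel] at h3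
  simp only [exchange, Set.mem_ofPred_eq]
  have e1 : ∀ t, (∃ k, v - b = t + k * l ∧ u - a = r + k * e) ↔
      ∃ k, u = r + a + k * e ∧ v = t + b + k * l := fun t =>
    exists_congr fun k => ⟨fun h => ⟨by linarith [h.2], by linarith [h.1]⟩,
      fun h => ⟨by linarith [h.2], by linarith [h.1]⟩⟩
  rw [e1, e1] at h3
  have h4 := fun h => (hA.mem_of_orbit (x := (u, v)) (c := r + a) (r := i + 1 + b) h).2 h2
  have h5 := fun h => mt (hA.mem_of_orbit (x := (u, v)) (c := r + a) (r := i + b) h).1 h1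
  simp only at h4 h5
  generalize (∃ k, u = r + a + k * e ∧ v = i + b + k * l) = P at h3 h5 ⊢
  generalize (∃ k, u = r + a + k * e ∧ v = i + 1 + b + k * l) = Q at h3 h4 ⊢
  tauto

end

section
variable {ℓ e : ℕ} {x y : ChargedPartition ℓ} {lam : YoungDiagram} {s : ℤ}

theorem exists_decomposition (he : 0 < e) (hl : 0 < ℓ) (c : ℤ) :
    ∃ (z : ℤ) (y : Fin ℓ) (r : Fin e), c = z * (e : ℤ) * (ℓ : ℤ) - (y : ℤ) * (e : ℤ) - (r : ℤ) := by
  obtain ⟨r, k, h⟩ := exists_fin_add_mul he (-c)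
  obtain ⟨y, k', h'⟩ := exists_fin_add_mul hl k
  refine ⟨-k', y, r, ?_⟩
  rw [h'] at h
  linarith

theorem decomposition_unique {z z' : ℤ} {y y' : Fin ℓ} {r r' : Fin e}
    (h : z * (e : ℤ) * (ℓ : ℤ) - (y : ℤ) * (e : ℤ) - (r : ℤ) =
      z' * (e : ℤ) * (ℓ : ℤ) - (y' : ℤ) * (e : ℤ) - (r' : ℤ)) : z = z' ∧ y = y' ∧ r = r' := by
  obtain ⟨h1, h2⟩ := fin_add_mul_injective (j := r) (j' := r') (k := y + -z * ℓ)
    (k' := y' + -z' * ℓ) (by linarith)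
  obtain ⟨h3, h4⟩ := fin_add_mul_injective h2
  exact ⟨by omega, h3, h1⟩

theorem exists_isTau (he : 0 < e) (hl : 0 < ℓ) (x : ChargedPartition ℓ) :
    ∃ lam s, IsTau e lam s x := by
  have he' : (1 : ℤ) ≤ e := by omega
  have hl' : (1 : ℤ) ≤ ℓ := by omega
  obtain ⟨u, v, hu, hv⟩ := abacus_bounded x
  obtain ⟨lam, s, h⟩ := exists_beads_eq (M := {c | ∃ (z : ℤ) (y : Fin ℓ) (r : Fin e),
      c = z * (e : ℤ) * (ℓ : ℤ) - (y : ℤ) * (e : ℤ) - (r : ℤ) ∧ (y, (e : ℤ) * z - (r : ℤ)) ∈ abacus x})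
    (u := (|u| + e) * ℓ) (v := -(|v| + 1) * (e * ℓ)) (by
      rintro _ ⟨z, y, r, rfl, h⟩
      have h1 := hu _ h
      simp only at h1
      have h2 := r.isLt
      have h3 := le_abs_self u
      have h4 : z * e ≤ |u| + e := by linarith
      have h5 : z * e * ℓ ≤ (|u| + e) * ℓ := mul_le_mul_of_nonneg_right h4 (by omega)
      have h6 : (0 : ℤ) ≤ y * e := by positivity
      omega) (by
      intro c hc
      obtain ⟨z, y, r, rfl⟩ := exists_decomposition he hl c
      refine ⟨z, y, r, rfl, hv _ ?_⟩
      simp only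
      have h2 := r.isLt
      have h3 : ((y : ℤ) + 1) * e ≤ ℓ * e := mul_le_mul_of_nonneg_right (by have := y.isLt; omega) (by omega)
      have h4 : z * (e * ℓ) < -|v| * (e * ℓ) := by nlinarith
      have h5 : z < -|v| := lt_of_mul_lt_mul_right h4 (by positivity)
      have h6 := neg_abs_le v
      have h7 : (e : ℤ) * z ≤ z := by nlinarith [abs_nonneg v]
      omega)
  refine ⟨lam, s, fun z y r => ?_⟩
  rw [h]
  constructor
  · rintro ⟨z', y', r', h1, h2⟩
    obtain ⟨rfl, rfl, rfl⟩ := decomposition_unique h1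
    exact h2
  · exact fun h => ⟨z, y, r, rfl, h⟩

/-- In the periodic picture, `τ` only cuts the `1`-abacus into blocks of length `e` and writes each
block in a row, over the columns `0, -1, …, 1 - e`. -/
theorem IsTau.mem_cover_iff (hl : 0 < ℓ) (h : IsTau e lam s x) (R : ℤ) (r : Fin e) :
    (-(r : ℤ), R) ∈ cover e x ↔ -(e * R) - (r : ℤ) ∈ beads lam s := by
  obtain ⟨y, k, rfl⟩ := exists_fin_add_mul hl R
  have h1 := h (-k) y r
  rw [show -k * (e : ℤ) * ℓ - y * e - r = -(e * (y + k * ℓ)) - r by ring] at h1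
  rw [h1, ← mem_cover (m := e) (k := k)]
  ring_nf

/-- Conjugation takes the complement and replaces `c` by `1 - c`. The map `τ̇` reads the same blocks
with rows and columns exchanged, so the composition is the reflected complement. -/
theorem IsTau.isTauDot_iff (he : 0 < e) (hl : 0 < ℓ) (h : IsTau e lam s x)
    {xd : ChargedPartition e} : IsTauDot ℓ lam.transpose (-s) xd ↔
      cover ℓ xd = star 1 (ℓ - 1) (cover e x) := by
  have hA := isConfig_cover he hl x
  have hD := isConfig_cover hl he xd
  have hS := hA.star (by omega) (by omega) 1 (ℓ - 1)
  have key : ∀ (z : ℤ) (y : Fin ℓ) (r : Fin e),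
      (z * (e : ℤ) * (ℓ : ℤ) - (y : ℤ) * (e : ℤ) - (r : ℤ) ∈ beads lam.transpose (-s) ↔
        ((ℓ : ℤ) * z - y, (r : ℤ)) ∈ star 1 (ℓ - 1) (cover e x)) := by
    intro z y r
    rw [mem_beads_transpose, mem_star]
    -- If `c` has remainder `r`, then `1 - c` has remainder `e - 1 - r` and lies in row `ℓ z - y -
    -- 1`. A translation by `(e, ℓ)` moves it to column `r + 1` and row `ℓ z - y + (ℓ - 1)`, which
    -- explains the shifts `1` and `ℓ - 1`.
    have h1 := h.mem_cover_iff hl (ℓ * z - y - 1) ⟨e - 1 - r, by omega⟩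
    have h2 : (((e - 1 - (r : ℕ) : ℕ) : ℕ) : ℤ) = e - 1 - r := by have := r.isLt; omega
    simp only [h2] at h1
    rw [show -((e : ℤ) * (ℓ * z - y - 1)) - (e - 1 - r) = 1 - (z * e * ℓ - y * e - r) by ring,
      ← hA.periodic] at h1
    rw [← h1, show -((e : ℤ) - 1 - r) + e = r + 1 by ring,
      show (ℓ : ℤ) * z - y - 1 + ℓ = ℓ * z - y + (ℓ - 1) by ring]
  constructor
  · intro hd
    ext ⟨c, R⟩
    obtain ⟨r, k, rfl⟩ := exists_fin_add_mul he R
    obtain ⟨y, z, hyz⟩ := exists_fin_add_mul hl (-(c - k * ℓ))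
    have h1 : (c - k * ℓ) = ℓ * -z - y := by linarith
    have h2 := hD.add_mul (c - k * ℓ) r k
    have h3 := hS.add_mul (c - k * ℓ) r k
    rw [sub_add_cancel] at h2 h3
    rw [h2, h3, h1, mem_cover_zero, ← hd (-z) y r, key]
  · intro hd z y r
    rw [key, ← hd, mem_cover_zero]

theorem isLevelRankDual_iff (he : 0 < e) (hl : 0 < ℓ) {xd : ChargedPartition e} :
    IsLevelRankDual x xd ↔ cover ℓ xd = star 1 (ℓ - 1) (cover e x) := by
  constructor
  · rintro ⟨lam, s, h1, h2⟩
    exact (h1.isTauDot_iff he hl).1 h2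
  · intro h
    obtain ⟨lam, s, h1⟩ := exists_isTau he hl x
    exact ⟨lam, s, h1, (h1.isTauDot_iff he hl).2 h⟩

theorem exists_isLevelRankDual (he : 0 < e) (hl : 0 < ℓ) (x : ChargedPartition ℓ) :
    ∃ xd : ChargedPartition e, IsLevelRankDual x xd := by
  obtain ⟨xd, h⟩ := exists_cover_eq hl he
    ((isConfig_cover he hl x).star (by omega) (by omega) 1 (ℓ - 1))
  exact ⟨xd, (isLevelRankDual_iff he hl).2 h⟩

theorem exists_isLevelRankDual' (he : 0 < e) (hl : 0 < ℓ) (xd : ChargedPartition e) :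
    ∃ x : ChargedPartition ℓ, IsLevelRankDual x xd := by
  obtain ⟨x, h⟩ := exists_cover_eq he hl
    ((isConfig_cover hl he xd).star (by omega) (by omega) (1 - ℓ) (-1))
  refine ⟨x, (isLevelRankDual_iff he hl).2 ?_⟩
  rw [h]
  ext ⟨c, r⟩
  rw [mem_star, mem_star, not_not, show c + ((ℓ : ℤ) - 1) + (1 - ℓ) = c by ring,
    show r + 1 + -1 = r by ring]

theorem star_injective {a b : ℤ} {A B : Set (ℤ × ℤ)} (h : star a b A = star a b B) : A = B := by
  ext ⟨u, v⟩
  have := Set.ext_iff.1 h (v - b, u - a)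
  simp only [mem_star, sub_add_cancel] at this
  exact not_iff_not.1 this

theorem dual_raisesTo_iff (he : 0 < e) (hl : 0 < ℓ) {j : ℤ} :
    (∃ xd yd : ChargedPartition e, IsLevelRankDual x xd ∧ IsLevelRankDual y yd ∧
      RaisesTo ℓ (j : ZMod ℓ) xd yd) ↔ DualRel e ℓ 1 (ℓ - 1) j (cover e x) (cover e y) := by
  simp only [isLevelRankDual_iff he hl, raisesTo_iff hl he, DualRel]
  constructor
  · rintro ⟨xd, yd, h1, h2, h3⟩
    rwa [← h1, ← h2]
  · intro h
    obtain ⟨xd, hx⟩ := exists_isLevelRankDual he hl x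
    obtain ⟨yd, hy⟩ := exists_isLevelRankDual he hl y
    rw [isLevelRankDual_iff he hl] at hx hy
    exact ⟨xd, yd, hx, hy, by rwa [hx, hy]⟩

theorem dual_lowersTo_iff (he : 0 < e) (hl : 2 ≤ ℓ) {j : ℤ} :
    (∃ xd yd : ChargedPartition e, IsLevelRankDual x xd ∧ IsLevelRankDual y yd ∧
      LowersTo ℓ (j : ZMod ℓ) xd yd) ↔ DualRel e ℓ 1 (ℓ - 1) j (cover e y) (cover e x) := by
  rw [← dual_raisesTo_iff he (by omega)]
  simp only [lowersTo_iff hl he]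
  constructor
  · rintro ⟨xd, yd, h1, h2, h3⟩
    exact ⟨yd, xd, h2, h1, h3⟩
  · rintro ⟨xd, yd, h1, h2, h3⟩
    exact ⟨yd, xd, h2, h1, h3⟩

/-! ### Moves of beads and the sum of the charges -/

open Classical in
theorem exists_ncard_abacus (x : ChargedPartition ℓ) : ∃ K₀ : ℤ, ∀ K, K₀ ≤ K →
    {p | p ∈ abacus x ∧ -K < p.2}.Finite ∧
    ({p | p ∈ abacus x ∧ -K < p.2}.ncard : ℤ) = ∑ j, (x.charge j + K) := by
  choose K₀ hK₀ using fun j => exists_ncard_beads (x.shape j) (x.charge j)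
  refine ⟨∑ j, |K₀ j|, fun K hK => ?_⟩
  have h1 : ∀ j, K₀ j ≤ K := fun j => (le_abs_self _).trans
    ((Finset.single_le_sum (f := fun j => |K₀ j|) (fun _ _ => abs_nonneg _)
      (Finset.mem_univ j)).trans hK)
  let T : Fin ℓ → Finset ℤ := fun j => (hK₀ j K (h1 j)).1.toFinset
  let F : Finset (Σ _ : Fin ℓ, ℤ) := Finset.univ.sigma T
  have h2 : {p | p ∈ abacus x ∧ -K < p.2} = (fun q : Σ _ : Fin ℓ, ℤ => (q.1, q.2)) '' F := by
    ext ⟨j, d⟩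
    simp only [Set.mem_ofPred_eq, Set.mem_image, Prod.mk.injEq]
    constructor
    · rintro ⟨h3, h4⟩
      exact ⟨⟨j, d⟩, by simpa [F, T] using ⟨h3, h4⟩, rfl, rfl⟩
    · rintro ⟨⟨j', d'⟩, h3, rfl, rfl⟩
      simp only [F, T, Finset.coe_sigma, Set.mem_sigma_iff, Set.Finite.coe_toFinset] at h3
      exact h3.2
  rw [h2]
  refine ⟨F.finite_toSet.image _, ?_⟩
  rw [Set.ncard_image_of_injective _ (by
    rintro ⟨j, d⟩ ⟨j', d'⟩ h
    simp only [Prod.mk.injEq] at h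
    rw [h.1, h.2]), Set.ncard_coe_finset, Finset.card_sigma]
  push_cast
  refine Finset.sum_congr rfl fun j _ => ?_
  rw [← (hK₀ j K (h1 j)).2, Set.ncard_eq_toFinset_card _ (hK₀ j K (h1 j)).1]

/-- The sum of the charges counts the beads to the right of a position far to the left, and
replacing one bead by another keeps the count. The dual operators may change individual charges, but
for this reason they stay inside `B_s`. -/
theorem sum_charge_eq {p q : Fin ℓ × ℤ} (hq : q ∈ abacus x) (hp : p ∉ abacus x)
    (h : abacus y = insert p (abacus x \ {q})) : ∑ j, y.charge j = ∑ j, x.charge j := by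
  obtain ⟨K₁, h1⟩ := exists_ncard_abacus x
  obtain ⟨K₂, h2⟩ := exists_ncard_abacus y
  obtain ⟨K, hK⟩ : ∃ K, K = max (max K₁ K₂) (max (1 - p.2) (1 - q.2)) := ⟨_, rfl⟩
  have hxK := h1 K (by omega)
  have hyK := h2 K (by omega)
  have h3 : {t | t ∈ abacus y ∧ -K < t.2} = insert p ({t | t ∈ abacus x ∧ -K < t.2} \ {q}) := by
    ext t
    rw [h]
    simp only [Set.mem_ofPred_eq, Set.mem_insert_iff, Set.mem_sdiff, Set.mem_singleton_iff]
    constructor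
    · tauto
    · rintro (rfl | h4)
      · exact ⟨Or.inl rfl, by omega⟩
      · tauto
  have h4 : q ∈ {t | t ∈ abacus x ∧ -K < t.2} := ⟨hq, by omega⟩
  rw [h3, Set.ncard_exchange (fun h => hp h.1) h4, hxK.2] at hyK
  simp only [Finset.sum_add_distrib, add_left_inj] at hyK
  exact hyK.2.symm

/-- The linear form `ℓ c - e r` is invariant under the translation by `(e, ℓ)`, so it can be read
off on the abacus. -/
theorem cover_exchange (hl : 0 < ℓ) {c r c' r' : ℤ}
    (h : cover e y = exchange e ℓ (cover e x) c r c' r') : ∃ q p : Fin ℓ × ℤ,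
      (q ∈ abacus x ↔ (c, r) ∈ cover e x) ∧ (p ∈ abacus x ↔ (c', r') ∈ cover e x) ∧
      abacus y = insert p (abacus x \ {q}) ∧ ℓ * q.2 - e * (q.1 : ℤ) = ℓ * c - e * r ∧
      ℓ * p.2 - e * (p.1 : ℤ) = ℓ * c' - e * r' := by
  obtain ⟨j, k, rfl⟩ := exists_fin_add_mul hl r
  obtain ⟨j', k', rfl⟩ := exists_fin_add_mul hl r'
  refine ⟨(j, c - k * e), (j', c' - k' * e), ?_, ?_, ?_, by simp only; ring, by simp only; ring⟩
  · rw [← mem_cover (m := e) (k := k), sub_add_cancel]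
  · rw [← mem_cover (m := e) (k := k'), sub_add_cancel]
  · rw [← cover_eq_exchange_iff (m := e) (k := k) (k' := k') hl, sub_add_cancel, sub_add_cancel, h]

end

/-! ### Periods of highest weight vertices -/

section
variable {ℓ e : ℕ} {x y : ChargedPartition ℓ}

theorem IsFirstPeriod.unique {A : Set (Fin ℓ × ℤ)} {P P' : Fin e → Fin ℓ × ℤ}
    (h : IsFirstPeriod A P) (h' : IsFirstPeriod A P') : P = P' := by
  obtain ⟨h1, h2, h3, -, h5⟩ := h
  obtain ⟨h1', h2', h3', -, h5'⟩ := h'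
  have key : ∀ (n : ℕ) (hn : n < e), (P ⟨n, hn⟩).2 = (P' ⟨n, hn⟩).2 := by
    intro n
    induction n with
    | zero =>
      intro hn
      exact le_antisymm (h2' _ rfl _ (h1 _)) (h2 _ rfl _ (h1' _))
    | succ n ih =>
      intro hn
      have := h3 ⟨n, by omega⟩ ⟨n + 1, hn⟩ rfl
      have := h3' ⟨n, by omega⟩ ⟨n + 1, hn⟩ rfl
      have := ih (by omega)
      omega
  funext i
  have hi := key i i.isLt
  exact Prod.ext (le_antisymm (h5 i _ (h1' i) hi.symm) (h5' i _ (h1 i) hi)) hi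

theorem IsPeriodSequence.unique {A : Set (Fin ℓ × ℤ)} {P P' : ℕ → Fin e → Fin ℓ × ℤ}
    (h : IsPeriodSequence A P) (h' : IsPeriodSequence A P') : P = P' := by
  funext k
  induction k using Nat.strong_induction_on with
  | _ k ih =>
    refine (h k).unique ?_
    have := h' k
    rwa [show {p | p ∈ A ∧ ∀ k' < k, p ∉ Set.range (P' k')} =
      {p | p ∈ A ∧ ∀ k' < k, p ∉ Set.range (P k')} by
        ext p
        exact and_congr_right fun _ => forall₂_congr fun k' hk' => by rw [ih k' hk']] at this

/-- The periods of a highest weight vertex are the good strips, and pushing its paths shifts the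
periods. -/
theorem exists_isPeriodSequence (he : 0 < e) (hl : 0 < ℓ) (h : IsHighest (cover e x)) :
    ∃ P : ℕ → Fin e → Fin ℓ × ℤ, IsPeriodSequence (abacus x) P ∧
      ∀ (f : ℕ → ℕ) (n : ℕ) (y : ChargedPartition ℓ), Antitone f → (∀ k, n ≤ k → f k = 0) →
        cover e y = pushAll f (cover e x) n →
        abacus y = {p | ∃ k i, p = ((P k i).1, (P k i).2 + (f k : ℤ))} := by
  have hA := isConfig_cover he hl x
  have he' : (0 : ℤ) < e := by omega
  have hl' : (0 : ℤ) < ℓ := by omega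
  obtain ⟨X, hX⟩ := exists_isGoodSequence he hl x
  rw [isGoodSequence_iff he hl] at hX
  have hrange : ∀ k (p : Fin ℓ × ℤ), (∃ i, ((X k i).comp, content x (X k i)) = p) ↔
      (p.1 : ℤ) = nthPath (cover e x) k p.2 := fun k p => by
    rw [← (hX k).mem_boxBeads he]
    exact ⟨fun ⟨i, hi⟩ => ⟨X k i, ⟨i, rfl⟩, hi⟩, fun ⟨_, ⟨i, rfl⟩, hi⟩ => ⟨i, hi⟩⟩
  refine ⟨fun k i => ((X k i).comp, content x (X k i)), fun k => ?_, fun f n y hf hn hy => ?_⟩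
  · have hmem : ∀ p : Fin ℓ × ℤ, p ∈ {p | p ∈ abacus x ∧ ∀ k' < k, p ∉ Set.range
        fun i => ((X k' i).comp, content x (X k' i))} ↔ (p.2, (p.1 : ℤ)) ∈ peel^[k] (cover e x) :=
      fun p => by
        rw [mem_iterate_peel, mem_cover_zero]
        refine and_congr_right fun _ => forall₂_congr fun k' hk' => not_congr ?_
        exact hrange k' p
    -- For a highest weight vertex, the `k`-th path runs through the lowest bead of each column of
    -- what is left. This gives both the extremal column and the extremal rows in the definition of
    -- a period.
    have hle : ∀ p ∈ {p | p ∈ abacus x ∧ ∀ k' < k, p ∉ Set.range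
        fun i => ((X k' i).comp, content x (X k' i))}, nthPath (cover e x) k p.2 ≤ (p.1 : ℤ) :=
      fun p hp => h.nthPath_le hA he' hl' ((hmem p).1 hp)
    obtain ⟨d, hd⟩ := (hX k).consecutive
    refine ⟨fun i => ?_, fun i hi p hp => ?_, fun i i' hi => ?_, fun i i' hi => ?_, fun i p hp hpi => ?_⟩
    · rw [hmem, mem_iterate_peel, mem_cover_zero]
      refine ⟨content_mem_abacus ((hX k).mem i), fun k' hk' => ?_⟩
      simp only
      rw [← (hX k).eq]
      exact hA.nthPath_ne he' hl' hk' _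
    · have h1 := (hle p hp).trans_lt (show (p.1 : ℤ) < ℓ by have := p.1.isLt; omega)
      rw [(hX k).lt_iff he hd] at h1
      simp only
      rw [hd, hi]
      simpa using h1
    · simp only
      rw [hd, hd]
      omega
    · exact (hX k).mem_strips.2.1.2 i i' hi
    · have h1 := hle p hp
      rw [hpi] at h1
      simp only at h1 ⊢
      rw [(hX k).eq] at h1
      rw [Fin.le_def]
      omega
  · ext ⟨j, d⟩
    rw [← mem_cover_zero (m := e), hy, h.mem_pushAll hA he' hl' hf hn]
    refine exists_congr fun k => ?_
    rw [← hrange k (j, d - f k)]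
    refine exists_congr fun i => ?_
    rw [Prod.mk.injEq, Prod.mk.injEq]
    constructor
    · rintro ⟨h1, h2⟩
      exact ⟨h1.symm, by simp only; omega⟩
    · rintro ⟨h1, h2⟩
      exact ⟨h1.symm, by simp only at h2; omega⟩

end

/-! ### Descent along moves of beads -/

section
variable {ℓ e : ℕ} {x y : ChargedPartition ℓ}

/-- The position of a bead on the `1`-abacus, up to reordering within windows. -/
def weight (e : ℕ) (p : Fin ℓ × ℤ) : ℤ := ℓ * p.2 - e * (p.1 : ℤ)

/-- A bead of `y` has been replaced by a bead in a position of smaller weight. -/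
def Descends (e : ℕ) (y x : ChargedPartition ℓ) : Prop :=
  ∃ q ∈ abacus y, ∃ p ∉ abacus y, abacus x = insert p (abacus y \ {q}) ∧ weight e p < weight e q

theorem Descends.sum_charge_eq (h : Descends e y x) : ∑ j, x.charge j = ∑ j, y.charge j := by
  obtain ⟨q, hq, p, hp, h, -⟩ := h
  exact FockSpace.sum_charge_eq hq hp h

theorem finite_weight_gt (hl : 0 < ℓ) (K : ℤ) : {p | p ∈ abacus x ∧ -K < weight e p}.Finite := by
  obtain ⟨u, -, hu, -⟩ := abacus_bounded x
  refine (Set.finite_univ.prod (Set.finite_Icc (-|K|) u)).subset fun p hp => ?_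
  refine Set.mk_mem_prod (Set.mem_univ _) ⟨?_, hu _ hp.1⟩
  have h1 := hp.2
  unfold weight at h1
  have h2 : (0 : ℤ) ≤ e * (p.1 : ℤ) := by positivity
  by_contra! hlt
  have h3 : (1 : ℤ) ≤ ℓ := by omega
  have h4 := le_abs_self K
  nlinarith [abs_nonneg K]

theorem exists_weight_filled (hl : 0 < ℓ) (x : ChargedPartition ℓ) :
    ∃ K, ∀ p, weight e p ≤ -K → p ∈ abacus x := by
  obtain ⟨-, v, -, hv⟩ := abacus_bounded x
  refine ⟨|v| * ℓ + e * ℓ, fun p hp => hv p ?_⟩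
  unfold weight at hp
  have h1 : (e : ℤ) * p.1 ≤ e * ℓ := by
    have := p.1.isLt
    exact mul_le_mul_of_nonneg_left (by omega) (by omega)
  have h2 : (ℓ : ℤ) * p.2 ≤ ℓ * -|v| := by linarith
  have h3 := le_of_mul_le_mul_left h2 (by omega)
  have h4 := neg_abs_le v
  omega

/-- Induction along moves of beads that decrease the weight. -/
theorem descent_induction (hl : 0 < ℓ) {P : ChargedPartition ℓ → Prop}
    (h : ∀ y, (∀ x, Descends e y x → P x) → P y) (x : ChargedPartition ℓ) : P x := by
  classical
  obtain ⟨K, hK⟩ := exists_weight_filled (e := e) hl x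
  -- All positions of weight at most `-K` are occupied and stay occupied, since vacancies are filled
  -- by beads of larger weight. The sum of the shifted weights of the finitely many other beads
  -- decreases with each move.
  have key : ∀ (n : ℕ) (y : ChargedPartition ℓ), (∀ p, weight e p ≤ -K → p ∈ abacus y) →
      ∑ p ∈ (finite_weight_gt (e := e) (x := y) hl K).toFinset, (weight e p + K).toNat = n → P y := by
    intro n
    induction n using Nat.strong_induction_on with
    | _ n ih =>
      intro y hy hn
      refine h y fun z hz => ?_
      obtain ⟨q, hq, p, hp, hz, hlt⟩ := hz
      have hpK : -K < weight e p := by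
        by_contra! hle
        exact hp (hy p hle)
      refine ih _ ?_ z (fun t ht => ?_) rfl
      · have hT : (finite_weight_gt (e := e) (x := z) hl K).toFinset =
            insert p ((finite_weight_gt (e := e) (x := y) hl K).toFinset.erase q) := by
          ext t
          simp only [Set.Finite.mem_toFinset, Set.mem_ofPred_eq, hz, Set.mem_insert_iff,
            Set.mem_sdiff, Set.mem_singleton_iff, Finset.mem_insert, Finset.mem_erase]
          constructor
          · tauto
          · rintro (rfl | h4)
            · exact ⟨Or.inl rfl, hpK⟩
            · tauto
        have hpT : p ∉ (finite_weight_gt (e := e) (x := y) hl K).toFinset.erase q := by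
          simp [hp]
        have hqT : q ∈ (finite_weight_gt (e := e) (x := y) hl K).toFinset := by
          simp only [Set.Finite.mem_toFinset]
          exact ⟨hq, hpK.trans hlt⟩
        rw [hT, Finset.sum_insert hpT, ← hn, ← Finset.add_sum_erase _ _ hqT]
        omega
      · rw [hz]
        refine Or.inr ⟨hy t ht, ?_⟩
        rintro rfl
        omega
  exact key _ x hK rfl

end

/-! ### The crystal operators in terms of configurations -/

section
variable {e l a b : ℤ} {A B B' : Set (ℤ × ℤ)}

/-- A bead and its translates are moved to vacant positions of larger weight. -/
def IsRaise (e l : ℤ) (A B : Set (ℤ × ℤ)) : Prop :=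
  ∃ c r c' r', (c, r) ∈ A ∧ (c', r') ∉ A ∧ B = exchange e l A c r c' r' ∧ l * c - e * r < l * c' - e * r'

theorem AddRel.isRaise (hl : 0 < l) {i : ℤ} (h : AddRel e l i A B) : IsRaise e l A B := by
  obtain ⟨r, hr, hB⟩ := h
  exact ⟨i, r, i + 1, r, hr.mem, hr.notMem, hB, by linarith⟩

/-- In `A` a bead moves down by one row, so its weight grows by `e`. Thus both crystals raise the
same weight, and one descent serves for both. -/
theorem DualRel.isRaise (he : 0 < e) (hA : IsConfig e l A) {j : ℤ}
    (h : DualRel e l a b j A B) : IsRaise e l A B := by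
  obtain ⟨r, hr, h⟩ := h
  obtain ⟨h1, h2, h3⟩ := hA.eq_exchange_of_star hr.mem hr.notMem h
  exact ⟨_, _, _, _, h1, h2, h3, by linarith⟩

theorem AddRel.right_unique {i : ℤ} (h : AddRel e l i A B) (h' : AddRel e l i A B') : B = B' := by
  obtain ⟨r, hr, rfl⟩ := h
  obtain ⟨r', hr', rfl⟩ := h'
  rw [hr.unique hr']

theorem AddRel.left_unique (he : 2 ≤ e) {i : ℤ} (hB : IsConfig e l B) (hB' : IsConfig e l B')
    (h : AddRel e l i B A) (h' : AddRel e l i B' A) : B = B' := by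
  obtain ⟨r, hr, hA⟩ := h
  obtain ⟨r', hr', hA'⟩ := h'
  have h1 := (isRemRow_moveBead (l := l) he hr.mem hr.notMem).2 hr
  have h2 := (isRemRow_moveBead (l := l) he hr'.mem hr'.notMem).2 hr'
  rw [← hA] at h1
  rw [← hA'] at h2
  obtain rfl := h1.unique h2
  rw [(hB.exchange_symm hr.mem hr.notMem).1, (hB'.exchange_symm hr'.mem hr'.notMem).1,
    ← moveBead_eq_exchange, ← moveBead_eq_exchange, ← hA, ← hA']

end

section
variable {ℓ e : ℕ} {s : ℤ}

theorem IsRaise.descends (he : 0 < e) (hl : 0 < ℓ) {x y : ChargedPartition ℓ}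
    (h : IsRaise e ℓ (cover e x) (cover e y)) : Descends e y x := by
  obtain ⟨c, r, c', r', h1, h2, h3, h4⟩ := h
  obtain ⟨h5, h6, h7⟩ := (isConfig_cover he hl x).exchange_symm h1 h2
  rw [← h3] at h5 h6 h7
  obtain ⟨q, p, hq, hp, hx, hwq, hwp⟩ := cover_exchange hl h5
  exact ⟨q, hq.2 h6, p, fun h => h7 (hp.1 h), hx, by rw [weight, weight]; omega⟩

theorem exists_raisesTo_basis_iff (he : 0 < e) (hl : 0 < ℓ) {i : ℤ} {x : Basis ℓ s} :
    (∃ y : Basis ℓ s, RaisesTo e (i : ZMod e) x.1 y.1) ↔ ∃ r, IsAddRow (cover e x.1) i r := by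
  rw [← exists_raisesTo_iff he hl]
  exact ⟨fun ⟨y, hy⟩ => ⟨y.1, hy⟩, fun ⟨y, hy⟩ => ⟨⟨y, by rw [hy.charge_eq]; exact x.2⟩, hy⟩⟩

theorem exists_lowersTo_basis_iff (he : 2 ≤ e) (hl : 0 < ℓ) {i : ℤ} {x : Basis ℓ s} :
    (∃ y : Basis ℓ s, LowersTo e (i : ZMod e) x.1 y.1) ↔ ∃ r, IsRemRow (cover e x.1) i r := by
  rw [← exists_lowersTo_iff he hl]
  refine ⟨fun ⟨y, hy⟩ => ⟨y.1, hy⟩, fun ⟨y, hy⟩ => ⟨⟨y, ?_⟩, hy⟩⟩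
  rw [← ((lowersTo_iff he hl).1 hy).charge_eq]
  exact x.2

theorem exists_dual_raisesTo_iff (he : 0 < e) (hl : 0 < ℓ) {j : ℤ} {x : Basis ℓ s} :
    (∃ y : Basis ℓ s, ∃ xd yd : ChargedPartition e, IsLevelRankDual x.1 xd ∧
      IsLevelRankDual y.1 yd ∧ RaisesTo ℓ (j : ZMod ℓ) xd yd) ↔
      ∃ r, IsAddRow (star 1 (ℓ - 1) (cover e x.1)) j r := by
  constructor
  · rintro ⟨y, hy⟩
    obtain ⟨r, hr, -⟩ := (dual_raisesTo_iff he hl).1 hy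
    exact ⟨r, hr⟩
  · intro h
    obtain ⟨xd, hx⟩ := exists_isLevelRankDual he hl x.1
    rw [← (isLevelRankDual_iff he hl).1 hx, ← exists_raisesTo_iff hl he] at h
    obtain ⟨yd, hd⟩ := h
    obtain ⟨y, hy⟩ := exists_isLevelRankDual' he hl yd
    have hxy : ∃ xd yd : ChargedPartition e, IsLevelRankDual x.1 xd ∧
      IsLevelRankDual y yd ∧ RaisesTo ℓ (j : ZMod ℓ) xd yd := ⟨xd, yd, hx, hy, hd⟩
    refine ⟨⟨y, ?_⟩, hxy⟩
    rw [← (((dual_raisesTo_iff he hl).1 hxy).isRaise (by omega)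
      (isConfig_cover he hl x.1)).descends he hl |>.sum_charge_eq]
    exact x.2

theorem exists_dual_lowersTo_iff (he : 0 < e) (hl : 2 ≤ ℓ) {j : ℤ} {x : Basis ℓ s} :
    (∃ y : Basis ℓ s, ∃ xd yd : ChargedPartition e, IsLevelRankDual x.1 xd ∧
      IsLevelRankDual y.1 yd ∧ LowersTo ℓ (j : ZMod ℓ) xd yd) ↔
      ∃ r, IsRemRow (star 1 (ℓ - 1) (cover e x.1)) j r := by
  have hl' : 0 < ℓ := by omega
  constructor
  · rintro ⟨y, xd, yd, hx, hy, h⟩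
    rw [← (isLevelRankDual_iff he hl').1 hx]
    exact (exists_lowersTo_iff hl he).1 ⟨yd, h⟩
  · intro h
    obtain ⟨xd, hx⟩ := exists_isLevelRankDual he hl' x.1
    rw [← (isLevelRankDual_iff he hl').1 hx, ← exists_lowersTo_iff hl he] at h
    obtain ⟨yd, hd⟩ := h
    obtain ⟨y, hy⟩ := exists_isLevelRankDual' he hl' yd
    have hxy : ∃ xd yd : ChargedPartition e, IsLevelRankDual x.1 xd ∧
      IsLevelRankDual y yd ∧ LowersTo ℓ (j : ZMod ℓ) xd yd := ⟨xd, yd, hx, hy, hd⟩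
    refine ⟨⟨y, ?_⟩, hxy⟩
    rw [(((dual_lowersTo_iff he hl).1 hxy).isRaise (by omega)
      (isConfig_cover he hl' y)).descends he hl' |>.sum_charge_eq]
    exact x.2

theorem Basis.ext_cover {x y : Basis ℓ s} (h : cover e x.1 = cover e y.1) : x = y :=
  Subtype.ext (cover_injective h)

/-- Commutation of partial maps needs more than compatibility with the relation: `h2` ensures that
the value `0` is not replaced by a vertex. -/
theorem partialMap_map {α : Type*} {r : α → α → Prop} {b : α → α}
    (h1 : ∀ x y, r x y → r (b x) (b y)) (hu : ∀ x y y', r x y → r x y' → y = y')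
    (h2 : ∀ x, (∃ y, r (b x) y) → ∃ y, r x y) (x : α) :
    (partialMap r x).map b = partialMap r (b x) := by
  by_cases h : ∃ y, r x y
  · obtain ⟨y, hy⟩ := h
    rw [partialMap_eq_some hy fun y' hy' => hu _ _ _ hy' hy, Option.map_some,
      partialMap_eq_some (h1 _ _ hy) fun y' hy' => hu _ _ _ hy' (h1 _ _ hy)]
  · rw [partialMap_eq_none_iff.2 h, partialMap_eq_none_iff.2 (mt (h2 x) h), Option.map_none]

theorem raisesTo_right_unique (he : 0 < e) (hl : 0 < ℓ) (i : ZMod e) (x y y' : Basis ℓ s)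
    (h : RaisesTo e i x.1 y.1) (h' : RaisesTo e i x.1 y'.1) : y = y' := by
  obtain ⟨i, rfl⟩ := ZMod.intCast_surjective i
  rw [raisesTo_iff he hl] at h h'
  exact Basis.ext_cover (h.right_unique h')

theorem lowersTo_right_unique (he : 2 ≤ e) (hl : 0 < ℓ) (i : ZMod e) (x y y' : Basis ℓ s)
    (h : LowersTo e i x.1 y.1) (h' : LowersTo e i x.1 y'.1) : y = y' := by
  obtain ⟨i, rfl⟩ := ZMod.intCast_surjective i
  rw [lowersTo_iff he hl, raisesTo_iff (by omega) hl] at h h'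
  exact Basis.ext_cover (h.left_unique (by omega) (isConfig_cover (by omega) hl _)
    (isConfig_cover (by omega) hl _) h')

theorem dual_raisesTo_right_unique (he : 0 < e) (hl : 0 < ℓ) (j : ZMod ℓ) (x y y' : Basis ℓ s)
    (h : ∃ xd yd : ChargedPartition e, IsLevelRankDual x.1 xd ∧ IsLevelRankDual y.1 yd ∧
      RaisesTo ℓ j xd yd)
    (h' : ∃ xd yd : ChargedPartition e, IsLevelRankDual x.1 xd ∧ IsLevelRankDual y'.1 yd ∧
      RaisesTo ℓ j xd yd) : y = y' := by
  obtain ⟨j, rfl⟩ := ZMod.intCast_surjective j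
  rw [dual_raisesTo_iff he hl] at h h'
  exact Basis.ext_cover (star_injective (AddRel.right_unique h h'))

theorem dual_lowersTo_right_unique (he : 0 < e) (hl : 2 ≤ ℓ) (j : ZMod ℓ) (x y y' : Basis ℓ s)
    (h : ∃ xd yd : ChargedPartition e, IsLevelRankDual x.1 xd ∧ IsLevelRankDual y.1 yd ∧
      LowersTo ℓ j xd yd)
    (h' : ∃ xd yd : ChargedPartition e, IsLevelRankDual x.1 xd ∧ IsLevelRankDual y'.1 yd ∧
      LowersTo ℓ j xd yd) : y = y' := by
  obtain ⟨j, rfl⟩ := ZMod.intCast_surjective j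
  rw [dual_lowersTo_iff he hl] at h h'
  have hc := fun z : Basis ℓ s => (isConfig_cover he (by omega) z.1).star (by omega) (by omega) 1 (ℓ - 1)
  exact Basis.ext_cover (star_injective (AddRel.left_unique (by omega) (hc y) (hc y') h h'))

variable {sigma : YoungDiagram} {b : Basis ℓ s → Basis ℓ s}

theorem isHighest_of_isDoublyHighestWeight (he : 2 ≤ e) (hl : 0 < ℓ) {x : Basis ℓ s}
    (h : IsDoublyHighestWeight e x) : IsHighest (cover e x.1) := fun i hi => by
  have h1 := h.1 (i : ZMod e)
  rw [opE, partialMap_eq_none_iff] at h1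
  exact h1 ((exists_lowersTo_basis_iff he hl).2 hi)

/-- Adding good vertical strips is a Heisenberg crystal operator. -/
theorem isHeisenbergOperator_of_cover (he : 2 ≤ e) (hl : 2 ≤ ℓ)
    (hb : ∀ x, (b x).1.charge = x.1.charge ∧
      cover e (b x).1 = pushAll sigma.rowLen (cover e x.1) (sigma.colLen 0)) :
    IsHeisenbergOperator e sigma b := by
  have he0 : 0 < e := by omega
  have hl0 : 0 < ℓ := by omega
  have he1 : (0 : ℤ) < e := by omega
  have hl1 : (0 : ℤ) < ℓ := by omega
  have he2 : (2 : ℤ) ≤ e := by omega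
  have hl2 : (2 : ℤ) ≤ ℓ := by omega
  have hf := antitone_rowLen sigma
  have hc := fun x : Basis ℓ s => isConfig_cover he0 hl0 x.1
  -- The relation is preserved in both directions of use: read from left to right it concerns the
  -- raising operators, and read from right to left the lowering ones.
  have hadd : ∀ (i : ℤ) (x y : Basis ℓ s), AddRel e ℓ i (cover e x.1) (cover e y.1) →
      AddRel e ℓ i (cover e (b x).1) (cover e (b y).1) := fun i x y h => by
    rw [(hb x).2, (hb y).2]
    exact (compatible_addRel he2 i).pushAll he1 hl1 hf _ (hc x) (hc y) h
  have hdual : ∀ (j : ℤ) (x y : Basis ℓ s), DualRel e ℓ 1 (ℓ - 1) j (cover e x.1) (cover e y.1) →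
      DualRel e ℓ 1 (ℓ - 1) j (cover e (b x).1) (cover e (b y).1) := fun j x y h => by
    rw [(hb x).2, (hb y).2]
    exact (compatible_dualRel he2 hl2 1 (ℓ - 1) j).pushAll he1 hl1 hf _ (hc x) (hc y) h
  refine ⟨fun x => (hb x).1, fun x hx => ?_, fun i => ?_, fun i => ?_, fun j => ?_, fun j => ?_⟩
  · obtain ⟨P, h1, h2⟩ := exists_isPeriodSequence he0 hl0 (isHighest_of_isDoublyHighestWeight he hl0 hx)
    exact ⟨P, h1, h2 _ _ _ hf (fun k hk => rowLen_eq_zero hk) (hb x).2⟩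
  · refine partialMap_map ?_ (raisesTo_right_unique he0 hl0 i) ?_
    · obtain ⟨i, rfl⟩ := ZMod.intCast_surjective i
      simp only [raisesTo_iff he0 hl0]
      exact hadd i
    · obtain ⟨i, rfl⟩ := ZMod.intCast_surjective i
      simp only [exists_raisesTo_basis_iff he0 hl0, (hb _).2]
      exact fun x => (hc x).exists_isAddRow_pushAll he1 hl1 hf _
  · refine partialMap_map ?_ (lowersTo_right_unique he hl0 i) ?_
    · obtain ⟨i, rfl⟩ := ZMod.intCast_surjective i
      simp only [lowersTo_iff he hl0, raisesTo_iff he0 hl0]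
      exact fun x y => hadd i y x
    · obtain ⟨i, rfl⟩ := ZMod.intCast_surjective i
      simp only [exists_lowersTo_basis_iff he hl0, (hb _).2]
      exact fun x => not_imp_not.1 ((hc x).not_exists_isRemRow_pushAll he1 hl1 hf _)
  · refine partialMap_map ?_ (dual_raisesTo_right_unique he0 hl0 j) ?_
    · obtain ⟨j, rfl⟩ := ZMod.intCast_surjective j
      simp only [dual_raisesTo_iff he0 hl0]
      exact hdual j
    · obtain ⟨j, rfl⟩ := ZMod.intCast_surjective j
      simp only [exists_dual_raisesTo_iff he0 hl0, (hb _).2]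
      exact fun x => (hc x).exists_isAddRow_star_pushAll he1 hl1 hf _
  · refine partialMap_map ?_ (dual_lowersTo_right_unique he0 hl j) ?_
    · obtain ⟨j, rfl⟩ := ZMod.intCast_surjective j
      simp only [dual_lowersTo_iff he0 hl]
      exact fun x y => hdual j y x
    · obtain ⟨j, rfl⟩ := ZMod.intCast_surjective j
      simp only [exists_dual_lowersTo_iff he0 hl, (hb _).2]
      exact fun x => (hc x).exists_isRemRow_star_pushAll he1 hl1 hf _

/-- Heisenberg crystal operators are determined by their values on doubly highest weight vertices. -/
theorem IsHeisenbergOperator.unique (he : 2 ≤ e) (hl : 2 ≤ ℓ) {b' : Basis ℓ s → Basis ℓ s}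
    (hb : IsHeisenbergOperator e sigma b) (hb' : IsHeisenbergOperator e sigma b') : b = b' := by
  have he0 : 0 < e := by omega
  have hl0 : 0 < ℓ := by omega
  suffices h : ∀ (x : ChargedPartition ℓ) (hx : ∑ j, x.charge j = s), b ⟨x, hx⟩ = b' ⟨x, hx⟩ from
    funext fun x => h x.1 x.2
  intro x
  induction x using descent_induction (e := e) hl0 with
  | h x ih =>
    intro hx
    -- On a doubly highest weight vertex the periods are unique, so the shift condition determines
    -- the value. Otherwise the vertex is a raised image of a vertex `y` below it in the descent,
    -- and commutation with the raising operator transports the equality from `y`.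
    by_cases hw : IsDoublyHighestWeight e (⟨x, hx⟩ : Basis ℓ s)
    · obtain ⟨P, hP, h⟩ := hb.shift_periods _ hw
      obtain ⟨P', hP', h'⟩ := hb'.shift_periods _ hw
      rw [hP.unique hP', ← h'] at h
      exact Subtype.ext (abacus_injective h)
    · have key : ∀ y : Basis ℓ s, IsRaise e ℓ (cover e y.1) (cover e x) → b y = b' y :=
        fun y hy => ih y.1 (hy.descends he0 hl0) y.2
      unfold IsDoublyHighestWeight at hw
      rw [not_and_or, not_forall, not_forall] at hw
      rcases hw with ⟨i, hi⟩ | ⟨j, hj⟩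
      · obtain ⟨y, hy⟩ := Option.ne_none_iff_exists'.1 hi
        obtain ⟨i, rfl⟩ := ZMod.intCast_surjective i
        have h1 := (lowersTo_iff he hl0).1 (rel_of_partialMap_eq_some
          (r := fun x y : Basis ℓ s => LowersTo e (i : ZMod e) x.1 y.1) hy)
        have h2 : opF e (i : ZMod e) y = some ⟨x, hx⟩ := partialMap_eq_some h1
          fun z hz => raisesTo_right_unique he0 hl0 _ y z ⟨x, hx⟩ hz h1
        have h3 := hb.comm_opF i y
        have h4 := hb'.comm_opF i y
        rw [raisesTo_iff he0 hl0] at h1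
        rw [h2, key y (h1.isRaise (by omega)), ← h4, h2] at h3
        exact Option.some.inj h3
      · obtain ⟨y, hy⟩ := Option.ne_none_iff_exists'.1 hj
        obtain ⟨j, rfl⟩ := ZMod.intCast_surjective j
        have h1 := rel_of_partialMap_eq_some hy
        have h2 : ∃ yd xd : ChargedPartition e, IsLevelRankDual y.1 yd ∧ IsLevelRankDual x xd ∧
            RaisesTo ℓ (j : ZMod ℓ) yd xd := by
          obtain ⟨xd, yd, hxd, hyd, h⟩ := h1
          exact ⟨yd, xd, hyd, hxd, (lowersTo_iff hl he0).1 h⟩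
        have h3 : dualF e (j : ZMod ℓ) y = some ⟨x, hx⟩ := partialMap_eq_some h2
          fun z hz => dual_raisesTo_right_unique he0 hl0 _ y z ⟨x, hx⟩ hz h2
        have h4 := hb.comm_dualF j y
        have h5 := hb'.comm_dualF j y
        rw [dual_raisesTo_iff he0 hl0] at h2
        rw [h3, key y (h2.isRaise (by omega) (isConfig_cover he0 hl0 y.1)), ← h5, h3] at h4
        exact Option.some.inj h4

end

end FockSpace

theorem theorem5p6 (e ℓ : ℕ) (he : 2 ≤ e) (hl : 2 ≤ ℓ) (s : ℤ) (sigma : YoungDiagram) :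
    (∃! b : FockSpace.Basis ℓ s → FockSpace.Basis ℓ s,
      FockSpace.IsHeisenbergOperator e sigma b) ∧
    ∀ b : FockSpace.Basis ℓ s → FockSpace.Basis ℓ s,
      FockSpace.IsHeisenbergOperator e sigma b →
        ∀ x, FockSpace.cTilde e sigma x = some (b x) := by
  choose b hb hb' hc using fun x : FockSpace.Basis ℓ s =>
    FockSpace.exists_cTilde_eq_some (by omega : 0 < e) (by omega) sigma x
  have h : FockSpace.IsHeisenbergOperator e sigma b :=
    FockSpace.isHeisenbergOperator_of_cover he hl fun x => ⟨hb x, hb' x⟩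
  exact ⟨⟨b, h, fun b' hb' => hb'.unique he hl h⟩, fun b' hb' x => by rw [hc, hb'.unique he hl h]⟩
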